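/- Let $\mathbb H^2=\{z=(z_1,z_2)\in\mathbb R^2: z_2>0\}$ be the hyperbolic plane with metric $z_2^{-2}\delta_{ij}$, area $dV_{\mathbb H}=z_2^{-2}\,dz$ and hyperbolic disks $D^{\mathbb H}_\rho(z)$; points of $\mathbb R^2$ are identified with complex numbers. A *loop* is a curve $u:\mathbb S^1\to\mathbb H^2$ of class $C^2$ whose derivative $u'$ (with respect to the angle) never vanishes; it is *embedded* if it is injective. Given $\kappa:\mathbb H^2\to\mathbb R$, a *$\kappa$-loop* is a loop whose geodesic curvature $$\frac{\langle \nabla^{\mathbb H}_{u'}u',\,iu'\rangle_{\mathbb H}}{|u'|_{\mathbb H}^3},\qquad \nabla^{\mathbb H}_{u'}u'=u''+u_2^{-1}\,i\,(u')^2,$$ equals $\kappa(u)$ at each point. For $k>1$ put $\rho_k=\operatorname{artanh}\frac1k$, and for $z\in\mathbb H^2$ let $\omega_z:\mathbb S^1\to\mathbb H^2$ be the parametrization of $\partial D^{\mathbb H}_{\rho_k}(z)$ given by $$\omega_z(x)=(z_1,0)+\frac{z_2}{k-x_2}\big(x_1,\sqrt{k^2-1}\big),\qquad x=x_1+ix_2\in\mathbb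 S^1 .$$ For an open set $A\Subset\mathbb H^2$ (that is, $\overline A$ is a compact subset of $\mathbb H^2$) and $X\in C^1(\mathbb H^2)$, we say that $X$ has a *stable critical point in $A$* if there is $r>0$ such that every real function $G$ of class $C^1$ on a neighbourhood of $\overline A$ with $\|G-X\|_{C^1(\overline A)}<r$ has a critical point in $A$. **Theorem.** Let $k>1$ and $K\in C^1(\mathbb H^2)$, and put $$F_k^K(z)=\int_{D^{\mathbb H}_{\rho_k}(z)}K\,dV_{\mathbb H},\qquad z\in\mathbb H^2 .$$ Assume that $F_k^K$ has a stable critical point in an open set $A\Subset\mathbb H^2$. Then there are $\varepsilon_0>0$ and a family $(u^\varepsilon)_{|\varepsilon|<\varepsilon_0}$ such that $u^\varepsilon$ is an embedded $(k+\varepsilon K)$-loop for every $\varepsilon\in(-\varepsilon_0,\varepsilon_0)$, and the following hold. 1. Every sequence $\varepsilon_h\to0$ has a subsequence $\varepsilon_{h_j}$ such that $u^{\varepsilon_{h_j}}\to\omega_{z_0}$ in $C^2(\mathbb S^1,\mathbb H^2)$ as $j\to\infty$, for some critical point $z_0\in\overline A$ of $F_k^K$. 2. If a point $z_0\in A$ is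 the unique critical point of $F_k^K$ in $\overline A$, then $u^\varepsilon\to\omega_{z_0}$ in $C^2(\mathbb S^1,\mathbb H^2)$ as $\varepsilon\to0$. -/

import Mathlib

open Filter Topology MeasureTheory

noncomputable section

namespace HypLoop

/-- The Poincaré half-plane, as an open subset of `ℂ = ℝ²`. -/
def halfPlane : Set ℂ := {z | 0 < z.im}

/-- The hyperbolic metric `z₂⁻² δ` at the point `p`. -/
def hypInner (p a b : ℂ) : ℝ := (a.re * b.re + a.im * b.im) / p.im ^ 2

/-- The norm of a tangent vector at `p` for the hyperbolic metric. -/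
def hypNorm (p a : ℂ) : ℝ := Real.sqrt (hypInner p a a)

/-- The open disk of center `z` and radius `ρ` for the hyperbolic distance
(Mathlib's distance on `UpperHalfPlane`). -/
def hypDisk (z : ℂ) (ρ : ℝ) : Set ℂ :=
  {w | ∃ (hw : 0 < w.im) (hz : 0 < z.im),
    dist (UpperHalfPlane.mk w hw) (UpperHalfPlane.mk z hz) < ρ}

/-- The hyperbolic radius `ρ_k` of the circles of geodesic curvature `k`. -/
def rho (k : ℝ) : ℝ := Real.artanh (1 / k)

/-- The Melnikov function: integral of `K` over the hyperbolic disk of radius `ρ_k` centred at `z`,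
with respect to the hyperbolic area `w₂⁻² dw`. -/
def melnikov (k : ℝ) (K : ℂ → ℝ) (z : ℂ) : ℝ :=
  ∫ w in hypDisk z (rho k), K w / w.im ^ 2

/-- `X` is differentiable at `z` with vanishing differential. -/
def IsCriticalPt (X : ℂ → ℝ) (z : ℂ) : Prop := HasFDerivAt X (0 : ℂ →L[ℝ] ℝ) z

/-- `A ⋐ ℍ²` for an open set `A`. -/
def CompactlyInside (A : Set ℂ) : Prop :=
  IsOpen A ∧ IsCompact (closure A) ∧ closure A ⊆ halfPlane

/-- The norm of `C¹(closure A)`. -/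
def c1Norm (A : Set ℂ) (f : ℂ → ℝ) : ℝ :=
  sSup ((fun z => |f z|) '' closure A) + sSup ((fun z => ‖fderiv ℝ f z‖) '' closure A)

/-- `X` has a stable critical point in `A`: every function `G` of class `C¹` (on an open
neighbourhood of the closure of `A`) that is `C¹(closure A)`-close to `X` has a critical point
in `A`. -/
def HasStableCriticalPt (X : ℂ → ℝ) (A : Set ℂ) : Prop :=
  ∃ r : ℝ, 0 < r ∧ ∀ G : ℂ → ℝ,
    (∃ U : Set ℂ, IsOpen U ∧ closure A ⊆ U ∧ ContDiffOn ℝ 1 G U) →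
    c1Norm A (fun z => G z - X z) < r → ∃ z ∈ A, IsCriticalPt G z

/-- A function on the circle in the angular variable. The derivative `f'(x) = f'(x)(ix)` at
`x = exp (iθ)` is the derivative of `lift f` at `θ`. -/
def lift (u : Circle → ℂ) (θ : ℝ) : ℂ := u (Circle.exp θ)

/-- A loop: a curve `𝕊¹ → ℍ²` of class `C²` with nowhere vanishing derivative. -/
structure IsLoop (u : Circle → ℂ) : Prop where
  mem_halfPlane : ∀ x, u x ∈ halfPlane
  contDiff : ContDiff ℝ 2 (lift u)
  regular : ∀ θ, deriv (lift u) θ ≠ 0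

/-- The Levi-Civita covariant derivative `∇_{u'} u' = u'' - u₂⁻¹ Γ(u')`, where `Γ(z) = - i z²`. -/
def covDeriv (u : Circle → ℂ) (θ : ℝ) : ℂ :=
  deriv (deriv (lift u)) θ
    - ((lift u θ).im : ℂ)⁻¹ * (-(Complex.I * deriv (lift u) θ ^ 2))

/-- The geodesic curvature `⟨∇_{u'} u', i u'⟩ / |u'|³` at `exp (iθ)`. -/
def geodCurv (u : Circle → ℂ) (θ : ℝ) : ℝ :=
  hypInner (lift u θ) (covDeriv u θ) (Complex.I * deriv (lift u) θ)
    / hypNorm (lift u θ) (deriv (lift u) θ) ^ 3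

/-- An embedded `K`-loop: an injective loop whose geodesic curvature at each of its points is the
value of `K` there. -/
def IsEmbeddedKLoop (K : ℂ → ℝ) (u : Circle → ℂ) : Prop :=
  IsLoop u ∧ Function.Injective u ∧ ∀ θ : ℝ, geodCurv u θ = K (lift u θ)

/-- The Euclidean radius `R_k = sinh ρ_k = (k² - 1)^{-1/2}`. -/
def eucRadius (k : ℝ) : ℝ := 1 / Real.sqrt (k ^ 2 - 1)

/-- The reference loop `ω(x) = (k - x₂)⁻¹ (x₁, 1 / R_k)`. -/
def omega (k : ℝ) (x : Circle) : ℂ :=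
  ((1 / (k - (x : ℂ).im) : ℝ) : ℂ) * ⟨(x : ℂ).re, 1 / eucRadius k⟩

/-- The translated reference loop `ω_z = z₁ e₁ + z₂ ω`. -/
def omegaAt (k : ℝ) (z : ℂ) (x : Circle) : ℂ := (z.re : ℂ) + (z.im : ℂ) * omega k x

/-- Convergence in `C²(𝕊¹, ℝ²)`: uniform convergence of the derivatives up to order two. -/
def C2Tendsto {ι : Type*} (u : ι → Circle → ℂ) (l : Filter ι) (v : Circle → ℂ) : Prop :=
  ∀ j : ℕ, j ≤ 2 →
    TendstoUniformly (fun i => iteratedDeriv j (lift (u i))) (iteratedDeriv j (lift v)) l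

end HypLoop

end

noncomputable section

namespace HypLoop

/-! ### Periodic primitives and a fixed point scheme on `C(Circle, ℂ)` -/

/-! A loop is sought in the form `u(x) = ω_{q(x)}(x)` with an unknown map `q` from the circle to the
half-plane. The tangent of `u` at `x` is required to be parallel to that of the reference circle, so
that `q(x)` is the centre of the circle of curvature `k` tangent to `u` there. With `κ = K(u)`, `s²
= k² - 1` and `w = s² + ε κ (k - x₂)`, the curvature equation then becomes the first order equation
`q' = -ε (κ q₂ / w) i x` (`IsSolution`, `IsSolution.loopVel_eq`, `IsSolution.geodCurv_eq`).

The only obstruction to periodic solutions is the mean of the right-hand side. Adding `c q₂² / w`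
with a constant vector `c` removes it, and a contraction argument gives for each `z` a solution
`q_z` of mean `z` with multiplier `c(z)` (`exists_reduced_solution`). The problem is variational:
`action` has first variation `∫ det(ξ, g)` with density `g = gradDensity`, and the modified equation
says exactly that `g` is the constant `c(z)`. The derivative of the action along the family
therefore sees only the mean of the variation, and equals `det(·, 2π c(z))`
(`hasFDerivAt_reduced_action`). A quadratic remainder bound (`exists_abs_action_sub_le`) makes
Lipschitz dependence of `q_z` on `z` sufficient, so that `K` of class `C¹` is enough.

On constant maps the action with parameter `1` is `s` times the Melnikov function, by a Green
formula on disks (`melnikov_eq_encArea`). This gives the differential of the Melnikov function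
through `bdry`, and `2π c(z) = ε bdry(z) + O(ε²)` (`norm_multiplier_sub_bdry_le`). Divided by `ε s`
and shifted by a constant, the reduced action is thus `C¹`-close to the Melnikov function. Stability
yields a centre `z` in `A` with `c(z) = 0`, hence a genuine solution (`exists_solution`).

The solution has `q = z + O(ε)` and `q' = O(ε)`. This gives injectivity (`injective_of_norm_vel_le`)
and `C²` closeness to `ω_z` (`exists_C2_bound`). As `bdry(z) = O(ε)` too, every limit of the centres
is critical, and compactness of the closure of `A` gives the two convergence statements. `K` is
first cut off outside a compact set containing all relevant disks and circles (`exists_truncation`).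
-/

lemma circleExp_isQuotientMap : IsQuotientMap Circle.exp :=
  (isLocalHomeomorph_circleExp.isOpenMap).isQuotientMap Circle.exp.continuous Circle.exp_surjective

lemma circleExp_periodic : Function.Periodic Circle.exp (2 * Real.pi) := Circle.periodic_exp

/-- A continuous `2π`-periodic function descends to the circle. -/
lemma exists_continuousMap_circle {f : ℝ → ℂ} (hf : Continuous f)
    (hp : Function.Periodic f (2 * Real.pi)) :
    ∃ g : C(Circle, ℂ), ∀ t, g (Circle.exp t) = f t := by
  have key : ∀ t, f (Complex.arg (Circle.exp t)) = f t := by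
    intro t
    have h : Circle.exp (Complex.arg (Circle.exp t)) = Circle.exp t := Circle.exp_arg _
    obtain ⟨m, hm⟩ := Circle.exp_eq_exp.1 h
    rw [hm]
    exact (hp.int_mul m) t
  -- `Complex.arg` jumps on the circle, so continuity is tested after composition with the quotient
  -- map `Circle.exp`, where the function is `f` again.
  refine ⟨⟨fun x => f (Complex.arg x), ?_⟩, key⟩
  rw [circleExp_isQuotientMap.continuous_iff]
  convert hf using 1
  funext t
  exact key t

/-- The integral over the circle with respect to the angle. -/
def cint {E : Type*} [NormedAddCommGroup E] [NormedSpace ℝ E] (g : Circle → E) : E :=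
  ∫ t in (0 : ℝ)..(2 * Real.pi), g (Circle.exp t)

lemma norm_cint_le {E : Type*} [NormedAddCommGroup E] [NormedSpace ℝ E] {g : Circle → E} {C : ℝ}
    (h : ∀ x, ‖g x‖ ≤ C) : ‖cint g‖ ≤ C * (2 * Real.pi) := by
  have := intervalIntegral.norm_integral_le_of_norm_le_const (a := 0) (b := 2 * Real.pi)
    (f := fun t => g (Circle.exp t)) (C := C) (fun t _ => h _)
  rwa [sub_zero, abs_of_pos Real.two_pi_pos] at this

lemma cint_sub {E : Type*} [NormedAddCommGroup E] [NormedSpace ℝ E] {g h : Circle → E}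
    (hg : Continuous g) (hh : Continuous h) : cint (fun x => g x - h x) = cint g - cint h :=
  intervalIntegral.integral_sub
    ((hg.comp Circle.exp.continuous).intervalIntegrable _ _)
    ((hh.comp Circle.exp.continuous).intervalIntegrable _ _)

lemma cint_add {E : Type*} [NormedAddCommGroup E] [NormedSpace ℝ E] {g h : Circle → E}
    (hg : Continuous g) (hh : Continuous h) : cint (fun x => g x + h x) = cint g + cint h :=
  intervalIntegral.integral_add
    ((hg.comp Circle.exp.continuous).intervalIntegrable _ _)
    ((hh.comp Circle.exp.continuous).intervalIntegrable _ _)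

/-- `v` is the primitive of `n` with zero mean. -/
def IsZeroMeanPrimitive (n v : C(Circle, ℂ)) : Prop :=
  ∀ t, v (Circle.exp t) = (∫ r in (0 : ℝ)..t, n (Circle.exp r))
    - ((2 * Real.pi : ℝ) : ℂ)⁻¹ * ∫ t in (0 : ℝ)..(2 * Real.pi),
        ∫ r in (0 : ℝ)..t, n (Circle.exp r)

lemma exists_isZeroMeanPrimitive (n : C(Circle, ℂ)) (hn : cint n = 0) :
    ∃ v, IsZeroMeanPrimitive n v := by
  have hc : Continuous fun r => n (Circle.exp r) := n.continuous.comp Circle.exp.continuous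
  have hcont : Continuous fun t : ℝ => ∫ r in (0 : ℝ)..t, n (Circle.exp r) :=
    intervalIntegral.continuous_primitive (fun a b => hc.intervalIntegrable a b) 0
  refine exists_continuousMap_circle (hcont.sub continuous_const) ?_
  intro t
  have hper : Function.Periodic (fun r => n (Circle.exp r)) (2 * Real.pi) := fun r => by
    simp only [circleExp_periodic r]
  have h1 : (∫ r in (0 : ℝ)..(t + 2 * Real.pi), n (Circle.exp r)) =
      ∫ r in (0 : ℝ)..t, n (Circle.exp r) := by
    rw [← intervalIntegral.integral_add_adjacent_intervals (b := t) (hc.intervalIntegrable _ _)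
      (hc.intervalIntegrable _ _), hper.intervalIntegral_add_eq t 0, zero_add]
    have : (∫ r in (0 : ℝ)..(2 * Real.pi), n (Circle.exp r)) = 0 := hn
    rw [this, add_zero]
  simp only [h1]

lemma IsZeroMeanPrimitive.hasDerivAt {n v : C(Circle, ℂ)} (h : IsZeroMeanPrimitive n v) (t : ℝ) :
    HasDerivAt (fun t => v (Circle.exp t)) (n (Circle.exp t)) t := by
  have hc : Continuous fun r => n (Circle.exp r) := n.continuous.comp Circle.exp.continuous
  have := (intervalIntegral.integral_hasDerivAt_right (hc.intervalIntegrable 0 t)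
    (hc.stronglyMeasurableAtFilter _ _) hc.continuousAt).sub_const (((2 * Real.pi : ℝ) : ℂ)⁻¹ *
      ∫ t in (0 : ℝ)..(2 * Real.pi), ∫ r in (0 : ℝ)..t, n (Circle.exp r))
  exact this.congr_of_eventuallyEq (Eventually.of_forall fun t => h t)

lemma IsZeroMeanPrimitive.cint_eq_zero {n v : C(Circle, ℂ)} (h : IsZeroMeanPrimitive n v) :
    cint v = 0 := by
  have hc : Continuous fun r => n (Circle.exp r) := n.continuous.comp Circle.exp.continuous
  have hcont : Continuous fun t : ℝ => ∫ r in (0 : ℝ)..t, n (Circle.exp r) :=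
    intervalIntegral.continuous_primitive (fun a b => hc.intervalIntegrable a b) 0
  unfold cint
  simp only [h _]
  rw [intervalIntegral.integral_sub (hcont.intervalIntegrable _ _) (by simp),
    intervalIntegral.integral_const]
  have h2 : ((2 * Real.pi : ℝ) : ℂ) ≠ 0 := by exact_mod_cast Real.two_pi_pos.ne'
  rw [sub_zero, Complex.real_smul, mul_inv_cancel_left₀ h2, sub_self]

lemma IsZeroMeanPrimitive.sub {n v n' v' : C(Circle, ℂ)} (h : IsZeroMeanPrimitive n v)
    (h' : IsZeroMeanPrimitive n' v') : IsZeroMeanPrimitive (n - n') (v - v') := by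
  have hc : Continuous fun r => n (Circle.exp r) := n.continuous.comp Circle.exp.continuous
  have hc' : Continuous fun r => n' (Circle.exp r) := n'.continuous.comp Circle.exp.continuous
  have hcont : Continuous fun t : ℝ => ∫ r in (0 : ℝ)..t, n (Circle.exp r) :=
    intervalIntegral.continuous_primitive (fun a b => hc.intervalIntegrable a b) 0
  have hcont' : Continuous fun t : ℝ => ∫ r in (0 : ℝ)..t, n' (Circle.exp r) :=
    intervalIntegral.continuous_primitive (fun a b => hc'.intervalIntegrable a b) 0
  intro t
  simp only [ContinuousMap.sub_apply, h t, h' t]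
  have e : ∀ t : ℝ, (∫ r in (0 : ℝ)..t, (n (Circle.exp r) - n' (Circle.exp r))) =
      (∫ r in (0 : ℝ)..t, n (Circle.exp r)) - ∫ r in (0 : ℝ)..t, n' (Circle.exp r) := fun t =>
    intervalIntegral.integral_sub (hc.intervalIntegrable _ _) (hc'.intervalIntegrable _ _)
  simp only [e]
  rw [intervalIntegral.integral_sub (hcont.intervalIntegrable _ _) (hcont'.intervalIntegrable _ _)]
  ring

lemma exists_angle (x : Circle) : ∃ t ∈ Set.Icc 0 (2 * Real.pi), Circle.exp t = x := by
  have h := circleExp_periodic.image_Icc Real.two_pi_pos 0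
  rw [Circle.exp_surjective.range_eq, zero_add] at h
  obtain ⟨t, ht, e⟩ := h.symm ▸ Set.mem_univ x
  exact ⟨t, ht, e⟩

/-- The primitive from `0` costs a factor `2π` on one period, and subtracting its mean costs another
`2π`. -/
lemma IsZeroMeanPrimitive.norm_le {n v : C(Circle, ℂ)} (h : IsZeroMeanPrimitive n v) :
    ‖v‖ ≤ 4 * Real.pi * ‖n‖ := by
  have hpi := Real.two_pi_pos
  have hprim : ∀ t ∈ Set.Icc 0 (2 * Real.pi),
      ‖∫ r in (0 : ℝ)..t, n (Circle.exp r)‖ ≤ ‖n‖ * (2 * Real.pi) := by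
    intro t ht
    refine (intervalIntegral.norm_integral_le_of_norm_le_const
      (C := ‖n‖) fun r _ => n.norm_coe_le_norm _).trans ?_
    rw [sub_zero, abs_of_nonneg ht.1]
    exact mul_le_mul_of_nonneg_left ht.2 (norm_nonneg _)
  rw [ContinuousMap.norm_le _ (by positivity)]
  intro x
  obtain ⟨t, ht, rfl⟩ := exists_angle x
  rw [h t]
  refine (norm_sub_le _ _).trans ?_
  have h2 : ‖∫ t in (0 : ℝ)..(2 * Real.pi), ∫ r in (0 : ℝ)..t, n (Circle.exp r)‖
      ≤ ‖n‖ * (2 * Real.pi) * (2 * Real.pi) := by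
    have := intervalIntegral.norm_integral_le_of_norm_le_const (a := 0) (b := 2 * Real.pi)
      (f := fun t => ∫ r in (0 : ℝ)..t, n (Circle.exp r)) (C := ‖n‖ * (2 * Real.pi)) (by
        intro t ht
        rw [Set.uIoc_of_le hpi.le] at ht
        exact hprim t ⟨ht.1.le, ht.2⟩)
    rwa [sub_zero, abs_of_pos hpi] at this
  have h3 : ‖((2 * Real.pi : ℝ) : ℂ)⁻¹ * ∫ t in (0 : ℝ)..(2 * Real.pi),
        ∫ r in (0 : ℝ)..t, n (Circle.exp r)‖ ≤ ‖n‖ * (2 * Real.pi) := by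
    rw [norm_mul, norm_inv, Complex.norm_real, Real.norm_of_nonneg hpi.le,
      inv_mul_le_iff₀ hpi]
    linarith
  linarith [hprim t ht]

/-- Solutions of `q' = N q` with prescribed mean `z`, for a nonlinearity `N` with zero mean,
small and with small Lipschitz constant. -/
lemma exists_periodic_solution (N : C(Circle, ℂ) → C(Circle, ℂ)) (hN : ∀ q, cint (N q) = 0)
    {l : ℝ} (hl : 4 * Real.pi * l ≤ 1 / 2) (hlip : ∀ q q', ‖N q - N q'‖ ≤ l * ‖q - q'‖) :
    ∃ q : ℂ → C(Circle, ℂ), (∀ z t, HasDerivAt (fun t => q z (Circle.exp t))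
        (N (q z) (Circle.exp t)) t) ∧
      (∀ z, cint (q z) = 2 * Real.pi * z) ∧
      (∀ z x, ‖q z x - z‖ ≤ 4 * Real.pi * ‖N (q z)‖) ∧
      (∀ z z', ‖q z - q z'‖ ≤ 2 * ‖z - z'‖) := by
  choose V hV using fun q => exists_isZeroMeanPrimitive (N q) (hN q)
  have hVlip : ∀ q q', ‖V q - V q'‖ ≤ 1 / 2 * ‖q - q'‖ := fun q q' => by
    refine ((hV q).sub (hV q')).norm_le.trans ?_
    calc 4 * Real.pi * ‖N q - N q'‖ ≤ 4 * Real.pi * (l * ‖q - q'‖) := by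
          gcongr; exact hlip q q'
      _ = (4 * Real.pi * l) * ‖q - q'‖ := by ring
      _ ≤ _ := by gcongr
  -- Since `V q` has zero mean, a fixed point of `T z` automatically has mean `z`.
  let T : ℂ → C(Circle, ℂ) → C(Circle, ℂ) := fun z q => ContinuousMap.const _ z + V q
  have hT : ∀ z, ContractingWith (1 / 2 : NNReal) (T z) := fun z => by
    refine ⟨by rw [← NNReal.coe_lt_coe]; norm_num, LipschitzWith.of_dist_le_mul fun q q' => ?_⟩
    simp only [T, dist_eq_norm, add_sub_add_left_eq_sub]
    simpa using hVlip q q'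
  obtain ⟨q, hfix⟩ : ∃ q : ℂ → C(Circle, ℂ), ∀ z x, q z x = z + V (q z) x :=
    ⟨fun z => (hT z).fixedPoint, fun z x =>
      (DFunLike.congr_fun (hT z).fixedPoint_isFixedPt x).symm⟩
  refine ⟨q, ?_, ?_, ?_, ?_⟩
  · intro z t
    exact (((hV (q z)).hasDerivAt t).const_add z).congr_of_eventuallyEq
      (Eventually.of_forall fun t => hfix z _)
  · intro z
    have h1 := (hV (q z)).cint_eq_zero
    have h2 : cint (q z) = cint (fun x => z + V (q z) x) := congrArg cint (funext (hfix z))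
    rw [h2, cint_add continuous_const (ContinuousMap.continuous _), h1]
    simp [cint]
  · intro z x
    rw [hfix z x, add_sub_cancel_left]
    exact ((V _).norm_coe_le_norm x).trans (hV (q z)).norm_le
  · intro z z'
    have h1 := hVlip (q z) (q z')
    have h2 : ‖q z - q z'‖ ≤ ‖z - z'‖ + ‖V (q z) - V (q z')‖ := by
      rw [ContinuousMap.norm_le _ (by positivity)]
      intro x
      have : (q z - q z') x = (z - z') + (V (q z) - V (q z')) x := by
        rw [ContinuousMap.sub_apply, ContinuousMap.sub_apply, hfix z x, hfix z' x]
        ring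
      rw [this]
      exact (norm_add_le _ _).trans (by gcongr; exact ContinuousMap.norm_coe_le_norm _ x)
    linarith

/-! ### Primitives of area forms and the first variation of the enclosed area -/

lemma hasFDerivAt_intervalIntegral {E : Type*} [NormedAddCommGroup E] [NormedSpace ℝ E]
    [ProperSpace E] {Φ : E → ℝ → ℝ} {Φ' : E → ℝ → E →L[ℝ] ℝ}
    (hΦ : ∀ x, Continuous (Φ x)) (hΦ' : Continuous (Function.uncurry Φ'))
    (h : ∀ x t, HasFDerivAt (fun x => Φ x t) (Φ' x t) x) (a b : ℝ) (x₀ : E) :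
    HasFDerivAt (fun x => ∫ t in a..b, Φ x t) (∫ t in a..b, Φ' x₀ t) x₀ := by
  obtain ⟨C, hC⟩ := ((isCompact_closedBall x₀ 1).prod
    (isCompact_uIcc (a := a) (b := b))).exists_bound_of_continuousOn hΦ'.continuousOn
  refine intervalIntegral.hasFDerivAt_integral_of_dominated_of_fderiv_le
    (s := Metric.closedBall x₀ 1) (bound := fun _ => C) (F' := Φ')
    (Metric.closedBall_mem_nhds x₀ one_pos) ?_ ?_ ?_ ?_ ?_ ?_
  · exact Eventually.of_forall fun x => (hΦ x).aestronglyMeasurable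
  · exact (hΦ x₀).intervalIntegrable _ _
  · exact (hΦ'.comp (Continuous.prodMk_right x₀)).aestronglyMeasurable
  · exact Eventually.of_forall fun t ht x hx => hC (x, t) ⟨hx, Set.uIoc_subset_uIcc ht⟩
  · simp
  · exact Eventually.of_forall fun t _ x _ => h x t

/-- The coefficient of `dx` in a primitive of the area form `f dx ∧ dy`. -/
def potential (f : ℂ → ℝ) (z : ℂ) : ℝ :=
  -∫ t in (0 : ℝ)..1, z.im * f (z.re + (t * z.im : ℝ) * Complex.I)

/-- The linear map `z ↦ x + t i y`. -/
def squeeze (t : ℝ) : ℂ →L[ℝ] ℂ :=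
  Complex.ofRealCLM.comp Complex.reCLM +
    (t : ℝ) • (Complex.I • (Complex.ofRealCLM.comp Complex.imCLM) : ℂ →L[ℝ] ℂ)

lemma squeeze_apply (t : ℝ) (z : ℂ) : squeeze t z = z.re + (t * z.im : ℝ) * Complex.I := by
  simp [squeeze]; ring

lemma continuous_squeeze : Continuous squeeze := by
  unfold squeeze; fun_prop

lemma contDiff_potential {f : ℂ → ℝ} (hf : ContDiff ℝ 1 f) : ContDiff ℝ 1 (potential f) := by
  have hfd : Continuous (fderiv ℝ f) := hf.continuous_fderiv (by norm_num)
  have hfc := hf.continuous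
  let Φ : ℂ → ℝ → ℝ := fun z t => z.im * f (squeeze t z)
  let Φ' : ℂ → ℝ → ℂ →L[ℝ] ℝ := fun z t =>
    z.im • (fderiv ℝ f (squeeze t z)).comp (squeeze t) + f (squeeze t z) • Complex.imCLM
  have hsq : Continuous fun p : ℂ × ℝ => squeeze p.2 p.1 := by
    simp only [squeeze_apply]; fun_prop
  have hc : Continuous (Function.uncurry Φ') := by
    have h1 : Continuous fun p : ℂ × ℝ => squeeze p.2 := continuous_squeeze.comp continuous_snd
    have h2 : Continuous fun p : ℂ × ℝ => fderiv ℝ f (squeeze p.2 p.1) := hfd.comp hsq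
    have h3 : Continuous fun p : ℂ × ℝ => f (squeeze p.2 p.1) := hfc.comp hsq
    exact ((Complex.continuous_im.comp continuous_fst).smul (h2.clm_comp h1)).add
      (h3.smul continuous_const)
  have hd : ∀ z t, HasFDerivAt (fun z => Φ z t) (Φ' z t) z := fun z t => by
    have h1 : HasFDerivAt (fun z => f (squeeze t z))
        ((fderiv ℝ f (squeeze t z)).comp (squeeze t)) z :=
      ((hf.differentiable (by norm_num)) _).hasFDerivAt.comp z (squeeze t).hasFDerivAt
    exact (Complex.imCLM.hasFDerivAt (x := z)).mul h1
  have hΦc : ∀ z, Continuous (Φ z) := fun z =>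
    continuous_const.mul (hfc.comp (hsq.comp (Continuous.prodMk_right z)))
  have key : ∀ z, HasFDerivAt (potential f) (-∫ t in (0 : ℝ)..1, Φ' z t) z := fun z => by
    have := (hasFDerivAt_intervalIntegral hΦc hc hd 0 1 z).neg
    refine this.congr_of_eventuallyEq (Eventually.of_forall fun w => ?_)
    simp only [potential, Φ, squeeze_apply]; rfl
  refine contDiff_one_iff_hasFDerivAt.2 ⟨_, ?_, key⟩
  exact (intervalIntegral.continuous_parametric_intervalIntegral_of_continuous' hc 0 1).neg

/-- Undoing the rescaling to the fixed interval `[0, 1]`, which served to differentiate under the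
integral, leaves a form whose vertical derivative is read off from the fundamental theorem of
calculus. -/
lemma potential_eq (f : ℂ → ℝ) (x y : ℝ) :
    potential f (x + y * Complex.I) = -∫ t in (0 : ℝ)..y, f (x + t * Complex.I) := by
  have := intervalIntegral.smul_integral_comp_mul_right (a := 0) (b := 1)
    (fun t : ℝ => f (x + t * Complex.I)) y
  simp only [zero_mul, one_mul, smul_eq_mul] at this
  simp only [potential, ← this]
  simp

lemma fderiv_potential_I {f : ℂ → ℝ} (hf : ContDiff ℝ 1 f) (z : ℂ) :
    fderiv ℝ (potential f) z Complex.I = -f z := by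
  have h1 : HasFDerivAt (potential f) (fderiv ℝ (potential f) z) z :=
    ((contDiff_potential hf).differentiable (by norm_num) z).hasFDerivAt
  have h2 : HasDerivAt (fun y : ℝ => (z.re : ℂ) + y * Complex.I) Complex.I z.im := by
    simpa using ((Complex.ofRealCLM.hasDerivAt (x := z.im)).mul_const Complex.I).const_add
      (z.re : ℂ)
  have h3 : HasDerivAt (fun y : ℝ => potential f (z.re + y * Complex.I))
      (fderiv ℝ (potential f) z Complex.I) z.im := by
    have h5 : HasFDerivAt (potential f) (fderiv ℝ (potential f) z) (z.re + z.im * Complex.I) := by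
      rwa [Complex.re_add_im]
    exact h5.comp_hasDerivAt z.im h2
  have hc : Continuous fun t : ℝ => f (z.re + t * Complex.I) := by
    have := hf.continuous
    fun_prop
  have h4 := (intervalIntegral.integral_hasDerivAt_right (hc.intervalIntegrable 0 z.im)
    (hc.stronglyMeasurableAtFilter _ _) hc.continuousAt).neg
  simp only [potential_eq] at h3
  have := h3.unique h4
  rwa [Complex.re_add_im] at this

/-- The determinant of two plane vectors. -/
def det2 (a b : ℂ) : ℝ := a.re * b.im - a.im * b.re

lemma abs_det2_le (a b : ℂ) : |det2 a b| ≤ 2 * ‖a‖ * ‖b‖ := by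
  have h1 := Complex.abs_re_le_norm a
  have h2 := Complex.abs_im_le_norm a
  have h3 := Complex.abs_re_le_norm b
  have h4 := Complex.abs_im_le_norm b
  calc |det2 a b| ≤ |a.re * b.im| + |a.im * b.re| := abs_sub _ _
    _ = |a.re| * |b.im| + |a.im| * |b.re| := by rw [abs_mul, abs_mul]
    _ ≤ ‖a‖ * ‖b‖ + ‖a‖ * ‖b‖ := by gcongr
    _ = _ := by ring

lemma clm_apply_eq (T : ℂ →L[ℝ] ℝ) (a : ℂ) : T a = a.re * T 1 + a.im * T Complex.I := by
  conv_lhs => rw [← Complex.re_add_im a]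
  have h1 : (a.re : ℂ) = a.re • (1 : ℂ) := by simp
  have h2 : (a.im : ℂ) * Complex.I = a.im • Complex.I := by simp
  rw [h1, h2, map_add, map_smul, map_smul]
  rfl

/-- The integral over a closed curve of the primitive of the area form `f dx ∧ dy`. -/
def encArea (f : ℂ → ℝ) (u u' : ℝ → ℂ) : ℝ :=
  ∫ t in (0 : ℝ)..(2 * Real.pi), potential f (u t) * (u' t).re

lemma hasDerivAt_re {u : ℝ → ℂ} {v : ℂ} {t : ℝ} (h : HasDerivAt u v t) :
    HasDerivAt (fun t => (u t).re) v.re t := Complex.reCLM.hasFDerivAt.comp_hasDerivAt t h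

lemma hasDerivAt_im {u : ℝ → ℂ} {v : ℂ} {t : ℝ} (h : HasDerivAt u v t) :
    HasDerivAt (fun t => (u t).im) v.im t := Complex.imCLM.hasFDerivAt.comp_hasDerivAt t h

/-- First variation of the enclosed area. -/
lemma hasDerivAt_encArea {f : ℂ → ℝ} (hf : ContDiff ℝ 1 f) {u u' ξ ξ' : ℝ → ℂ}
    (hu : ∀ t, HasDerivAt u (u' t) t) (hu' : Continuous u')
    (hξ : ∀ t, HasDerivAt ξ (ξ' t) t) (hξ' : Continuous ξ')
    (hup : u (2 * Real.pi) = u 0) (hξp : ξ (2 * Real.pi) = ξ 0) (r : ℝ) :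
    HasDerivAt (fun r : ℝ => encArea f (fun t => u t + r * ξ t) (fun t => u' t + r * ξ' t))
      (∫ t in (0 : ℝ)..(2 * Real.pi),
        f (u t + r * ξ t) * det2 (ξ t) (u' t + r * ξ' t)) r := by
  have huc : Continuous u := continuous_iff_continuousAt.2 fun t => (hu t).continuousAt
  have hξc : Continuous ξ := continuous_iff_continuousAt.2 fun t => (hξ t).continuousAt
  set b := potential f with hb
  have hbC : ContDiff ℝ 1 b := contDiff_potential hf
  have hbc := hbC.continuous
  have hbd : Continuous (fderiv ℝ b) := hbC.continuous_fderiv (by norm_num)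
  have hbD : ∀ z, HasFDerivAt b (fderiv ℝ b z) z := fun z =>
    (hbC.differentiable (by norm_num) z).hasFDerivAt
  let Φ : ℝ → ℝ → ℝ := fun r t => b (u t + r * ξ t) * (u' t + r * ξ' t).re
  let d : ℝ → ℝ → ℝ := fun r t => fderiv ℝ b (u t + r * ξ t) (ξ t) * (u' t + r * ξ' t).re +
    b (u t + r * ξ t) * (ξ' t).re
  have hline : ∀ (a v : ℂ) (r : ℝ), HasDerivAt (fun r : ℝ => a + r * v) v r := fun a v r => by
    simpa using ((Complex.ofRealCLM.hasDerivAt (x := r)).mul_const v).const_add a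
  have hd : ∀ r t, HasDerivAt (fun r => Φ r t) (d r t) r := fun r t =>
    ((hbD _).comp_hasDerivAt r (hline (u t) (ξ t) r)).mul
      (hasDerivAt_re (hline (u' t) (ξ' t) r))
  have hdc : Continuous (Function.uncurry d) := by
    have h1 : Continuous fun p : ℝ × ℝ => fderiv ℝ b (u p.2 + p.1 * ξ p.2) (ξ p.2) :=
      (hbd.comp (by fun_prop)).clm_apply (by fun_prop)
    have h2 : Continuous fun p : ℝ × ℝ => (u' p.2 + p.1 * ξ' p.2).re :=
      Complex.continuous_re.comp (by fun_prop)
    have h3 : Continuous fun p : ℝ × ℝ => (ξ' p.2).re := Complex.continuous_re.comp (by fun_prop)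
    have h4 : Continuous fun p : ℝ × ℝ => b (u p.2 + p.1 * ξ p.2) := hbc.comp (by fun_prop)
    exact (h1.mul h2).add (h4.mul h3)
  have hΦc : ∀ r, Continuous (Φ r) := fun r =>
    (hbc.comp (by fun_prop)).mul (Complex.continuous_re.comp (by fun_prop))
  have hmain := hasFDerivAt_intervalIntegral (Φ := Φ)
    (Φ' := fun r t => ContinuousLinearMap.toSpanSingleton ℝ (d r t)) hΦc (by
      exact (ContinuousLinearMap.toSpanSingletonCLE (𝕜 := ℝ) (E := ℝ)).continuous.comp hdc)
      (fun r t => (hd r t).hasFDerivAt) 0 (2 * Real.pi) r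
  have hmain' := hmain.hasDerivAt
  rw [ContinuousLinearMap.intervalIntegral_apply (by
    refine Continuous.intervalIntegrable ?_ _ _
    exact (ContinuousLinearMap.toSpanSingletonCLE (𝕜 := ℝ) (E := ℝ)).continuous.comp
      (hdc.comp (Continuous.prodMk_right r)))] at hmain'
  simp only [ContinuousLinearMap.toSpanSingleton_apply, one_smul] at hmain'
  refine HasDerivAt.congr_deriv (f := fun r : ℝ =>
    encArea f (fun t => u t + r * ξ t) (fun t => u' t + r * ξ' t)) hmain' ?_
  set v : ℝ → ℂ := fun t => u t + r * ξ t with hv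
  set v' : ℝ → ℂ := fun t => u' t + r * ξ' t with hv'
  have hvd : ∀ t, HasDerivAt v (v' t) t := fun t => (hu t).add ((hξ t).const_mul _)
  have hvc : Continuous v := by fun_prop
  have hvc' : Continuous v' := by fun_prop
  have hprod : ∀ t, HasDerivAt (fun t => b (v t) * (ξ t).re)
      (fderiv ℝ b (v t) (v' t) * (ξ t).re + b (v t) * (ξ' t).re) t := fun t =>
    ((hbD _).comp_hasDerivAt t (hvd t)).mul (hasDerivAt_re (hξ t))
  have hpc : Continuous fun t => fderiv ℝ b (v t) (v' t) * (ξ t).re + b (v t) * (ξ' t).re :=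
    (((hbd.comp hvc).clm_apply hvc').mul (Complex.continuous_re.comp hξc)).add
      ((hbc.comp hvc).mul (Complex.continuous_re.comp hξ'))
  -- The derivative of the periodic function `b(v) ξ₁` has zero integral. Subtracting it from the
  -- integrand cancels the derivatives of `ξ` and the horizontal derivative of `b`; what remains
  -- involves only the vertical derivative `-f`.
  have hzero : ∫ t in (0 : ℝ)..(2 * Real.pi),
      (fderiv ℝ b (v t) (v' t) * (ξ t).re + b (v t) * (ξ' t).re) = 0 := by
    rw [intervalIntegral.integral_eq_sub_of_hasDerivAt (fun t _ => hprod t)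
      (hpc.intervalIntegrable _ _)]
    simp [hv, hup, hξp]
  have hdr : Continuous (d r) := hdc.comp (Continuous.prodMk_right r)
  have hs := intervalIntegral.integral_sub (hdr.intervalIntegrable (μ := volume) 0 (2 * Real.pi))
    (hpc.intervalIntegrable _ _)
  rw [hzero, sub_zero] at hs
  rw [← hs]
  refine intervalIntegral.integral_congr fun t _ => ?_
  have e := fderiv_potential_I hf (v t)
  simp only [d]
  rw [clm_apply_eq _ (ξ t), clm_apply_eq _ (v' t)]
  simp only [hv, hv', ← hb] at e ⊢
  rw [e, det2]
  ring

/-- Second order estimate for the enclosed area. -/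
lemma abs_encArea_sub_le {f : ℂ → ℝ} (hf : ContDiff ℝ 1 f) {M L : ℝ} (hM : ∀ z, |f z| ≤ M)
    (hL : ∀ z w, |f z - f w| ≤ L * ‖z - w‖) {u u' ξ ξ' : ℝ → ℂ}
    (hu : ∀ t, HasDerivAt u (u' t) t) (hu' : Continuous u')
    (hξ : ∀ t, HasDerivAt ξ (ξ' t) t) (hξ' : Continuous ξ')
    (hup : u (2 * Real.pi) = u 0) (hξp : ξ (2 * Real.pi) = ξ 0)
    {B δ : ℝ} (hB : ∀ t, ‖u' t‖ ≤ B) (hδ : ∀ t, ‖ξ t‖ ≤ δ) (hδ' : ∀ t, ‖ξ' t‖ ≤ δ)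
    (hL0 : 0 ≤ L) (hM0 : 0 ≤ M) (hδ0 : 0 ≤ δ) :
    |encArea f (fun t => u t + ξ t) (fun t => u' t + ξ' t) - encArea f u u' -
      ∫ t in (0 : ℝ)..(2 * Real.pi), f (u t) * det2 (ξ t) (u' t)| ≤
      (2 * L * (B + δ) + 2 * M) * δ ^ 2 * (2 * Real.pi) := by
  have huc : Continuous u := continuous_iff_continuousAt.2 fun t => (hu t).continuousAt
  have hξc : Continuous ξ := continuous_iff_continuousAt.2 fun t => (hξ t).continuousAt
  have hd := hasDerivAt_encArea hf hu hu' hξ hξ' hup hξp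
  -- The increment is the first variation at an intermediate `r`. Comparing it with the one at `r =
  -- 0` uses only the Lipschitz bound on `f`, not a second derivative.
  obtain ⟨r, hr, e⟩ := exists_hasDerivAt_eq_slope _ _ (zero_lt_one' ℝ)
    (fun r _ => (hd r).continuousAt.continuousWithinAt) (fun r _ => hd r)
  simp only [Complex.ofReal_one, one_mul, Complex.ofReal_zero, zero_mul, add_zero, sub_zero,
    div_one] at e
  have hfc := hf.continuous
  have hdet : Continuous fun p : ℂ × ℂ => det2 p.1 p.2 := by unfold det2; fun_prop
  have c1 : Continuous fun t => f (u t + r * ξ t) * det2 (ξ t) (u' t + r * ξ' t) :=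
    (hfc.comp (by fun_prop)).mul (hdet.comp (f := fun t => (ξ t, u' t + r * ξ' t)) (by fun_prop))
  have c2 : Continuous fun t => f (u t) * det2 (ξ t) (u' t) :=
    (hfc.comp (by fun_prop)).mul (hdet.comp (f := fun t => (ξ t, u' t)) (by fun_prop))
  rw [← e, ← intervalIntegral.integral_sub (c1.intervalIntegrable _ _) (c2.intervalIntegrable _ _)]
  have := intervalIntegral.norm_integral_le_of_norm_le_const (a := 0) (b := 2 * Real.pi)
    (f := fun t => f (u t + r * ξ t) * det2 (ξ t) (u' t + r * ξ' t) - f (u t) * det2 (ξ t) (u' t))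
    (C := (2 * L * (B + δ) + 2 * M) * δ ^ 2) ?_
  · rwa [sub_zero, abs_of_pos Real.two_pi_pos, Real.norm_eq_abs] at this
  intro t _
  have hr1 : |r| ≤ 1 := by rw [abs_of_pos hr.1]; exact hr.2.le
  have e1 : det2 (ξ t) (u' t + r * ξ' t) = det2 (ξ t) (u' t) + r * det2 (ξ t) (ξ' t) := by
    simp [det2]; ring
  have e2 : f (u t + r * ξ t) * det2 (ξ t) (u' t + r * ξ' t) - f (u t) * det2 (ξ t) (u' t) =
      (f (u t + r * ξ t) - f (u t)) * det2 (ξ t) (u' t) +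
      f (u t + r * ξ t) * (r * det2 (ξ t) (ξ' t)) := by rw [e1]; ring
  have n0 : ‖(r : ℂ) * ξ t‖ ≤ δ := by
    rw [norm_mul, Complex.norm_real, Real.norm_eq_abs]
    calc |r| * ‖ξ t‖ ≤ 1 * δ := by gcongr; exact hδ t
      _ = δ := one_mul _
  have n1 : |f (u t + r * ξ t) - f (u t)| ≤ L * δ := by
    refine (hL _ _).trans ?_
    rw [add_sub_cancel_left]
    gcongr
  have n2 : |det2 (ξ t) (u' t)| ≤ 2 * δ * B := (abs_det2_le _ _).trans (by
    gcongr; exacts [hδ t, hB t])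
  have n3 : |det2 (ξ t) (ξ' t)| ≤ 2 * δ * δ := (abs_det2_le _ _).trans (by
    gcongr; exacts [hδ t, hδ' t])
  rw [Real.norm_eq_abs, e2]
  calc _ ≤ |f (u t + r * ξ t) - f (u t)| * |det2 (ξ t) (u' t)| +
      |f (u t + r * ξ t)| * (|r| * |det2 (ξ t) (ξ' t)|) := by
        refine (abs_add_le _ _).trans ?_
        rw [abs_mul, abs_mul, abs_mul]
    _ ≤ (L * δ) * (2 * δ * B) + M * (1 * (2 * δ * δ)) := by
        gcongr
        exact hM _
    _ ≤ _ := by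
        have : 0 ≤ L * δ ^ 3 := by positivity
        nlinarith

/-! ### The reference circle -/

/-- The constant `√(k² - 1)`. -/
def sk (k : ℝ) : ℝ := Real.sqrt (k ^ 2 - 1)

lemma sk_pos {k : ℝ} (hk : 1 < k) : 0 < sk k := Real.sqrt_pos.2 (by nlinarith)

lemma sk_sq {k : ℝ} (hk : 1 < k) : sk k ^ 2 = k ^ 2 - 1 := Real.sq_sqrt (by nlinarith)

lemma sk_lt {k : ℝ} (hk : 1 < k) : sk k < k := by
  have := sk_sq hk
  nlinarith [sk_pos hk]

lemma den_pos {k : ℝ} (hk : 1 < k) (t : ℝ) : 0 < k - Real.sin t := by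
  linarith [Real.sin_le_one t]

/-- The reference loop in the angular variable. -/
def refCurve (k t : ℝ) : ℂ := ⟨Real.cos t / (k - Real.sin t), sk k / (k - Real.sin t)⟩

/-- The derivative of the reference loop. -/
def refVel (k t : ℝ) : ℂ :=
  ⟨(1 - k * Real.sin t) / (k - Real.sin t) ^ 2, sk k * Real.cos t / (k - Real.sin t) ^ 2⟩

/-- The second derivative of the reference loop. -/
def refAcc (k t : ℝ) : ℂ :=
  ⟨(-k * Real.cos t * (k - Real.sin t) + 2 * (1 - k * Real.sin t) * Real.cos t) /
      (k - Real.sin t) ^ 3,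
   sk k * (-Real.sin t * (k - Real.sin t) + 2 * Real.cos t ^ 2) / (k - Real.sin t) ^ 3⟩

lemma hasDerivAt_mk {f g : ℝ → ℝ} {f' g' t : ℝ} (hf : HasDerivAt f f' t)
    (hg : HasDerivAt g g' t) : HasDerivAt (fun t => (⟨f t, g t⟩ : ℂ)) ⟨f', g'⟩ t := by
  have h := hf.ofReal_comp.add (hg.ofReal_comp.mul_const Complex.I)
  rw [← Complex.mk_eq_add_mul_I] at h
  refine h.congr_of_eventuallyEq (Eventually.of_forall fun t => ?_)
  simp [Complex.mk_eq_add_mul_I]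

lemma hasDerivAt_refCurve {k : ℝ} (hk : 1 < k) (t : ℝ) :
    HasDerivAt (refCurve k) (refVel k t) t := by
  have hD : HasDerivAt (fun t => k - Real.sin t) (-Real.cos t) t :=
    (Real.hasDerivAt_sin t).const_sub k
  have h0 := (den_pos hk t).ne'
  refine (hasDerivAt_mk ((Real.hasDerivAt_cos t).div hD h0)
    ((hasDerivAt_const t (sk k)).div hD h0)).congr_deriv ?_
  have := Real.sin_sq_add_cos_sq t
  apply Complex.ext
  · simp only [refVel]
    congr 1
    linear_combination this
  · simp only [refVel]
    congr 1
    ring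

lemma hasDerivAt_refVel {k : ℝ} (hk : 1 < k) (t : ℝ) :
    HasDerivAt (refVel k) (refAcc k t) t := by
  have hD : HasDerivAt (fun t => k - Real.sin t) (-Real.cos t) t :=
    (Real.hasDerivAt_sin t).const_sub k
  have h0 := (den_pos hk t).ne'
  have hD2 := hD.pow 2
  refine (hasDerivAt_mk ((((Real.hasDerivAt_sin t).const_mul k).const_sub 1).div hD2
    (pow_ne_zero 2 h0))
    (((Real.hasDerivAt_cos t).const_mul (sk k)).div hD2 (pow_ne_zero 2 h0))).congr_deriv ?_
  have := Real.sin_sq_add_cos_sq t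
  apply Complex.ext
  · simp only [refAcc, Pi.pow_apply]
    field_simp
    ring
  · simp only [refAcc, Pi.pow_apply]
    field_simp
    ring

lemma continuous_mk {f g : ℝ → ℝ} (hf : Continuous f) (hg : Continuous g) :
    Continuous fun t => (⟨f t, g t⟩ : ℂ) := by
  simp only [Complex.mk_eq_add_mul_I]; fun_prop

lemma continuous_refVel {k : ℝ} (hk : 1 < k) : Continuous (refVel k) :=
  continuous_iff_continuousAt.2 fun t => (hasDerivAt_refVel hk t).continuousAt

lemma continuous_refCurve {k : ℝ} (hk : 1 < k) : Continuous (refCurve k) :=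
  continuous_iff_continuousAt.2 fun t => (hasDerivAt_refCurve hk t).continuousAt

lemma continuous_refAcc {k : ℝ} (hk : 1 < k) : Continuous (refAcc k) := by
  have h0 : ∀ t, (k - Real.sin t) ^ 3 ≠ 0 := fun t => pow_ne_zero 3 (den_pos hk t).ne'
  refine continuous_mk ?_ ?_
  · exact Continuous.div (by fun_prop) (by fun_prop) h0
  · exact Continuous.div (by fun_prop) (by fun_prop) h0

lemma coe_circleExp (t : ℝ) : (Circle.exp t : ℂ) = ⟨Real.cos t, Real.sin t⟩ := by
  rw [Circle.coe_exp, Complex.exp_mul_I]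
  apply Complex.ext <;> simp [Complex.cos_ofReal_re, Complex.sin_ofReal_re]

lemma lift_omega (k t : ℝ) : lift (omega k) t = refCurve k t := by
  unfold lift omega refCurve eucRadius sk
  rw [coe_circleExp]
  apply Complex.ext
  · rw [Complex.re_ofReal_mul]
    simp only
    ring
  · rw [Complex.im_ofReal_mul]
    simp only [one_div_one_div]
    ring

lemma lift_omegaAt (k : ℝ) (q : Circle → ℂ) (t : ℝ) :
    lift (fun x => omegaAt k (q x) x) t =
      ((q (Circle.exp t)).re : ℂ) + ((q (Circle.exp t)).im : ℂ) * refCurve k t := by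
  rw [← lift_omega]; rfl

lemma refCurve_periodic (k : ℝ) : Function.Periodic (refCurve k) (2 * Real.pi) := fun t => by
  simp [refCurve]

lemma refCurve_two_pi (k : ℝ) : refCurve k (2 * Real.pi) = refCurve k 0 := by
  simp [refCurve]

/-! ### The Green formula and the Melnikov function -/

/-- Green's formula obtained by inflating a circle from its centre: the first variation in the
radius is the integral of `f r` over the angle, and integrating it in `r` is integration in polar
coordinates. -/
lemma setIntegral_ball_eq_encArea {f : ℂ → ℝ} (hf : ContDiff ℝ 1 f) (c : ℂ) {R : ℝ}
    (hR : 0 ≤ R) :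
    ∫ w in Metric.ball c R, f w = encArea f (fun t => c + R * Complex.exp (t * Complex.I))
      (fun t => R * (Complex.I * Complex.exp (t * Complex.I))) := by
  have hfc := hf.continuous
  have hexp : ∀ t : ℝ, HasDerivAt (fun t : ℝ => Complex.exp (t * Complex.I))
      (Complex.I * Complex.exp (t * Complex.I)) t := fun t => by
    have := ((Complex.ofRealCLM.hasDerivAt (x := t)).mul_const Complex.I).cexp
    simpa [mul_comm] using this
  have hdet : ∀ r t : ℝ, det2 (Complex.exp (t * Complex.I))
      (0 + r * (Complex.I * Complex.exp (t * Complex.I))) = r := fun r t => by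
    have := Real.sin_sq_add_cos_sq t
    simp only [det2, Complex.exp_mul_I]
    simp [Complex.cos_ofReal_re, Complex.sin_ofReal_re]
    linear_combination r * this
  -- The base curve is the constant `c` and the variation field is `exp(it)`, so the variation
  -- parameter is the radius and the determinant is the polar Jacobian.
  have hder := hasDerivAt_encArea hf (u := fun _ => c) (u' := fun _ => 0)
    (fun t => hasDerivAt_const t c) continuous_const hexp (by fun_prop) rfl (by simp)
  simp only [hdet] at hder
  have hcont : Continuous fun p : ℝ × ℝ =>
      f (c + p.1 * Complex.exp (p.2 * Complex.I)) * p.1 := by fun_prop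
  have hftc := intervalIntegral.integral_eq_sub_of_hasDerivAt (a := 0) (b := R)
    (fun r _ => hder r) ((intervalIntegral.continuous_parametric_intervalIntegral_of_continuous'
      (f := fun r t : ℝ => f (c + r * Complex.exp (t * Complex.I)) * r)
        hcont 0 (2 * Real.pi)).intervalIntegrable _ _)
  have h0 : encArea f (fun t => c + ((0 : ℝ) : ℂ) * Complex.exp (t * Complex.I))
      (fun t => 0 + ((0 : ℝ) : ℂ) * (Complex.I * Complex.exp (t * Complex.I))) = 0 := by
    simp [encArea]
  rw [h0, sub_zero] at hftc
  simp only [zero_add] at hftc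
  rw [← hftc, ← integral_indicator measurableSet_ball,
    ← integral_add_left_eq_self _ c, ← Complex.integral_comp_polarCoord_symm]
  have htgt : polarCoord.target = Set.Ioi (0 : ℝ) ×ˢ Set.Ioo (-Real.pi) Real.pi := rfl
  have hind : ∀ p ∈ polarCoord.target, p.1 • (Metric.ball c R).indicator f
        (c + Complex.polarCoord.symm p) =
      (Set.Ioo (0 : ℝ) R ×ˢ Set.Ioo (-Real.pi) Real.pi).indicator
        (fun p : ℝ × ℝ => f (c + p.1 * Complex.exp (p.2 * Complex.I)) * p.1) p := by
    intro p hp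
    rw [htgt] at hp
    have e : Complex.polarCoord.symm p = p.1 * Complex.exp (p.2 * Complex.I) := by
      rw [Complex.polarCoord_symm_apply, Complex.exp_mul_I]; simp
    have hnorm : dist (c + Complex.polarCoord.symm p) c = p.1 := by
      rw [dist_eq_norm, add_sub_cancel_left, Complex.norm_polarCoord_symm, abs_of_pos hp.1]
    by_cases h : p.1 < R
    · rw [Set.indicator_of_mem (by rwa [Metric.mem_ball, hnorm]),
        Set.indicator_of_mem (Set.mk_mem_prod (Set.mem_Ioo.2 ⟨hp.1, h⟩) hp.2), e, smul_eq_mul,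
        mul_comm]
    · rw [Set.indicator_of_notMem (by rwa [Metric.mem_ball, hnorm]),
        Set.indicator_of_notMem (fun h' => h h'.1.2), smul_zero]
  have hmeas : MeasurableSet (Set.Ioo (0 : ℝ) R ×ˢ Set.Ioo (-Real.pi) Real.pi) :=
    measurableSet_Ioo.prod measurableSet_Ioo
  rw [setIntegral_congr_fun polarCoord.open_target.measurableSet hind,
    setIntegral_indicator hmeas, htgt, Set.inter_eq_self_of_subset_right
      (Set.prod_mono Set.Ioo_subset_Ioi_self le_rfl), Measure.volume_eq_prod,
    setIntegral_prod _ ((hcont.continuousOn.integrableOn_compact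
      (isCompact_Icc.prod isCompact_Icc)).mono_set
        (Set.prod_mono Set.Ioo_subset_Icc_self Set.Ioo_subset_Icc_self)),
    intervalIntegral.integral_of_le hR, integral_Ioc_eq_integral_Ioo]
  refine setIntegral_congr_fun measurableSet_Ioo fun r _ => ?_
  have hper : Function.Periodic
      (fun t : ℝ => f (c + r * Complex.exp (t * Complex.I)) * r) (2 * Real.pi) := fun t => by
    have : Complex.exp (((t + 2 * Real.pi : ℝ) : ℂ) * Complex.I) =
        Complex.exp (t * Complex.I) := by
      push_cast
      rw [add_mul, Complex.exp_periodic]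
    simp only [this]
  have := hper.intervalIntegral_add_eq (-Real.pi) 0
  rw [zero_add, show -Real.pi + 2 * Real.pi = Real.pi by ring,
    intervalIntegral.integral_of_le (by linarith [Real.pi_pos]),
    integral_Ioc_eq_integral_Ioo] at this
  exact this

/-- The angular change of variable between the Euclidean parametrization of the unit circle and
the one induced by `refCurve`. -/
lemma exists_angle_change {k : ℝ} (hk : 1 < k) : ∃ φ φ' : ℝ → ℝ,
    (∀ t, HasDerivAt φ (φ' t) t) ∧ Continuous φ' ∧ φ (2 * Real.pi) = φ 0 + 2 * Real.pi ∧
    ∀ t, Complex.exp (φ t * Complex.I) = sk k * refCurve k t - k * Complex.I := by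
  -- `a` is the root of `a² - 2ak + 1` in `(0, 1)`. Hence `v = 1 + a i exp(it)` stays in the right
  -- half-plane, where the logarithm is smooth, and `exp(iφ) = exp(it) conj(v) / v` is a Blaschke
  -- factor of degree one.
  set a := k - sk k with ha
  have hs := sk_pos hk
  have hs2 := sk_sq hk
  have ha0 : 0 < a := by linarith [sk_lt hk]
  have ha1 : a < 1 := by nlinarith
  have ha2 : 1 + a ^ 2 = 2 * a * k := by rw [ha]; linear_combination hs2
  let v : ℝ → ℂ := fun t => 1 + a * Complex.I * Complex.exp (t * Complex.I)
  have hvv : ∀ t, v t = ⟨1 - a * Real.sin t, a * Real.cos t⟩ := fun t => by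
    simp only [v, Complex.exp_mul_I]
    apply Complex.ext <;> simp [Complex.cos_ofReal_re, Complex.sin_ofReal_re]
    ring
  have hvre : ∀ t, 0 < (v t).re := fun t => by
    rw [hvv]
    simp only
    nlinarith [Real.sin_le_one t]
  have hvs : ∀ t, v t ∈ Complex.slitPlane := fun t => Or.inl (hvre t)
  have hexp : ∀ t : ℝ, HasDerivAt (fun t : ℝ => Complex.exp (t * Complex.I))
      (Complex.I * Complex.exp (t * Complex.I)) t := fun t => by
    have := ((Complex.ofRealCLM.hasDerivAt (x := t)).mul_const Complex.I).cexp
    simpa [mul_comm] using this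
  have hv : ∀ t : ℝ, HasDerivAt v (a * Complex.I * (Complex.I * Complex.exp (t * Complex.I))) t :=
    fun t => ((hexp t).const_mul _).const_add 1
  have hv0 : ∀ t, v t ≠ 0 := fun t h => by simpa [h] using hvre t
  have hvc : Continuous v := by fun_prop
  refine ⟨fun t => t - 2 * (Complex.log (v t)).im, fun t => 1 - 2 *
    (a * Complex.I * (Complex.I * Complex.exp (t * Complex.I)) / v t).im, ?_, ?_, ?_, ?_⟩
  · intro t
    exact (hasDerivAt_id t).sub ((hasDerivAt_im ((hv t).clog_real (hvs t))).const_mul 2)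
  · have : Continuous fun t : ℝ =>
        a * Complex.I * (Complex.I * Complex.exp (t * Complex.I)) / v t :=
      Continuous.div (by fun_prop) hvc hv0
    fun_prop
  · simp [v]; ring
  · intro t
    have hconj : Complex.exp (((-2 * (Complex.log (v t)).im : ℝ) : ℂ) * Complex.I) =
        (starRingEnd ℂ) (v t) / v t := by
      have h1 : ((-2 * (Complex.log (v t)).im : ℝ) : ℂ) * Complex.I =
          (starRingEnd ℂ) (Complex.log (v t)) - Complex.log (v t) := by
        apply Complex.ext <;> simp; ring
      rw [h1, Complex.exp_sub, Complex.exp_conj, Complex.exp_log (hv0 t)]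
    have h2 : (((t - 2 * (Complex.log (v t)).im : ℝ) : ℂ) * Complex.I) = t * Complex.I +
        ((-2 * (Complex.log (v t)).im : ℝ) : ℂ) * Complex.I := by push_cast; ring
    rw [h2, Complex.exp_add, hconj, ← mul_div_assoc, div_eq_iff (hv0 t), hvv, Complex.exp_mul_I]
    have hD := (den_pos hk t).ne'
    have hsc := Real.sin_sq_add_cos_sq t
    have hka : sk k = k - a := by rw [ha]; ring
    have hkc : Real.cos t ^ 2 = 1 - Real.sin t ^ 2 := by linarith
    apply Complex.ext
    · simp [refCurve, Complex.cos_ofReal_re, Complex.sin_ofReal_re]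
      rw [hka]
      field_simp
      linear_combination (-(Real.cos t * (Real.sin t - a))) * ha2
    · simp [refCurve, Complex.cos_ofReal_re, Complex.sin_ofReal_re]
      rw [hka]
      field_simp
      rw [hkc]
      linear_combination (-(Real.sin t ^ 2 - a * Real.sin t)) * ha2

/-- Both curves run once around the same Euclidean circle, and the integral of a one-form does not
depend on the parametrization. -/
lemma encArea_omegaAt_eq {f : ℂ → ℝ} (hf : ContDiff ℝ 1 f) {k : ℝ} (hk : 1 < k) (z : ℂ) :
    encArea f (fun t => z.re + z.im * refCurve k t) (fun t => z.im * refVel k t) =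
    encArea f
      (fun t => (z.re + (z.im * k / sk k : ℝ) * Complex.I) +
        (z.im / sk k : ℝ) * Complex.exp (t * Complex.I))
      (fun t => (z.im / sk k : ℝ) * (Complex.I * Complex.exp (t * Complex.I))) := by
  obtain ⟨φ, φ', hφ, hφ', hper, hE⟩ := exists_angle_change hk
  have hs := (sk_pos hk).ne'
  have hsC : (sk k : ℂ) ≠ 0 := by exact_mod_cast hs
  have hbc := (contDiff_potential hf).continuous
  set γ : ℝ → ℂ := fun t => (z.re + (z.im * k / sk k : ℝ) * Complex.I) +
        (z.im / sk k : ℝ) * Complex.exp (t * Complex.I) with hγ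
  set γ' : ℝ → ℂ := fun t => (z.im / sk k : ℝ) * (Complex.I * Complex.exp (t * Complex.I)) with hγ'
  have hexp : ∀ t : ℝ, HasDerivAt (fun t : ℝ => Complex.exp (t * Complex.I))
      (Complex.I * Complex.exp (t * Complex.I)) t := fun t => by
    have := ((Complex.ofRealCLM.hasDerivAt (x := t)).mul_const Complex.I).cexp
    simpa [mul_comm] using this
  have hγd : ∀ t, HasDerivAt γ (γ' t) t := fun t => ((hexp t).const_mul _).const_add _
  have hγφ : ∀ t, γ (φ t) = z.re + z.im * refCurve k t := fun t => by
    simp only [hγ, hE]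
    push_cast
    field_simp
    ring
  -- Uniqueness of the derivative of `γ ∘ φ` matches the velocities without an explicit formula for
  -- `φ'`.
  have hd1 : ∀ t, φ' t • γ' (φ t) = z.im * refVel k t := fun t => by
    have h1 : HasDerivAt (fun t => γ (φ t)) (φ' t • γ' (φ t)) t := (hγd (φ t)).scomp t (hφ t)
    simp only [hγφ] at h1
    exact h1.unique (((hasDerivAt_refCurve hk t).const_mul _).const_add _)
  set g : ℝ → ℝ := fun t => potential f (γ t) * (γ' t).re with hg
  have hgc : Continuous g := by
    have : Continuous γ := by fun_prop
    have h2 : Continuous γ' := by fun_prop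
    exact (hbc.comp this).mul (Complex.continuous_re.comp h2)
  have hsub := intervalIntegral.integral_comp_mul_deriv (a := 0) (b := 2 * Real.pi)
    (fun t _ => hφ t) hφ'.continuousOn hgc
  have hgp : Function.Periodic g (2 * Real.pi) := fun t => by
    have : Complex.exp (((t + 2 * Real.pi : ℝ) : ℂ) * Complex.I) =
        Complex.exp (t * Complex.I) := by
      push_cast
      rw [add_mul, Complex.exp_periodic]
    simp only [hg, hγ, hγ', this]
  rw [hper, hgp.intervalIntegral_add_eq (φ 0) 0, zero_add] at hsub
  rw [show encArea f γ γ' = ∫ t in (0 : ℝ)..(2 * Real.pi), g t from rfl, ← hsub]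
  refine intervalIntegral.integral_congr fun t _ => ?_
  simp only [Function.comp, hg, hγφ, ← hd1, Complex.smul_re, smul_eq_mul]
  ring

lemma rho_mem {k : ℝ} (hk : 1 < k) : 1 / k ∈ Set.Ioo (-1 : ℝ) 1 := by
  have h0 : 0 < k := by linarith
  refine ⟨by have := one_div_pos.2 h0; linarith, by rw [div_lt_one h0]; exact hk⟩

lemma sqrt_one_sub {k : ℝ} (hk : 1 < k) : Real.sqrt (1 - (1 / k) ^ 2) = sk k / k := by
  have h0 : 0 < k := by linarith
  rw [show 1 - (1 / k) ^ 2 = (k ^ 2 - 1) / k ^ 2 by field_simp, Real.sqrt_div' _ (by positivity),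
    Real.sqrt_sq h0.le, sk]

/-- A hyperbolic disk of radius `ρ` is the Euclidean disk centred at height `z₂ cosh ρ` with radius
`z₂ sinh ρ`; for `ρ = rho k` these factors are `k / sk k` and `1 / sk k`. -/
lemma hypDisk_eq {k : ℝ} (hk : 1 < k) {z : ℂ} (hz : 0 < z.im) :
    hypDisk z (rho k) = Metric.ball (z.re + (z.im * k / sk k : ℝ) * Complex.I) (z.im / sk k) := by
  have h0 : 0 < k := by linarith
  have hs := sk_pos hk
  have e : hypDisk z (rho k) = ((↑) : UpperHalfPlane → ℂ) ''
      Metric.ball (α := UpperHalfPlane) (UpperHalfPlane.mk z hz) (rho k) := by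
    ext w
    constructor
    · rintro ⟨hw, hz', h⟩
      exact ⟨UpperHalfPlane.mk w hw, h, rfl⟩
    · rintro ⟨w, hw, rfl⟩
      exact ⟨w.im_pos, hz, hw⟩
  rw [e, UpperHalfPlane.image_coe_ball]
  congr 1
  · apply Complex.ext
    · simp
    · simp only [UpperHalfPlane.coe_im, UpperHalfPlane.center_im, rho,
        Real.cosh_artanh (rho_mem hk), sqrt_one_sub hk]
      simp
      ring
  · simp only [rho, Real.sinh_artanh (rho_mem hk), sqrt_one_sub hk]
    simp
    field_simp

lemma melnikov_eq_encArea {k : ℝ} (hk : 1 < k) {K : ℂ → ℝ}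
    (hK : ContDiff ℝ 1 fun w => K w / w.im ^ 2) {z : ℂ} (hz : 0 < z.im) :
    melnikov k K z = encArea (fun w => K w / w.im ^ 2)
      (fun t => z.re + z.im * refCurve k t) (fun t => z.im * refVel k t) := by
  rw [melnikov, hypDisk_eq hk hz,
    setIntegral_ball_eq_encArea hK _ (div_pos hz (sk_pos hk)).le, encArea_omegaAt_eq hK hk]

/-! ### The reduced equation -/

lemma cint_ofReal (g : Circle → ℝ) : cint (fun x => (g x : ℂ)) = ((cint g : ℝ) : ℂ) :=
  intervalIntegral.integral_ofReal

lemma cint_mul_const (g : Circle → ℂ) (c : ℂ) : cint (fun x => g x * c) = cint g * c :=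
  intervalIntegral.integral_mul_const c _

lemma cint_const_mul (g : Circle → ℂ) (c : ℂ) : cint (fun x => c * g x) = c * cint g :=
  intervalIntegral.integral_const_mul c _

lemma le_cint {g : Circle → ℝ} (hg : Continuous g) {m : ℝ} (h : ∀ x, m ≤ g x) :
    m * (2 * Real.pi) ≤ cint g := by
  have := intervalIntegral.integral_mono_on (a := 0) (b := 2 * Real.pi) (μ := volume)
    Real.two_pi_pos.le (intervalIntegrable_const (c := m))
    ((hg.comp Circle.exp.continuous).intervalIntegrable _ _) (fun t _ => h (Circle.exp t))
  rw [intervalIntegral.integral_const, sub_zero, smul_eq_mul, mul_comm] at this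
  exact this

/-- Bounds for the coefficients of the reduced equation. -/
structure CoeffBounds (m B L : ℝ) (h₁ h₂ : Circle → ℂ → ℝ) : Prop where
  cont₁ : Continuous (Function.uncurry h₁)
  cont₂ : Continuous (Function.uncurry h₂)
  lower : ∀ x q, m ≤ h₁ x q
  upper : ∀ x q, h₁ x q ≤ B
  bound : ∀ x q, |h₂ x q| ≤ B
  lip₁ : ∀ x q q', |h₁ x q - h₁ x q'| ≤ L * ‖q - q'‖
  lip₂ : ∀ x q p, |h₂ x q - h₂ x p| ≤ L * ‖q - p‖

/-- The multiplier which makes the reduced vector field of zero mean. -/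
def multiplier (ε : ℝ) (h₁ h₂ : Circle → ℂ → ℝ) (q : C(Circle, ℂ)) : ℂ :=
  ((ε * (cint fun x => h₁ x (q x))⁻¹ : ℝ) : ℂ) *
    cint fun x : Circle => (h₂ x (q x) : ℂ) * (Complex.I * x)

lemma norm_I_mul_circle (a : ℂ) (x : Circle) : ‖a * (Complex.I * x)‖ = ‖a‖ := by
  rw [norm_mul, norm_mul, Circle.norm_coe, Complex.norm_I, mul_one, mul_one]

lemma norm_multiplier_le {m B L ε : ℝ} {h₁ h₂ : Circle → ℂ → ℝ} (hm : 0 < m)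
    (h : CoeffBounds m B L h₁ h₂) (q : C(Circle, ℂ)) :
    ‖multiplier ε h₁ h₂ q‖ ≤ |ε| * (B / m) := by
  have hpi := Real.two_pi_pos
  have hc : Continuous fun x => h₁ x (q x) :=
    h.cont₁.comp (continuous_id.prodMk q.continuous)
  have h1 := le_cint hc (fun x => h.lower x (q x))
  have h2 : ‖cint fun x : Circle => (h₂ x (q x) : ℂ) * (Complex.I * x)‖ ≤ B * (2 * Real.pi) :=
    norm_cint_le fun x => by
      rw [norm_I_mul_circle, Complex.norm_real]; exact h.bound _ _
  have h3 : (cint fun x => h₁ x (q x))⁻¹ ≤ (m * (2 * Real.pi))⁻¹ :=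
    inv_anti₀ (by positivity) h1
  have hP : 0 < cint fun x => h₁ x (q x) := lt_of_lt_of_le (by positivity) h1
  rw [multiplier, norm_mul, Complex.norm_real, Real.norm_eq_abs, abs_mul, abs_of_pos (inv_pos.2 hP)]
  calc _ ≤ |ε| * (m * (2 * Real.pi))⁻¹ * (B * (2 * Real.pi)) := by gcongr
    _ = _ := by field_simp

lemma norm_multiplier_sub_le {m B L ε : ℝ} {h₁ h₂ : Circle → ℂ → ℝ} (hm : 0 < m) (hB : 0 ≤ B)
    (hL : 0 ≤ L) (h : CoeffBounds m B L h₁ h₂) (q q' : C(Circle, ℂ)) :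
    ‖multiplier ε h₁ h₂ q - multiplier ε h₁ h₂ q'‖ ≤
      |ε| * (L * B / m ^ 2 + L / m) * ‖q - q'‖ := by
  have hpi := Real.two_pi_pos
  have hc : ∀ q : C(Circle, ℂ), Continuous fun x => h₁ x (q x) := fun q =>
    h.cont₁.comp (continuous_id.prodMk q.continuous)
  have hc2 : ∀ q : C(Circle, ℂ), Continuous fun x : Circle =>
      (h₂ x (q x) : ℂ) * (Complex.I * x) := fun q =>
    (Complex.continuous_ofReal.comp (h.cont₂.comp (continuous_id.prodMk q.continuous))).mul
      (continuous_const.mul continuous_subtype_val)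
  have hq : ∀ x, ‖q x - q' x‖ ≤ ‖q - q'‖ := fun x => (q - q').norm_coe_le_norm x
  set δ := ‖q - q'‖ with hδ
  have hδ0 : 0 ≤ δ := norm_nonneg _
  set P := fun q : C(Circle, ℂ) => cint fun x => h₁ x (q x) with hP
  set Q := fun q : C(Circle, ℂ) =>
    cint fun x : Circle => (h₂ x (q x) : ℂ) * (Complex.I * x) with hQ
  have hPl : ∀ q, m * (2 * Real.pi) ≤ P q := fun q => le_cint (hc q) (fun x => h.lower x (q x))
  have hPpos : ∀ q, 0 < P q := fun q => lt_of_lt_of_le (by positivity) (hPl q)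
  have hPinv : ∀ q, (P q)⁻¹ ≤ (m * (2 * Real.pi))⁻¹ := fun q =>
    inv_anti₀ (by positivity) (hPl q)
  have hQb : ‖Q q‖ ≤ B * (2 * Real.pi) := norm_cint_le fun x => by
      rw [norm_I_mul_circle, Complex.norm_real]; exact h.bound _ _
  have hPd : |P q' - P q| ≤ L * δ * (2 * Real.pi) := by
    rw [abs_sub_comm, hP]
    simp only
    rw [← cint_sub (hc q) (hc q'), ← Real.norm_eq_abs]
    exact norm_cint_le fun x => (h.lip₁ _ _ _).trans (by gcongr; exact hq x)
  have hQd : ‖Q q - Q q'‖ ≤ L * δ * (2 * Real.pi) := by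
    rw [hQ]
    simp only
    rw [← cint_sub (hc2 q) (hc2 q')]
    refine norm_cint_le fun x => ?_
    rw [← sub_mul, norm_I_mul_circle, ← Complex.ofReal_sub, Complex.norm_real]
    exact (h.lip₂ _ _ _).trans (by gcongr; exact hq x)
  have e : multiplier ε h₁ h₂ q - multiplier ε h₁ h₂ q' =
      ((ε * ((P q' - P q) * ((P q)⁻¹ * (P q')⁻¹)) : ℝ) : ℂ) * Q q +
      ((ε * (P q')⁻¹ : ℝ) : ℂ) * (Q q - Q q') := by
    have e1 : (P q' - P q) * ((P q)⁻¹ * (P q')⁻¹) = (P q)⁻¹ - (P q')⁻¹ := by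
      have := (hPpos q).ne'
      have := (hPpos q').ne'
      field_simp
    rw [e1]
    simp only [multiplier, hP, hQ]
    push_cast
    ring
  rw [e]
  refine (norm_add_le _ _).trans ?_
  rw [norm_mul, norm_mul, Complex.norm_real, Complex.norm_real, Real.norm_eq_abs,
    Real.norm_eq_abs, abs_mul, abs_mul, abs_mul ε, abs_mul, abs_of_pos (inv_pos.2 (hPpos q)),
    abs_of_pos (inv_pos.2 (hPpos q'))]
  have hi := hPinv q
  have hi' := hPinv q'
  have p1 := (inv_pos.2 (hPpos q)).le
  have p2 := (inv_pos.2 (hPpos q')).le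
  calc _ ≤ |ε| * (L * δ * (2 * Real.pi) * ((m * (2 * Real.pi))⁻¹ * (m * (2 * Real.pi))⁻¹)) *
        (B * (2 * Real.pi)) + |ε| * (m * (2 * Real.pi))⁻¹ * (L * δ * (2 * Real.pi)) := by
        gcongr
    _ = _ := by field_simp

/-- Lyapunov-Schmidt reduction: for every prescribed mean value the equation is solvable up to a
constant multiplier. -/
lemma exists_reduced_solution {m B L : ℝ} (hm : 0 < m) (hB : 0 ≤ B) (hL : 0 ≤ L) :
    ∃ ε₁ : ℝ, 0 < ε₁ ∧ ∃ C : ℝ, 0 ≤ C ∧ ∀ ε : ℝ, |ε| < ε₁ → ∀ h₁ h₂ : Circle → ℂ → ℝ,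
      CoeffBounds m B L h₁ h₂ → ∃ q v : ℂ → C(Circle, ℂ), ∃ c : ℂ → ℂ,
        (∀ z t, HasDerivAt (fun t => q z (Circle.exp t)) (v z (Circle.exp t)) t) ∧
        (∀ z x, v z x = h₁ x (q z x) * c z - ε * (h₂ x (q z x) * (Complex.I * x))) ∧
        (∀ z, cint (q z) = 2 * Real.pi * z) ∧ (∀ z, cint (v z) = 0) ∧
        (∀ z x, ‖q z x - z‖ ≤ C * |ε|) ∧ (∀ z x, ‖v z x‖ ≤ C * |ε|) ∧
        (∀ z z' x, ‖q z x - q z' x‖ ≤ 2 * ‖z - z'‖) ∧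
        (∀ z z' x, ‖v z x - v z' x‖ ≤ C * ‖z - z'‖) ∧
        (∀ z z', ‖c z - c z'‖ ≤ C * ‖z - z'‖) := by
  have hpi := Real.pi_pos
  -- Per unit of `|ε|`: `C₀` bounds the nonlinearity, `C₁` is a Lipschitz constant of the
  -- multiplier, and `C₂` one of the nonlinearity. The choice of `ε₁` makes `4π ε₁ C₂` at most
  -- `1/2`, as the contraction requires.
  set C₀ := B * (B / m) + B with hC₀
  set C₁ := L * B / m ^ 2 + L / m with hC₁
  set C₂ := L * (B / m) + B * C₁ + L with hC₂
  have p0 : 0 ≤ C₀ := by positivity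
  have p1 : 0 ≤ C₁ := by positivity
  have p2 : 0 ≤ C₂ := by positivity
  set ε₁ := 1 / (8 * Real.pi * (C₂ + 1)) with hε₁
  have hε₁0 : 0 < ε₁ := by positivity
  refine ⟨ε₁, hε₁0, 4 * Real.pi * C₀ + C₀ + 2 * ε₁ * C₂ + 2 * ε₁ * C₁, by positivity, ?_⟩
  intro ε hε h₁ h₂ h
  have hc : ∀ q : C(Circle, ℂ), Continuous fun x => h₁ x (q x) := fun q =>
    h.cont₁.comp (continuous_id.prodMk q.continuous)
  have hc2 : ∀ q : C(Circle, ℂ), Continuous fun x : Circle =>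
      (h₂ x (q x) : ℂ) * (Complex.I * x) := fun q =>
    (Complex.continuous_ofReal.comp (h.cont₂.comp (continuous_id.prodMk q.continuous))).mul
      (continuous_const.mul continuous_subtype_val)
  let N : C(Circle, ℂ) → C(Circle, ℂ) := fun q =>
    ⟨fun x => h₁ x (q x) * multiplier ε h₁ h₂ q - ε * (h₂ x (q x) * (Complex.I * x)),
      ((Complex.continuous_ofReal.comp (hc q)).mul continuous_const).sub
        (continuous_const.mul (hc2 q))⟩
  have hNapp : ∀ q x, N q x = h₁ x (q x) * multiplier ε h₁ h₂ q -
    ε * (h₂ x (q x) * (Complex.I * x)) := fun _ _ => rfl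
  have hN0 : ∀ q, cint (N q) = 0 := fun q => by
    have hP : (cint fun x => h₁ x (q x)) ≠ 0 :=
      (lt_of_lt_of_le (by positivity) (le_cint (hc q) (fun x => h.lower x (q x)))).ne'
    have hPC : ((cint fun x => h₁ x (q x) : ℝ) : ℂ) ≠ 0 := by exact_mod_cast hP
    have e : cint (N q) = cint (fun x => (h₁ x (q x) : ℂ) * multiplier ε h₁ h₂ q) -
        cint (fun x : Circle => (ε : ℂ) * (h₂ x (q x) * (Complex.I * x))) :=
      cint_sub ((Complex.continuous_ofReal.comp (hc q)).mul continuous_const)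
        (continuous_const.mul (hc2 q))
    rw [e, cint_mul_const, cint_const_mul, cint_ofReal, multiplier]
    push_cast
    rw [mul_comm (ε : ℂ), mul_assoc, mul_inv_cancel_left₀ hPC, sub_self]
  have hNb : ∀ q x, ‖N q x‖ ≤ C₀ * |ε| := fun q x => by
    rw [hNapp]
    refine (norm_sub_le _ _).trans ?_
    rw [norm_mul, norm_mul, norm_I_mul_circle, Complex.norm_real, Complex.norm_real,
      Complex.norm_real, Real.norm_eq_abs, Real.norm_eq_abs, Real.norm_eq_abs,
      abs_of_pos (hm.trans_le (h.lower x (q x)))]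
    calc _ ≤ B * (|ε| * (B / m)) + |ε| * B := by
          gcongr
          exacts [h.upper _ _, norm_multiplier_le hm h q, h.bound _ _]
      _ = _ := by rw [hC₀]; ring
  have hNl : ∀ q q', ‖N q - N q'‖ ≤ |ε| * C₂ * ‖q - q'‖ := fun q q' => by
    rw [ContinuousMap.norm_le _ (by positivity)]
    intro x
    have hq : ‖q x - q' x‖ ≤ ‖q - q'‖ := (q - q').norm_coe_le_norm x
    set δ := ‖q - q'‖ with hδ
    have e : (N q - N q') x = ((h₁ x (q x) - h₁ x (q' x) : ℝ) : ℂ) * multiplier ε h₁ h₂ q +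
        (h₁ x (q' x) : ℂ) * (multiplier ε h₁ h₂ q - multiplier ε h₁ h₂ q') -
        ε * (((h₂ x (q x) - h₂ x (q' x) : ℝ) : ℂ) * (Complex.I * x)) := by
      rw [ContinuousMap.sub_apply, hNapp, hNapp]
      push_cast
      ring
    rw [e]
    refine (norm_sub_le _ _).trans ((add_le_add_left (norm_add_le _ _) _).trans ?_)
    rw [norm_mul, norm_mul, norm_mul, norm_I_mul_circle, Complex.norm_real, Complex.norm_real,
      Complex.norm_real, Complex.norm_real, Real.norm_eq_abs, Real.norm_eq_abs, Real.norm_eq_abs,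
      Real.norm_eq_abs, abs_of_pos (hm.trans_le (h.lower x (q' x)))]
    have l1 : |h₁ x (q x) - h₁ x (q' x)| ≤ L * δ := (h.lip₁ _ _ _).trans (by gcongr)
    have l2 : |h₂ x (q x) - h₂ x (q' x)| ≤ L * δ := (h.lip₂ _ _ _).trans (by gcongr)
    calc _ ≤ L * δ * (|ε| * (B / m)) + B * (|ε| * C₁ * δ) + |ε| * (L * δ) := by
          gcongr
          exacts [norm_multiplier_le hm h q, h.upper _ _,
            norm_multiplier_sub_le hm hB hL h q q']
      _ = _ := by rw [hC₂]; ring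
  have hsmall : 4 * Real.pi * (|ε| * C₂) ≤ 1 / 2 := by
    calc 4 * Real.pi * (|ε| * C₂) ≤ 4 * Real.pi * (ε₁ * (C₂ + 1)) := by gcongr; linarith
      _ = 1 / 2 := by rw [hε₁]; field_simp; norm_num
  obtain ⟨q, hd, hmean, hz, hlip⟩ := exists_periodic_solution N hN0 hsmall hNl
  have hx : ∀ z z' x, ‖q z x - q z' x‖ ≤ ‖q z - q z'‖ := fun z z' x =>
    (q z - q z').norm_coe_le_norm x
  refine ⟨q, fun z => N (q z), fun z => multiplier ε h₁ h₂ (q z), hd, fun z x => rfl, hmean,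
    fun z => hN0 _, ?_, ?_, ?_, ?_, ?_⟩
  · intro z x
    refine (hz z x).trans ?_
    have : ‖N (q z)‖ ≤ C₀ * |ε| := by
      rw [ContinuousMap.norm_le _ (by positivity)]; exact hNb _
    calc 4 * Real.pi * ‖N (q z)‖ ≤ 4 * Real.pi * (C₀ * |ε|) := by gcongr
      _ = 4 * Real.pi * C₀ * |ε| := by ring
      _ ≤ _ := by
        gcongr
        have : 0 ≤ 2 * ε₁ * C₂ + 2 * ε₁ * C₁ := by positivity
        linarith
  · intro z x
    refine (hNb _ x).trans ?_
    gcongr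
    have : 0 ≤ 4 * Real.pi * C₀ + 2 * ε₁ * C₂ + 2 * ε₁ * C₁ := by positivity
    linarith
  · exact fun z z' x => (hx z z' x).trans (hlip z z')
  · intro z z' x
    have h1 : ‖N (q z) x - N (q z') x‖ ≤ ‖N (q z) - N (q z')‖ :=
      (N (q z) - N (q z')).norm_coe_le_norm x
    calc _ ≤ |ε| * C₂ * ‖q z - q z'‖ := h1.trans (hNl _ _)
      _ ≤ ε₁ * C₂ * (2 * ‖z - z'‖) := by gcongr; exact hlip z z'
      _ = 2 * ε₁ * C₂ * ‖z - z'‖ := by ring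
      _ ≤ _ := by
        gcongr
        have : 0 ≤ 4 * Real.pi * C₀ + C₀ + 2 * ε₁ * C₁ := by positivity
        linarith
  · intro z z'
    calc _ ≤ |ε| * C₁ * ‖q z - q z'‖ := norm_multiplier_sub_le hm hB hL h _ _
      _ ≤ ε₁ * C₁ * (2 * ‖z - z'‖) := by gcongr; exact hlip z z'
      _ = 2 * ε₁ * C₁ * ‖z - z'‖ := by ring
      _ ≤ _ := by
        gcongr
        have : 0 ≤ 4 * Real.pi * C₀ + C₀ + 2 * ε₁ * C₂ := by positivity
        linarith

/-! ### Bounds for the coefficients -/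

/-- A family of functions which is uniformly bounded and uniformly Lipschitz. -/
def UnifBddLip {ι : Type*} (S : Set ι) (f : ι → ℂ → ℝ) : Prop :=
  ∃ B L : ℝ, 0 ≤ B ∧ 0 ≤ L ∧ (∀ i ∈ S, ∀ q, |f i q| ≤ B) ∧
    ∀ i ∈ S, ∀ q q', |f i q - f i q'| ≤ L * ‖q - q'‖

namespace UnifBddLip

variable {ι : Type*} {S : Set ι} {f g : ι → ℂ → ℝ}

lemma of_const {c : ι → ℝ} {B : ℝ} (hB : 0 ≤ B) (h : ∀ i ∈ S, |c i| ≤ B) :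
    UnifBddLip S fun i _ => c i :=
  ⟨B, 0, hB, le_rfl, fun i hi _ => h i hi, fun i _ q q' => by simp⟩

lemma mul (hf : UnifBddLip S f) (hg : UnifBddLip S g) : UnifBddLip S fun i q => f i q * g i q := by
  obtain ⟨B, L, hB, hL, hf1, hf2⟩ := hf
  obtain ⟨B', L', hB', hL', hg1, hg2⟩ := hg
  refine ⟨B * B', B * L' + L * B', by positivity, by positivity, fun i hi q => ?_,
    fun i hi q q' => ?_⟩
  · rw [abs_mul]
    gcongr
    exacts [hf1 i hi q, hg1 i hi q]
  · have e : f i q * g i q - f i q' * g i q' =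
        f i q * (g i q - g i q') + (f i q - f i q') * g i q' := by ring
    rw [e]
    refine (abs_add_le _ _).trans ?_
    rw [abs_mul, abs_mul]
    calc _ ≤ B * (L' * ‖q - q'‖) + L * ‖q - q'‖ * B' := by
          gcongr
          exacts [hf1 i hi q, hg2 i hi q q', hf2 i hi q q', hg1 i hi q']
      _ = _ := by ring

lemma add (hf : UnifBddLip S f) (hg : UnifBddLip S g) : UnifBddLip S fun i q => f i q + g i q := by
  obtain ⟨B, L, hB, hL, hf1, hf2⟩ := hf
  obtain ⟨B', L', hB', hL', hg1, hg2⟩ := hg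
  refine ⟨B + B', L + L', by positivity, by positivity, fun i hi q => ?_, fun i hi q q' => ?_⟩
  · exact (abs_add_le _ _).trans (add_le_add (hf1 i hi q) (hg1 i hi q))
  · have e : f i q + g i q - (f i q' + g i q') = (f i q - f i q') + (g i q - g i q') := by ring
    rw [e, add_mul]
    exact (abs_add_le _ _).trans (add_le_add (hf2 i hi q q') (hg2 i hi q q'))

lemma inv (hf : UnifBddLip S f) {m : ℝ} (hm : 0 < m) (h : ∀ i ∈ S, ∀ q, m ≤ f i q) :
    UnifBddLip S fun i q => (f i q)⁻¹ := by
  obtain ⟨B, L, hB, hL, hf1, hf2⟩ := hf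
  refine ⟨m⁻¹, L * (m⁻¹ * m⁻¹), by positivity, by positivity, fun i hi q => ?_,
    fun i hi q q' => ?_⟩
  · rw [abs_of_pos (inv_pos.2 (hm.trans_le (h i hi q)))]
    exact inv_anti₀ hm (h i hi q)
  · have p := hm.trans_le (h i hi q)
    have p' := hm.trans_le (h i hi q')
    have e : (f i q)⁻¹ - (f i q')⁻¹ = -(f i q - f i q') * ((f i q)⁻¹ * (f i q')⁻¹) := by
      field_simp; ring
    rw [e, abs_mul, abs_neg, abs_mul, abs_of_pos (inv_pos.2 p), abs_of_pos (inv_pos.2 p')]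
    calc _ ≤ L * ‖q - q'‖ * (m⁻¹ * m⁻¹) := by
          gcongr
          exacts [hf2 i hi q q', h i hi q, h i hi q']
      _ = _ := by ring

end UnifBddLip

/-! ### Coefficients of the reduced equation for a truncated curvature -/

/-- Truncation of a real number to the interval `[m, M]`. -/
def clamp (m M y : ℝ) : ℝ := max m (min y M)

lemma le_clamp (m M y : ℝ) : m ≤ clamp m M y := le_max_left _ _

lemma clamp_le {m M : ℝ} (h : m ≤ M) (y : ℝ) : clamp m M y ≤ M := max_le h (min_le_right _ _)

lemma clamp_of_mem {m M y : ℝ} (h1 : m ≤ y) (h2 : y ≤ M) : clamp m M y = y := by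
  rw [clamp, min_eq_left h2, max_eq_right h1]

lemma abs_clamp_sub_le (m M y y' : ℝ) : |clamp m M y - clamp m M y'| ≤ |y - y'| := by
  unfold clamp
  have h1 := abs_max_sub_max_le_abs (min y M) (min y' M) m
  have h2 := abs_min_sub_min_le_max y M y' M
  rw [sub_self, abs_zero, max_eq_left (abs_nonneg _)] at h2
  rw [max_comm m, max_comm m]
  exact h1.trans h2

lemma continuous_clamp (m M : ℝ) : Continuous (clamp m M) := by unfold clamp; fun_prop

/-- The value of the curvature density along the loop `ω_q`. -/
def kap (k : ℝ) (K : ℂ → ℝ) (x : Circle) (q : ℂ) : ℝ := K (omegaAt k q x)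

/-- The weight `s² + ε κ (k - x₂)`. -/
def wgt (k : ℝ) (K : ℂ → ℝ) (ε : ℝ) (x : Circle) (q : ℂ) : ℝ :=
  sk k ^ 2 + ε * (kap k K x q * (k - (x : ℂ).im))

lemma abs_circle_im_le (x : Circle) : |(x : ℂ).im| ≤ 1 := by
  have := Complex.abs_im_le_norm (x : ℂ)
  rwa [Circle.norm_coe] at this

lemma circle_den_pos {k : ℝ} (hk : 1 < k) (x : Circle) : 0 < k - (x : ℂ).im := by
  have := (abs_le.1 (abs_circle_im_le x)).2
  linarith

lemma continuous_circle_im : Continuous fun x : Circle => (x : ℂ).im :=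
  Complex.continuous_im.comp continuous_subtype_val

lemma continuous_omega {k : ℝ} (hk : 1 < k) : Continuous (omega k) := by
  rw [circleExp_isQuotientMap.continuous_iff]
  have : omega k ∘ Circle.exp = refCurve k := funext fun t => lift_omega k t
  rw [this]
  exact continuous_refCurve hk

lemma continuous_omegaAt {k : ℝ} (hk : 1 < k) :
    Continuous fun p : Circle × ℂ => omegaAt k p.2 p.1 := by
  have := continuous_omega hk
  unfold omegaAt
  fun_prop

lemma exists_norm_omega_le {k : ℝ} (hk : 1 < k) : ∃ W : ℝ, 0 ≤ W ∧ ∀ x, ‖omega k x‖ ≤ W := by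
  let g : C(Circle, ℂ) := ⟨omega k, continuous_omega hk⟩
  exact ⟨‖g‖, norm_nonneg _, fun x => g.norm_coe_le_norm x⟩

lemma norm_omegaAt_sub_le (k : ℝ) {W : ℝ} {x : Circle} (hW : ‖omega k x‖ ≤ W) (q q' : ℂ) :
    ‖omegaAt k q x - omegaAt k q' x‖ ≤ (1 + W) * ‖q - q'‖ := by
  have e : omegaAt k q x - omegaAt k q' x =
      (((q - q').re : ℝ) : ℂ) + (((q - q').im : ℝ) : ℂ) * omega k x := by
    simp [omegaAt]; ring
  rw [e]
  refine (norm_add_le _ _).trans ?_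
  rw [norm_mul, Complex.norm_real, Complex.norm_real, Real.norm_eq_abs, Real.norm_eq_abs]
  have h1 := Complex.abs_re_le_norm (q - q')
  have h2 := Complex.abs_im_le_norm (q - q')
  calc _ ≤ ‖q - q'‖ + ‖q - q'‖ * W := by gcongr
    _ = _ := by ring

/-- The curvature densities obtained by truncation: `C¹` with compact support in the half-plane. -/
structure IsTruncated (K : ℂ → ℝ) : Prop where
  contDiff : ContDiff ℝ 1 K
  compact : HasCompactSupport K
  subset : tsupport K ⊆ halfPlane

lemma exists_bounds_of_hasCompactSupport {K : ℂ → ℝ} (h : ContDiff ℝ 1 K)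
    (hc : HasCompactSupport K) : ∃ M L : ℝ, 0 ≤ M ∧ 0 ≤ L ∧ (∀ z, |K z| ≤ M) ∧
      ∀ z w, |K z - K w| ≤ L * ‖z - w‖ := by
  obtain ⟨M, hM⟩ := hc.exists_bound_of_continuous h.continuous
  obtain ⟨L, hL⟩ := h.lipschitzWith_of_hasCompactSupport hc (by norm_num)
  refine ⟨M, L, (norm_nonneg _).trans (hM 0), L.2, hM, fun z w => ?_⟩
  simpa [dist_eq_norm] using hL.dist_le_mul z w

lemma isOpen_halfPlane : IsOpen halfPlane := isOpen_lt continuous_const Complex.continuous_im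

/-- The denominator vanishes only on the real axis, near which `K` is identically zero. -/
lemma IsTruncated.contDiff_density {K : ℂ → ℝ} (h : IsTruncated K) :
    ContDiff ℝ 1 fun w => K w / w.im ^ 2 := by
  rw [contDiff_iff_contDiffAt]
  intro w
  by_cases hw : w ∈ tsupport K
  · have hpos : 0 < w.im := h.subset hw
    exact h.contDiff.contDiffAt.div (Complex.imCLM.contDiff.contDiffAt.pow 2)
      (pow_ne_zero 2 hpos.ne')
  · have h0 : K =ᶠ[𝓝 w] 0 := notMem_tsupport_iff_eventuallyEq.1 hw
    have h1 : (fun w => K w / w.im ^ 2) =ᶠ[𝓝 w] fun _ => 0 := by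
      filter_upwards [h0] with v hv
      simp [hv]
    exact contDiffAt_const.congr_of_eventuallyEq h1

lemma IsTruncated.hasCompactSupport_density {K : ℂ → ℝ} (h : IsTruncated K) :
    HasCompactSupport fun w => K w / w.im ^ 2 := by
  refine h.compact.mono fun w hw => ?_
  rw [Function.mem_support] at hw ⊢
  intro h0
  exact hw (by simp [h0])

/-- The coefficient of the multiplier in the reduced equation. -/
def coef₁ (k : ℝ) (K : ℂ → ℝ) (m M ε : ℝ) (x : Circle) (q : ℂ) : ℝ :=
  clamp m M q.im * clamp m M q.im * (wgt k K ε x q)⁻¹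

/-- The forcing coefficient in the reduced equation. -/
def coef₂ (k : ℝ) (K : ℂ → ℝ) (m M ε : ℝ) (x : Circle) (q : ℂ) : ℝ :=
  kap k K x q * clamp m M q.im * (wgt k K ε x q)⁻¹

/-- The inverse of `coef₁`. -/
def dual₁ (k : ℝ) (K : ℂ → ℝ) (m M ε : ℝ) (x : Circle) (q : ℂ) : ℝ :=
  wgt k K ε x q * ((clamp m M q.im)⁻¹ * (clamp m M q.im)⁻¹)

/-- The quotient of `coef₂` by `coef₁`. -/
def dual₂ (k : ℝ) (K : ℂ → ℝ) (m M : ℝ) (x : Circle) (q : ℂ) : ℝ :=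
  kap k K x q * (clamp m M q.im)⁻¹

/-- All the bounds on the coefficients, for a fixed value of the parameter. -/
structure AllBounds (k : ℝ) (K : ℂ → ℝ) (m M m₁ B L ε : ℝ) : Prop where
  coeff : CoeffBounds m₁ B L (coef₁ k K m M ε) (coef₂ k K m M ε)
  wgt_lower : ∀ x q, sk k ^ 2 / 2 ≤ wgt k K ε x q
  kap_bound : ∀ x q, |kap k K x q * (k - (x : ℂ).im)| ≤ B
  dual_lip₁ : ∀ x q q', |dual₁ k K m M ε x q - dual₁ k K m M ε x q'| ≤ L * ‖q - q'‖
  dual_lip₂ : ∀ x q q', |dual₂ k K m M x q - dual₂ k K m M x q'| ≤ L * ‖q - q'‖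

lemma continuous_kap {k : ℝ} (hk : 1 < k) {K : ℂ → ℝ} (hK : Continuous K) :
    Continuous fun p : Circle × ℂ => kap k K p.1 p.2 := hK.comp (continuous_omegaAt hk)

lemma continuous_wgt {k : ℝ} (hk : 1 < k) {K : ℂ → ℝ} (hK : Continuous K) (ε : ℝ) :
    Continuous fun p : Circle × ℂ => wgt k K ε p.1 p.2 := by
  have h1 := continuous_kap hk hK
  have h2 : Continuous fun p : Circle × ℂ => (p.1 : ℂ).im :=
    continuous_circle_im.comp continuous_fst
  unfold wgt
  fun_prop

/-- All coefficients are products of bounded Lipschitz functions and inverses of such functions.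
Clamping the height bounds it above and away from zero on the whole plane, so the contraction needs
no invariant domain, and the weight is bounded below for small `ε`. -/
lemma exists_allBounds {k : ℝ} (hk : 1 < k) {K : ℂ → ℝ} (hK : IsTruncated K) {m M : ℝ}
    (hm : 0 < m) (hmM : m ≤ M) : ∃ ε₁ m₁ B L : ℝ, 0 < ε₁ ∧ 0 < m₁ ∧ 0 ≤ B ∧ 0 ≤ L ∧
      ∀ ε, |ε| < ε₁ → AllBounds k K m M m₁ B L ε := by
  have hs := sk_pos hk
  obtain ⟨MK, LK, hMK, hLK, hKb, hKl⟩ := exists_bounds_of_hasCompactSupport hK.contDiff hK.compact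
  obtain ⟨W, hW, hωW⟩ := exists_norm_omega_le hk
  have hK0 := hK.contDiff.continuous
  -- `MK * (k + 1)` bounds `κ (k - x₂)`, so the perturbation of the weight is at most half of `sk k
  -- ^ 2`; the extra `1` keeps the denominator positive when `MK = 0`.
  set ε₁ : ℝ := sk k ^ 2 / (2 * (MK * (k + 1) + 1)) with hε₁
  have hk0 : 0 < k := by linarith
  have hε₁0 : 0 < ε₁ := by positivity
  -- Indexing by pairs `(ε, x)` makes the constants uniform in both variables.
  let S : Set (ℝ × Circle) := {p | |p.1| < ε₁}
  have hden : ∀ x : Circle, |k - (x : ℂ).im| ≤ k + 1 := fun x => by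
    have := abs_le.1 (abs_circle_im_le x)
    rw [abs_le]; constructor <;> linarith
  have ukap : UnifBddLip S fun p q => kap k K p.2 q :=
    ⟨MK, LK * (1 + W), hMK, by positivity, fun p _ q => hKb _, fun p _ q q' => by
      refine (hKl _ _).trans ?_
      rw [mul_assoc]
      gcongr
      exact norm_omegaAt_sub_le k (hωW p.2) q q'⟩
  have ud : UnifBddLip S fun p _ => k - (p.2 : ℂ).im :=
    .of_const (by linarith) fun p _ => hden p.2
  have ukd := ukap.mul ud
  have ueps : UnifBddLip S fun p _ => p.1 := .of_const hε₁0.le fun p hp => le_of_lt hp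
  have uw : UnifBddLip S fun p q => wgt k K p.1 p.2 q :=
    (UnifBddLip.of_const (sq_nonneg (sk k)) fun p _ => (abs_of_nonneg (sq_nonneg _)).le).add
      (ueps.mul ukd)
  have hkd : ∀ x q, |kap k K x q * (k - (x : ℂ).im)| ≤ MK * (k + 1) := fun x q => by
    rw [abs_mul]
    gcongr
    exacts [hKb _, hden x]
  have hpert : ∀ ε, |ε| < ε₁ → ∀ x q,
      |ε * (kap k K x q * (k - (x : ℂ).im))| ≤ sk k ^ 2 / 2 := fun ε hε x q => by
    rw [abs_mul]
    calc _ ≤ ε₁ * (MK * (k + 1) + 1) := by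
          gcongr
          exact (hkd x q).trans (by linarith)
      _ = _ := by rw [hε₁]; field_simp
  have hwl : ∀ ε, |ε| < ε₁ → ∀ x q, sk k ^ 2 / 2 ≤ wgt k K ε x q := fun ε hε x q => by
    have := (abs_le.1 (hpert ε hε x q)).1
    unfold wgt
    linarith
  have uwi := uw.inv (m := sk k ^ 2 / 2) (by positivity) fun p hp q => hwl p.1 hp p.2 q
  have ucl : UnifBddLip S fun _ q => clamp m M q.im :=
    ⟨M, 1, hm.le.trans hmM, zero_le_one, fun _ _ q => by
      rw [abs_of_pos (hm.trans_le (le_clamp _ _ _))]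
      exact clamp_le hmM _, fun _ _ q q' => by
      rw [one_mul]
      refine (abs_clamp_sub_le _ _ _ _).trans ?_
      rw [← Complex.sub_im]
      exact Complex.abs_im_le_norm _⟩
  have ucli := ucl.inv hm fun _ _ q => le_clamp m M q.im
  obtain ⟨B₁, L₁, hB₁, hL₁, b1, l1⟩ := (ucl.mul ucl).mul uwi
  obtain ⟨B₂, L₂, hB₂, hL₂, b2, l2⟩ := (ukap.mul ucl).mul uwi
  obtain ⟨-, L₃, -, hL₃, -, l3⟩ := uw.mul (ucli.mul ucli)
  obtain ⟨-, L₄, -, hL₄, -, l4⟩ := ukap.mul ucli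
  have hwu : ∀ ε, |ε| < ε₁ → ∀ x q, wgt k K ε x q ≤ 2 * sk k ^ 2 := fun ε hε x q => by
    have := (abs_le.1 (hpert ε hε x q)).2
    unfold wgt
    nlinarith
  refine ⟨ε₁, m * m * (2 * sk k ^ 2)⁻¹, B₁ + B₂ + MK * (k + 1), L₁ + L₂ + L₃ + L₄, hε₁0,
    by positivity, by positivity, by positivity, fun ε hε => ?_⟩
  have hwpos : ∀ x q, 0 < wgt k K ε x q := fun x q =>
    lt_of_lt_of_le (by positivity) (hwl ε hε x q)
  have hccl : Continuous fun p : Circle × ℂ => clamp m M p.2.im :=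
    (continuous_clamp m M).comp (Complex.continuous_im.comp continuous_snd)
  have hmem : ∀ x : Circle, (ε, x) ∈ S := fun x => hε
  have hle : ∀ {a b : ℝ} {q q' : ℂ}, a ≤ b → a * ‖q - q'‖ ≤ b * ‖q - q'‖ := fun h => by gcongr
  have hMKk : 0 ≤ MK * (k + 1) := by positivity
  refine ⟨⟨?_, ?_, ?_, ?_, ?_, ?_, ?_⟩, hwl ε hε, ?_, ?_, ?_⟩
  · exact (hccl.mul hccl).mul ((continuous_wgt hk hK0 ε).inv₀ fun p => (hwpos p.1 p.2).ne')
  · exact ((continuous_kap hk hK0).mul hccl).mul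
      ((continuous_wgt hk hK0 ε).inv₀ fun p => (hwpos p.1 p.2).ne')
  · intro x q
    have h1 := le_clamp m M q.im
    have h3 := hm.le.trans h1
    have h2 := inv_anti₀ (hwpos x q) (hwu ε hε x q)
    unfold coef₁
    gcongr
  · intro x q
    exact (le_abs_self _).trans ((b1 (ε, x) (hmem x) q).trans (by linarith))
  · intro x q
    exact (b2 (ε, x) (hmem x) q).trans (by linarith)
  · intro x q q'
    exact (l1 (ε, x) (hmem x) q q').trans (hle (by linarith))
  · intro x q q'
    exact (l2 (ε, x) (hmem x) q q').trans (hle (by linarith))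
  · intro x q
    exact (hkd x q).trans (by linarith)
  · intro x q q'
    exact (l3 (ε, x) (hmem x) q q').trans (hle (by linarith))
  · intro x q q'
    exact (l4 (ε, x) (hmem x) q q').trans (hle (by linarith))

/-! ### The action functional and its second order expansion -/

/-- The loop `x ↦ ω_{q(x)}(x)` in the angular variable. -/
def loopCurve (k : ℝ) (q : Circle → ℂ) (t : ℝ) : ℂ :=
  ((q (Circle.exp t)).re : ℂ) + ((q (Circle.exp t)).im : ℂ) * refCurve k t

/-- The velocity of `loopCurve k q` if `q` has derivative `v`. -/
def loopVel (k : ℝ) (q v : Circle → ℂ) (t : ℝ) : ℂ :=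
  loopCurve k v t + ((q (Circle.exp t)).im : ℂ) * refVel k t

/-- `v` is the angular derivative of `q`. -/
def HasVel (q v : C(Circle, ℂ)) : Prop :=
  ∀ t, HasDerivAt (fun t => q (Circle.exp t)) (v (Circle.exp t)) t

lemma HasVel.sub {q v q' v' : C(Circle, ℂ)} (h : HasVel q v) (h' : HasVel q' v') :
    HasVel (q - q') (v - v') := fun t => (h t).sub (h' t)

lemma hasVel_const (z : ℂ) : HasVel (ContinuousMap.const _ z) 0 := fun t => hasDerivAt_const t z

lemma hasDerivAt_loopCurve {k : ℝ} (hk : 1 < k) {q v : C(Circle, ℂ)} (h : HasVel q v) (t : ℝ) :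
    HasDerivAt (loopCurve k q) (loopVel k q v t) t := by
  have h1 := (hasDerivAt_re (h t)).ofReal_comp
  have h2 := (hasDerivAt_im (h t)).ofReal_comp
  refine (h1.add (h2.mul (hasDerivAt_refCurve hk t))).congr_deriv ?_
  simp only [loopVel, loopCurve]
  ring

lemma continuous_loopCurve {k : ℝ} (hk : 1 < k) (q : C(Circle, ℂ)) :
    Continuous (loopCurve k q) := by
  have h1 := continuous_refCurve hk
  have h2 : Continuous fun t => q (Circle.exp t) := q.continuous.comp Circle.exp.continuous
  unfold loopCurve
  fun_prop

lemma continuous_loopVel {k : ℝ} (hk : 1 < k) (q v : C(Circle, ℂ)) :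
    Continuous (loopVel k q v) := by
  have h1 := continuous_refVel hk
  have h2 : Continuous fun t => q (Circle.exp t) := q.continuous.comp Circle.exp.continuous
  have h3 := continuous_loopCurve hk v
  unfold loopVel
  fun_prop

lemma circleExp_two_pi : Circle.exp (2 * Real.pi) = Circle.exp 0 := by
  have := circleExp_periodic 0
  rwa [zero_add] at this

lemma loopCurve_two_pi (k : ℝ) (q : Circle → ℂ) :
    loopCurve k q (2 * Real.pi) = loopCurve k q 0 := by
  simp only [loopCurve, circleExp_two_pi, refCurve_two_pi]

lemma loopCurve_add_sub (k : ℝ) (q q' : C(Circle, ℂ)) (t : ℝ) :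
    loopCurve k q t + loopCurve k (q' - q : C(Circle, ℂ)) t = loopCurve k q' t := by
  simp [loopCurve]; ring

lemma loopVel_add_sub (k : ℝ) (q v q' v' : C(Circle, ℂ)) (t : ℝ) :
    loopVel k q v t + loopVel k (q' - q : C(Circle, ℂ)) (v' - v : C(Circle, ℂ)) t =
      loopVel k q' v' t := by
  rw [loopVel, loopVel, loopVel, ← loopCurve_add_sub k v v']
  simp
  ring

lemma exists_norm_ref_le {k : ℝ} (hk : 1 < k) : ∃ W : ℝ, 0 ≤ W ∧
    (∀ t, ‖refCurve k t‖ ≤ W) ∧ (∀ t, ‖refVel k t‖ ≤ W) ∧ ∀ t, ‖refAcc k t‖ ≤ W := by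
  have key : ∀ g : ℝ → ℂ, Continuous g → Function.Periodic g (2 * Real.pi) →
      ∃ W : ℝ, 0 ≤ W ∧ ∀ t, ‖g t‖ ≤ W := fun g hg hp => by
    obtain ⟨G, hG⟩ := exists_continuousMap_circle hg hp
    exact ⟨‖G‖, norm_nonneg _, fun t => hG t ▸ G.norm_coe_le_norm _⟩
  obtain ⟨W₁, p1, h1⟩ := key _ (continuous_refCurve hk) (refCurve_periodic k)
  obtain ⟨W₂, p2, h2⟩ := key _ (continuous_refVel hk) (fun t => by simp [refVel])
  obtain ⟨W₃, p3, h3⟩ := key _ (continuous_refAcc hk) (fun t => by simp [refAcc])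
  exact ⟨W₁ + W₂ + W₃, by positivity, fun t => (h1 t).trans (by linarith),
    fun t => (h2 t).trans (by linarith), fun t => (h3 t).trans (by linarith)⟩

lemma norm_loopCurve_le {k W δ : ℝ} {q : Circle → ℂ} {t : ℝ} (hW : ‖refCurve k t‖ ≤ W)
    (h : ‖q (Circle.exp t)‖ ≤ δ) : ‖loopCurve k q t‖ ≤ (1 + W) * δ := by
  have h0 : 0 ≤ δ := (norm_nonneg _).trans h
  refine (norm_add_le _ _).trans ?_
  rw [norm_mul, Complex.norm_real, Complex.norm_real, Real.norm_eq_abs, Real.norm_eq_abs]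
  have h1 := (Complex.abs_re_le_norm (q (Circle.exp t))).trans h
  have h2 := (Complex.abs_im_le_norm (q (Circle.exp t))).trans h
  calc _ ≤ δ + δ * W := by gcongr
    _ = _ := by ring

lemma norm_loopVel_le {k W δ : ℝ} {q v : Circle → ℂ} {t : ℝ} (hW : ‖refCurve k t‖ ≤ W)
    (hW' : ‖refVel k t‖ ≤ W) (h : ‖q (Circle.exp t)‖ ≤ δ) (h' : ‖v (Circle.exp t)‖ ≤ δ) :
    ‖loopVel k q v t‖ ≤ (1 + 2 * W) * δ := by
  have h0 : 0 ≤ δ := (norm_nonneg _).trans h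
  refine (norm_add_le _ _).trans ?_
  rw [norm_mul, Complex.norm_real, Real.norm_eq_abs]
  have h1 := norm_loopCurve_le hW h'
  have h2 := (Complex.abs_im_le_norm (q (Circle.exp t))).trans h
  calc _ ≤ (1 + W) * δ + δ * W := by gcongr
    _ = _ := by ring

lemma continuous_det2 {X : Type*} [TopologicalSpace X] {f g : X → ℂ} (hf : Continuous f)
    (hg : Continuous g) : Continuous fun x => det2 (f x) (g x) := by
  unfold det2; fun_prop

/-- The action functional whose critical points are the loops of curvature `k + ε K`. -/
def action (k : ℝ) (K : ℂ → ℝ) (ε : ℝ) (q v : Circle → ℂ) : ℝ :=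
  sk k ^ 2 * cint (fun x => (v x).re / (q x).im) +
    ε * (sk k * encArea (fun w => K w / w.im ^ 2) (loopCurve k q) (loopVel k q v))

/-- The density of the first variation of the action. -/
def gradDensity (k : ℝ) (K : ℂ → ℝ) (ε : ℝ) (q v : Circle → ℂ) (x : Circle) : ℂ :=
  ((wgt k K ε x (q x) / (q x).im ^ 2 : ℝ) : ℂ) * v x +
    ((ε * (kap k K x (q x) / (q x).im) : ℝ) : ℂ) * (Complex.I * x)

lemma loopCurve_eq_omegaAt (k : ℝ) (q : Circle → ℂ) (t : ℝ) :
    loopCurve k q t = omegaAt k (q (Circle.exp t)) (Circle.exp t) := (lift_omegaAt k q t).symm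

/-- The area form pulled back through `q ↦ ω_q(x)`. The velocity of the loop has a part from `v`,
which produces the term `ε κ (k - x₂)` of the weight, and a part from the motion of `x`, which
produces the forcing along `i x`. -/
lemma density_mul_det2 {k : ℝ} (hk : 1 < k) (K : ℂ → ℝ) (q v h : Circle → ℂ) (t : ℝ)
    (hq : 0 < (q (Circle.exp t)).im) :
    sk k * (K (loopCurve k q t) / (loopCurve k q t).im ^ 2 *
      det2 (loopCurve k h t) (loopVel k q v t)) =
    kap k K (Circle.exp t) (q (Circle.exp t)) * ((k - Real.sin t) *
      (det2 (h (Circle.exp t)) (v (Circle.exp t)) / (q (Circle.exp t)).im ^ 2) +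
      det2 (h (Circle.exp t)) (Complex.I * Circle.exp t) / (q (Circle.exp t)).im) := by
  have hD := (den_pos hk t).ne'
  have hs := (sk_pos hk).ne'
  have hsc := Real.sin_sq_add_cos_sq t
  rw [kap, ← loopCurve_eq_omegaAt]
  have him : (loopCurve k q t).im = (q (Circle.exp t)).im * (sk k / (k - Real.sin t)) := by
    simp [loopCurve, refCurve]
  rw [him]
  generalize K (loopCurve k q t) = κ
  rw [coe_circleExp]
  simp only [loopVel, loopCurve, refCurve, refVel, det2, Complex.add_re, Complex.add_im,
    Complex.re_ofReal_mul, Complex.im_ofReal_mul, Complex.ofReal_re, Complex.ofReal_im,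
    Complex.I_mul_re, Complex.I_mul_im]
  generalize q (Circle.exp t) = a at *
  generalize v (Circle.exp t) = b
  generalize h (Circle.exp t) = c
  have hq' := hq.ne'
  have hc2 : Real.cos t ^ 2 = 1 - Real.sin t ^ 2 := by linarith
  field_simp
  ring_nf
  simp only [hc2]
  ring

/-- Second order expansion of the kinetic part of the action. -/
lemma abs_kinetic_sub_le {q v q' v' : C(Circle, ℂ)} (h : HasVel q v) (h' : HasVel q' v')
    {m B δ : ℝ} (hm : 0 < m) (hB : 0 ≤ B) (hq : ∀ x, m ≤ (q x).im) (hq' : ∀ x, m ≤ (q' x).im)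
    (hv : ∀ x, ‖v x‖ ≤ B) (hδ : ∀ x, ‖q' x - q x‖ ≤ δ) (hδ' : ∀ x, ‖v' x - v x‖ ≤ δ) :
    |cint (fun x => (v' x).re / (q' x).im) - cint (fun x => (v x).re / (q x).im) -
      cint (fun x => det2 (q' x - q x) (v x) / (q x).im ^ 2)| ≤
      (1 / m ^ 2 + B / m ^ 3) * δ ^ 2 * (2 * Real.pi) := by
  have hpos : ∀ x, 0 < (q x).im := fun x => hm.trans_le (hq x)
  have hpos' : ∀ x, 0 < (q' x).im := fun x => hm.trans_le (hq' x)
  have hδ0 : 0 ≤ δ := (norm_nonneg _).trans (hδ 1)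
  have cre : ∀ w : C(Circle, ℂ), Continuous fun x => (w x).re := fun w =>
    Complex.continuous_re.comp w.continuous
  have cim : ∀ w : C(Circle, ℂ), Continuous fun x => (w x).im := fun w =>
    Complex.continuous_im.comp w.continuous
  have cq := cre q
  have cq' := cre q'
  have cv := cre v
  have cv' := cre v'
  have dq := cim q
  have dq' := cim q'
  have dv := cim v
  have c1 : Continuous fun x => (v' x).re / (q' x).im := cv'.div dq' fun x => (hpos' x).ne'
  have c2 : Continuous fun x => (v x).re / (q x).im := cv.div dq fun x => (hpos x).ne'
  have c3 : Continuous fun x => det2 (q' x - q x) (v x) / (q x).im ^ 2 := by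
    refine Continuous.div ?_ (dq.pow 2) fun x => pow_ne_zero 2 (hpos x).ne'
    simp only [det2, Complex.sub_re, Complex.sub_im]
    fun_prop
  -- `g` is the angular derivative of `(q'₁ - q₁) / q₂`, hence has zero integral. Subtracting it
  -- leaves an integrand quadratic in `q' - q` and `v' - v`.
  set g : Circle → ℝ := fun x => ((v' x).re - (v x).re) / (q x).im -
    ((q' x).re - (q x).re) * (v x).im / (q x).im ^ 2 with hg
  have cg : Continuous g := by
    refine Continuous.sub (Continuous.div (by fun_prop) dq fun x => (hpos x).ne')
      (Continuous.div (by fun_prop) (dq.pow 2) fun x => pow_ne_zero 2 (hpos x).ne')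
  have hg0 : cint g = 0 := by
    have hd : ∀ t, HasDerivAt (fun t => ((q' (Circle.exp t)).re - (q (Circle.exp t)).re) /
        (q (Circle.exp t)).im) (g (Circle.exp t)) t := fun t => by
      have h1 := ((hasDerivAt_re (h' t)).sub (hasDerivAt_re (h t))).div (hasDerivAt_im (h t))
        (hpos _).ne'
      refine h1.congr_deriv ?_
      have := (hpos (Circle.exp t)).ne'
      simp only [hg, Pi.sub_apply]
      field_simp
    have := intervalIntegral.integral_eq_sub_of_hasDerivAt (a := 0) (b := 2 * Real.pi)
      (fun t _ => hd t) ((cg.comp Circle.exp.continuous).intervalIntegrable _ _)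
    rw [circleExp_two_pi, sub_self] at this
    exact this
  have c12 : Continuous fun x => (v' x).re / (q' x).im - (v x).re / (q x).im := c1.sub c2
  have c123 : Continuous fun x => (v' x).re / (q' x).im - (v x).re / (q x).im -
    det2 (q' x - q x) (v x) / (q x).im ^ 2 := c12.sub c3
  have e0 := cint_sub c123 cg
  rw [hg0, sub_zero] at e0
  rw [← cint_sub c1 c2, ← cint_sub c12 c3, ← e0, ← Real.norm_eq_abs]
  refine norm_cint_le fun x => ?_
  have p := hpos x
  have p' := hpos' x
  have e : (v' x).re / (q' x).im - (v x).re / (q x).im -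
      det2 (q' x - q x) (v x) / (q x).im ^ 2 - g x =
      -(((v' x - v x).re * (q' x - q x).im) * ((q x).im⁻¹ * (q' x).im⁻¹)) +
        ((v x).re * (q' x - q x).im ^ 2) * ((q x).im⁻¹ ^ 2 * (q' x).im⁻¹) := by
    simp only [hg, det2, Complex.sub_re, Complex.sub_im]
    field_simp
    ring
  have i1 : (q x).im⁻¹ ≤ m⁻¹ := inv_anti₀ hm (hq x)
  have i2 : (q' x).im⁻¹ ≤ m⁻¹ := inv_anti₀ hm (hq' x)
  have j1 := (Complex.abs_re_le_norm (v' x - v x)).trans (hδ' x)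
  have j2 := (Complex.abs_im_le_norm (q' x - q x)).trans (hδ x)
  have j3 := (Complex.abs_re_le_norm (v x)).trans (hv x)
  rw [e, Real.norm_eq_abs]
  refine (abs_add_le _ _).trans ?_
  rw [abs_neg, abs_mul, abs_mul, abs_mul _ ((q x).im⁻¹ ^ 2 * (q' x).im⁻¹), abs_mul (v x).re,
    abs_of_pos (mul_pos (inv_pos.2 p) (inv_pos.2 p')),
    abs_of_pos (mul_pos (pow_pos (inv_pos.2 p) 2) (inv_pos.2 p')), abs_pow]
  have k1 := (inv_pos.2 p).le
  have k2 := (inv_pos.2 p').le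
  calc _ ≤ (δ * δ) * (m⁻¹ * m⁻¹) + (B * δ ^ 2) * (m⁻¹ ^ 2 * m⁻¹) := by gcongr
    _ = _ := by field_simp

/-- Second order expansion of the action. -/
lemma exists_abs_action_sub_le {k : ℝ} (hk : 1 < k) {K : ℂ → ℝ} (hK : IsTruncated K) {m B : ℝ}
    (hm : 0 < m) (hB : 0 ≤ B) : ∃ C : ℝ, 0 ≤ C ∧ ∀ ε : ℝ, |ε| ≤ 1 → ∀ q v q' v' : C(Circle, ℂ),
      HasVel q v → HasVel q' v' → (∀ x, m ≤ (q x).im) → (∀ x, m ≤ (q' x).im) →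
      (∀ x, ‖q x‖ ≤ B) → (∀ x, ‖v x‖ ≤ B) → ∀ δ, δ ≤ 1 → (∀ x, ‖q' x - q x‖ ≤ δ) →
      (∀ x, ‖v' x - v x‖ ≤ δ) → |action k K ε q' v' - action k K ε q v -
        cint (fun x => det2 (q' x - q x) (gradDensity k K ε q v x))| ≤ C * δ ^ 2 := by
  have hpi := Real.pi_pos
  have hs := sk_pos hk
  obtain ⟨W, hW, w0, w1, -⟩ := exists_norm_ref_le hk
  obtain ⟨M, L, hM, hL, fM, fL⟩ := exists_bounds_of_hasCompactSupport hK.contDiff_density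
    hK.hasCompactSupport_density
  set C₁ := (1 / m ^ 2 + B / m ^ 3) * (2 * Real.pi) with hC₁
  set C₂ := (2 * L * ((1 + 2 * W) * B + (1 + 2 * W)) + 2 * M) * (1 + 2 * W) ^ 2 * (2 * Real.pi)
    with hC₂
  refine ⟨sk k ^ 2 * C₁ + sk k * C₂, by positivity, ?_⟩
  intro ε hε q v q' v' hqv hqv' hq hq' hqB hvB δ hδ1 hδ hδ'
  have hδ0 : 0 ≤ δ := (norm_nonneg _).trans (hδ 1)
  have E1 := abs_kinetic_sub_le hqv hqv' hm hB hq hq' hvB hδ hδ'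
  -- `loopCurve` is real linear in `q`, so the variation field is the loop of the difference `q' -
  -- q`.
  have E2 := abs_encArea_sub_le hK.contDiff_density fM fL (hasDerivAt_loopCurve hk hqv)
    (continuous_loopVel hk q v) (hasDerivAt_loopCurve hk (hqv'.sub hqv))
    (continuous_loopVel hk (q' - q) (v' - v)) (loopCurve_two_pi k q) (loopCurve_two_pi k _)
    (B := (1 + 2 * W) * B) (δ := (1 + 2 * W) * δ)
    (fun t => norm_loopVel_le (w0 t) (w1 t) (hqB _) (hvB _))
    (fun t => (norm_loopCurve_le (w0 t) (hδ _)).trans (by gcongr; linarith))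
    (fun t => norm_loopVel_le (w0 t) (w1 t) (hδ _) (hδ' _)) hL hM (by positivity)
  simp only [loopCurve_add_sub, loopVel_add_sub] at E2
  have hpos : ∀ x, 0 < (q x).im := fun x => hm.trans_le (hq x)
  set I₁ := cint (fun x => det2 (q' x - q x) (v x) / (q x).im ^ 2) with hI₁
  set I₂ := ∫ t in (0 : ℝ)..(2 * Real.pi), K (loopCurve k q t) / (loopCurve k q t).im ^ 2 *
    det2 (loopCurve k (q' - q : C(Circle, ℂ)) t) (loopVel k q v t) with hI₂
  have e : cint (fun x => det2 (q' x - q x) (gradDensity k K ε q v x)) =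
      sk k ^ 2 * I₁ + ε * (sk k * I₂) := by
    have c1 : Continuous fun t => det2 (q' (Circle.exp t) - q (Circle.exp t)) (v (Circle.exp t)) /
        (q (Circle.exp t)).im ^ 2 := by
      refine Continuous.div ?_ ?_ fun t => pow_ne_zero 2 (hpos _).ne'
      · exact continuous_det2 ((q'.continuous.sub q.continuous).comp Circle.exp.continuous)
          (v.continuous.comp Circle.exp.continuous)
      · exact (Complex.continuous_im.comp (q.continuous.comp Circle.exp.continuous)).pow 2
    have c2 : Continuous fun t => K (loopCurve k q t) / (loopCurve k q t).im ^ 2 *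
        det2 (loopCurve k (q' - q : C(Circle, ℂ)) t) (loopVel k q v t) :=
      (hK.contDiff_density.continuous.comp (continuous_loopCurve hk q)).mul
        (continuous_det2 (continuous_loopCurve hk (q' - q)) (continuous_loopVel hk q v))
    rw [hI₁, hI₂, cint, cint, ← intervalIntegral.integral_const_mul,
      ← intervalIntegral.integral_const_mul,
      ← intervalIntegral.integral_const_mul,
      ← intervalIntegral.integral_add ((c1.const_mul _).intervalIntegrable _ _)
        (((c2.const_mul _).const_mul _).intervalIntegrable _ _)]
    refine intervalIntegral.integral_congr fun t _ => ?_
    rw [density_mul_det2 hk K q v _ t (hpos _)]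
    simp only [gradDensity, wgt, coe_circleExp, det2, Complex.add_re, Complex.add_im,
      Complex.re_ofReal_mul, Complex.im_ofReal_mul, ContinuousMap.sub_apply,
      Complex.I_mul_re, Complex.I_mul_im]
    ring
  have e2 : action k K ε q' v' - action k K ε q v -
      cint (fun x => det2 (q' x - q x) (gradDensity k K ε q v x)) =
      sk k ^ 2 * (cint (fun x => (v' x).re / (q' x).im) - cint (fun x => (v x).re / (q x).im) - I₁)
      + ε * (sk k * (encArea (fun w => K w / w.im ^ 2) (loopCurve k q') (loopVel k q' v') -
        encArea (fun w => K w / w.im ^ 2) (loopCurve k q) (loopVel k q v) - I₂)) := by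
    rw [e, action, action]; ring
  have F2 : |encArea (fun w => K w / w.im ^ 2) (loopCurve k q') (loopVel k q' v') -
        encArea (fun w => K w / w.im ^ 2) (loopCurve k q) (loopVel k q v) - I₂| ≤ C₂ * δ ^ 2 := by
    refine E2.trans ?_
    calc _ ≤ (2 * L * ((1 + 2 * W) * B + (1 + 2 * W) * 1) + 2 * M) * ((1 + 2 * W) * δ) ^ 2 *
          (2 * Real.pi) := by gcongr
      _ = _ := by rw [hC₂]; ring
  rw [e2]
  refine (abs_add_le _ _).trans ?_
  rw [abs_mul, abs_mul, abs_mul, abs_of_pos hs, abs_of_pos (pow_pos hs 2)]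
  calc _ ≤ sk k ^ 2 * ((1 / m ^ 2 + B / m ^ 3) * δ ^ 2 * (2 * Real.pi)) +
        1 * (sk k * (C₂ * δ ^ 2)) := by gcongr
    _ = _ := by rw [hC₁]; ring

/-! ### The reduced function -/

/-- The linear form `δ ↦ det (δ, c)`. -/
def detL (c : ℂ) : ℂ →L[ℝ] ℝ := c.im • Complex.reCLM - c.re • Complex.imCLM

lemma detL_apply (c δ : ℂ) : detL c δ = det2 δ c := by
  simp [detL, det2]; ring

lemma detL_sub (c c' : ℂ) : detL c - detL c' = detL (c - c') := by
  ext δ; simp [detL_apply, det2]; ring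

lemma smul_detL (a : ℝ) (c : ℂ) : a • detL c = detL (a * c) := by
  ext δ; simp [detL_apply, det2]; ring

lemma norm_detL_le (c : ℂ) : ‖detL c‖ ≤ 2 * ‖c‖ :=
  ContinuousLinearMap.opNorm_le_bound _ (by positivity) fun δ => by
    rw [detL_apply, Real.norm_eq_abs]
    exact (abs_det2_le δ c).trans (le_of_eq (by ring))

lemma continuous_detL : Continuous detL := by unfold detL; fun_prop

lemma eq_zero_of_detL_eq_zero {c : ℂ} (h : detL c = 0) : c = 0 := by
  have h1 : detL c 1 = 0 := by rw [h]; rfl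
  have h2 : detL c Complex.I = 0 := by rw [h]; rfl
  simp only [detL_apply, det2] at h1 h2
  apply Complex.ext
  · simpa using h2
  · simpa using h1

lemma cint_det2 {g : Circle → ℂ} (hg : Continuous g) (c : ℂ) :
    cint (fun x => det2 (g x) c) = det2 (cint g) c := by
  have := (detL c).intervalIntegral_comp_comm (μ := volume) (a := 0) (b := 2 * Real.pi)
    ((hg.comp Circle.exp.continuous).intervalIntegrable 0 (2 * Real.pi))
  simp only [Function.comp_apply, detL_apply] at this
  exact this

lemma det2_cint {g : Circle → ℂ} (hg : Continuous g) (c : ℂ) :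
    cint (fun x => det2 c (g x)) = det2 c (cint g) := by
  have h1 : ∀ a b, det2 a b = -det2 b a := fun a b => by unfold det2; ring
  rw [h1 c, ← cint_det2 hg c, cint, cint, ← intervalIntegral.integral_neg]
  exact intervalIntegral.integral_congr fun t _ => h1 _ _

/-- Turns the second order expansions of the action into differentiability in the centre `z`. -/
lemma hasFDerivAt_of_quadratic {G : ℂ → ℝ} {T : ℂ →L[ℝ] ℝ} {z : ℂ} {C : ℝ}
    (h : ∀ᶠ z' in 𝓝 z, |G z' - G z - T (z' - z)| ≤ C * ‖z' - z‖ ^ 2) : HasFDerivAt G T z := by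
  have h1 : (fun z' => G z' - G z - T (z' - z)) =O[𝓝 z] fun z' => ‖z' - z‖ ^ 2 := by
    refine Asymptotics.IsBigO.of_bound C ?_
    filter_upwards [h] with z' hz'
    rwa [Real.norm_eq_abs, Real.norm_of_nonneg (by positivity)]
  have h2 : HasFDerivAt (fun z' => G z' - G z - T (z' - z)) (0 : ℂ →L[ℝ] ℝ) z :=
    h1.hasFDerivAt (by norm_num)
  have h3 : HasFDerivAt (fun z' => T (z' - z)) T z :=
    T.hasFDerivAt.comp z ((hasFDerivAt_id z).sub_const z)
  have h4 := (h2.add h3).add_const (G z)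
  rw [zero_add] at h4
  refine h4.congr_of_eventuallyEq (Eventually.of_forall fun z' => ?_)
  simp

/-! ### The differentials of the Melnikov function and of the reduced action -/

/-- The boundary integral which represents the differential of the Melnikov function. -/
def bdry (k : ℝ) (K : ℂ → ℝ) (z : ℂ) : ℂ :=
  cint fun x : Circle => ((kap k K x z / z.im : ℝ) : ℂ) * (Complex.I * x)

lemma continuous_bdry_integrand {k : ℝ} (hk : 1 < k) {K : ℂ → ℝ} (hK : Continuous K) (z : ℂ) :
    Continuous fun x : Circle => ((kap k K x z / z.im : ℝ) : ℂ) * (Complex.I * x) := by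
  have h1 : Continuous fun x : Circle => kap k K x z :=
    (continuous_kap hk hK).comp (Continuous.prodMk_left z)
  exact (Complex.continuous_ofReal.comp (h1.div_const _)).mul
    (continuous_const.mul continuous_subtype_val)

/-- With zero velocity the kinetic term disappears and the Green formula applies. The value `1` of
the parameter is a device: it lets the expansion of the action also differentiate the Melnikov
function. -/
lemma action_const {k : ℝ} (hk : 1 < k) {K : ℂ → ℝ} (hK : IsTruncated K) {z : ℂ}
    (hz : 0 < z.im) :
    action k K 1 (ContinuousMap.const Circle z) (0 : C(Circle, ℂ)) = sk k * melnikov k K z := by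
  rw [melnikov_eq_encArea hk hK.contDiff_density hz, action]
  have h1 : cint (fun x => ((0 : C(Circle, ℂ)) x).re /
      ((ContinuousMap.const Circle z) x).im) = 0 := by
    simp [cint]
  rw [h1, mul_zero, zero_add, one_mul]
  congr 2
  funext t
  simp [loopVel, loopCurve]

/-- The expansion of the action between the constant maps `z` and `z'`. The variation is constant
and leaves the integral, and the density reduces to its forcing term because the velocity is zero.
-/
lemma hasFDerivAt_melnikov {k : ℝ} (hk : 1 < k) {K : ℂ → ℝ} (hK : IsTruncated K) {z : ℂ}
    (hz : 0 < z.im) :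
    HasFDerivAt (melnikov k K) (detL (((sk k)⁻¹ : ℝ) * bdry k K z)) z := by
  have hs := sk_pos hk
  obtain ⟨C, hC, hmain⟩ := exists_abs_action_sub_le hk hK (m := z.im / 2) (B := ‖z‖)
    (by positivity) (norm_nonneg _)
  have hev : ∀ᶠ z' in 𝓝 z, z.im / 2 < z'.im :=
    Complex.continuous_im.continuousAt.eventually (lt_mem_nhds (by linarith))
  have hev1 : ∀ᶠ z' in 𝓝 z, ‖z' - z‖ < 1 := by
    have : Metric.ball z 1 ∈ 𝓝 z := Metric.ball_mem_nhds z one_pos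
    filter_upwards [this] with z' hz'
    rwa [Metric.mem_ball, dist_eq_norm] at hz'
  refine hasFDerivAt_of_quadratic (C := (sk k)⁻¹ * C) ?_
  filter_upwards [hev, hev1] with z' h1 h2
  have hz' : 0 < z'.im := by linarith
  have := hmain 1 (by simp) _ _ _ _ (hasVel_const z) (hasVel_const z')
    (fun _ => by simp; linarith) (fun _ => by simpa using h1.le) (fun _ => by simp)
    (fun _ => by simp)
    ‖z' - z‖ h2.le (fun _ => by simp) (fun _ => by simp)
  rw [action_const hk hK hz', action_const hk hK hz] at this
  have e : cint (fun x => det2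
      ((ContinuousMap.const Circle z') x - (ContinuousMap.const Circle z) x)
      (gradDensity k K 1 (ContinuousMap.const Circle z) (0 : C(Circle, ℂ)) x)) =
      det2 (z' - z) (bdry k K z) := by
    rw [bdry, ← det2_cint (continuous_bdry_integrand hk hK.contDiff.continuous z)]
    simp [gradDensity]
  rw [e] at this
  have e2 : melnikov k K z' - melnikov k K z - detL (((sk k)⁻¹ : ℝ) * bdry k K z) (z' - z) =
      (sk k)⁻¹ * (sk k * melnikov k K z' - sk k * melnikov k K z -
        det2 (z' - z) (bdry k K z)) := by
    rw [← smul_detL, smul_apply, detL_apply, smul_eq_mul]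
    field_simp
  rw [e2, abs_mul, abs_of_pos (inv_pos.2 hs), mul_assoc]
  gcongr

lemma continuousOn_bdry {k : ℝ} (hk : 1 < k) {K : ℂ → ℝ} (hK : Continuous K) :
    ContinuousOn (bdry k K) halfPlane := by
  intro z hz
  have hz0 : 0 < z.im := hz
  set m := z.im / 2
  have h1 : Continuous fun p : ℂ × ℝ => kap k K (Circle.exp p.2) p.1 :=
    (continuous_kap hk hK).comp ((Circle.exp.continuous.comp continuous_snd).prodMk continuous_fst)
  -- Replacing the height by its maximum with `m` makes the integrand continuous everywhere without
  -- changing it near `z`.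
  have h2 : Continuous fun p : ℂ × ℝ => max m p.1.im := by fun_prop
  have hm : ∀ y, max m y ≠ 0 := fun y => (lt_of_lt_of_le (by positivity) (le_max_left m y)).ne'
  have h3 : Continuous fun p : ℂ × ℝ =>
      ((kap k K (Circle.exp p.2) p.1 / max m p.1.im : ℝ) : ℂ) * (Complex.I * Circle.exp p.2) :=
    (Complex.continuous_ofReal.comp (h1.div h2 fun p => hm _)).mul
      (continuous_const.mul (continuous_subtype_val.comp
        (Circle.exp.continuous.comp continuous_snd)))
  have h4 := intervalIntegral.continuous_parametric_intervalIntegral_of_continuous' (μ := volume)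
    (f := fun (w : ℂ) (t : ℝ) => ((kap k K (Circle.exp t) w / max m w.im : ℝ) : ℂ) *
      (Complex.I * Circle.exp t)) h3 0 (2 * Real.pi)
  have hev : ∀ᶠ w in 𝓝 z, m < w.im :=
    Complex.continuous_im.continuousAt.eventually (lt_mem_nhds (by simp only [m]; linarith))
  refine (h4.continuousAt.congr ?_).continuousWithinAt
  filter_upwards [hev] with w hw
  rw [bdry, cint, max_eq_right hw.le]

lemma contDiffOn_one_of_hasFDerivAt {U : Set ℂ} (hU : IsOpen U) {G : ℂ → ℝ} {T : ℂ → ℂ →L[ℝ] ℝ}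
    (h : ∀ z ∈ U, HasFDerivAt G (T z) z) (hT : ContinuousOn T U) : ContDiffOn ℝ 1 G U := by
  rw [show (1 : WithTop ℕ∞) = 0 + 1 from (zero_add _).symm,
    contDiffOn_succ_iff_fderiv_of_isOpen hU]
  refine ⟨fun z hz => (h z hz).differentiableAt.differentiableWithinAt, by simp, ?_⟩
  rw [contDiffOn_zero]
  exact hT.congr fun z hz => (h z hz).fderiv

/-- Multiplying the reduced equation by `w / q₂²` isolates the multiplier, because the clamp is
inactive at this height. -/
lemma gradDensity_eq_multiplier {k : ℝ} {K : ℂ → ℝ} {m M ε : ℝ} (hm : 0 < m)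
    {q v : Circle → ℂ} {c : ℂ} {x : Circle} (hw : 0 < wgt k K ε x (q x))
    (hv : v x = coef₁ k K m M ε x (q x) * c - ε * (coef₂ k K m M ε x (q x) * (Complex.I * x)))
    (h1 : m ≤ (q x).im) (h2 : (q x).im ≤ M) : gradDensity k K ε q v x = c := by
  have hq : ((q x).im : ℂ) ≠ 0 := by exact_mod_cast (hm.trans_le h1).ne'
  have hw' : (wgt k K ε x (q x) : ℂ) ≠ 0 := by exact_mod_cast hw.ne'
  rw [gradDensity, hv, coef₁, coef₂, clamp_of_mem h1 h2]
  push_cast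
  field_simp
  ring

/-- The multiplier is, at first order, the differential of the Melnikov function. -/
lemma norm_multiplier_sub_bdry_le {k : ℝ} (hk : 1 < k) {K : ℂ → ℝ} (hK : IsTruncated K)
    {m M m₁ B L ε C : ℝ} (hm : 0 < m) (hB : 0 ≤ B) (hL : 0 ≤ L) (hC : 0 ≤ C)
    (hb : AllBounds k K m M m₁ B L ε) {q v : C(Circle, ℂ)} {c z : ℂ}
    (hg : ∀ x, gradDensity k K ε q v x = c) (h1 : ∀ x, m ≤ (q x).im) (h2 : ∀ x, (q x).im ≤ M)
    (hz1 : m ≤ z.im) (hz2 : z.im ≤ M) (hv0 : cint v = 0) (hq : ∀ x, ‖q x - z‖ ≤ C * |ε|)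
    (hv : ∀ x, ‖v x‖ ≤ C * |ε|) :
    ‖2 * Real.pi * c - ε * bdry k K z‖ ≤
      ((L * C + B / m ^ 2) * C + L * C) * (2 * Real.pi) * |ε| ^ 2 := by
  have hz : 0 < z.im := hm.trans_le hz1
  have c1 := continuous_bdry_integrand hk hK.contDiff.continuous z
  have c2 : Continuous fun x => (gradDensity k K ε q v x) := by
    simp only [hg]; exact continuous_const
  set a : ℂ := ((sk k ^ 2 / z.im ^ 2 : ℝ) : ℂ) with ha
  -- The term `a v` integrates to zero. Subtracting it replaces the factor `w / q₂²` of `v` by its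
  -- `O(ε)` deviation from the constant `a`, and as `v` is itself `O(ε)` the error becomes
  -- quadratic.
  have e : 2 * Real.pi * c - ε * bdry k K z = cint fun x => (gradDensity k K ε q v x -
      ε * (((kap k K x z / z.im : ℝ) : ℂ) * (Complex.I * x))) - a * v x := by
    have c3 : Continuous fun x : Circle =>
        (ε : ℂ) * (((kap k K x z / z.im : ℝ) : ℂ) * (Complex.I * x)) := continuous_const.mul c1
    have c4 : Continuous fun x : Circle => gradDensity k K ε q v x -
      ε * (((kap k K x z / z.im : ℝ) : ℂ) * (Complex.I * x)) := c2.sub c3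
    have c5 : Continuous fun x : Circle => a * v x := continuous_const.mul v.continuous
    rw [cint_sub c4 c5, cint_sub c2 c3, cint_const_mul, cint_const_mul, hv0, mul_zero,
      sub_zero, bdry]
    simp only [hg]
    simp [cint]
  rw [e]
  calc _ ≤ (((L * C + B / m ^ 2) * C + L * C) * |ε| ^ 2) * (2 * Real.pi) := ?_
    _ = _ := by ring
  refine norm_cint_le fun x => ?_
  have p : 0 < (q x).im := hm.trans_le (h1 x)
  have d1 : wgt k K ε x (q x) / (q x).im ^ 2 = dual₁ k K m M ε x (q x) := by
    rw [dual₁, clamp_of_mem (h1 x) (h2 x)]; field_simp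
  have d2 : kap k K x (q x) / (q x).im = dual₂ k K m M x (q x) := by
    rw [dual₂, clamp_of_mem (h1 x) (h2 x)]; field_simp
  have d3 : kap k K x z / z.im = dual₂ k K m M x z := by
    rw [dual₂, clamp_of_mem hz1 hz2]; field_simp
  have d4 : sk k ^ 2 / z.im ^ 2 = dual₁ k K m M ε x z -
      ε * (kap k K x z * (k - (x : ℂ).im)) / z.im ^ 2 := by
    rw [dual₁, clamp_of_mem hz1 hz2, wgt]; field_simp; ring
  have e2 : (gradDensity k K ε q v x - ε * (((kap k K x z / z.im : ℝ) : ℂ) * (Complex.I * x))) -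
      a * v x = ((dual₁ k K m M ε x (q x) - dual₁ k K m M ε x z +
        ε * (kap k K x z * (k - (x : ℂ).im)) / z.im ^ 2 : ℝ) : ℂ) * v x +
      ((ε * (dual₂ k K m M x (q x) - dual₂ k K m M x z) : ℝ) : ℂ) * (Complex.I * x) := by
    rw [gradDensity, d1, d2, d3, ha, d4]
    push_cast
    ring
  rw [e2]
  refine (norm_add_le _ _).trans ?_
  rw [norm_mul, norm_I_mul_circle, Complex.norm_real, Complex.norm_real, Real.norm_eq_abs,
    Real.norm_eq_abs, abs_mul]
  have f1 : |dual₁ k K m M ε x (q x) - dual₁ k K m M ε x z| ≤ L * (C * |ε|) :=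
    (hb.dual_lip₁ _ _ _).trans (by gcongr; exact hq x)
  have f2 : |dual₂ k K m M x (q x) - dual₂ k K m M x z| ≤ L * (C * |ε|) :=
    (hb.dual_lip₂ _ _ _).trans (by gcongr; exact hq x)
  have f3 : |ε * (kap k K x z * (k - (x : ℂ).im)) / z.im ^ 2| ≤ |ε| * B / m ^ 2 := by
    rw [abs_div, abs_mul, abs_of_pos (pow_pos hz 2)]
    gcongr
    exact hb.kap_bound x z
  calc _ ≤ (L * (C * |ε|) + |ε| * B / m ^ 2) * (C * |ε|) + |ε| * (L * (C * |ε|)) := by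
        gcongr
        · exact (abs_add_le _ _).trans (add_le_add f1 f3)
        · exact hv x
    _ = _ := by ring

/-! ### Stability and the vanishing of the multiplier -/

/-- `q` solves the equation saying that the loop `x ↦ ω_{q(x)}(x)` has curvature `k + ε K`. -/
structure IsSolution (k : ℝ) (K : ℂ → ℝ) (ε : ℝ) (q v : C(Circle, ℂ)) : Prop where
  vel : HasVel q v
  im_pos : ∀ x, 0 < (q x).im
  wgt_lower : ∀ x, sk k ^ 2 / 2 ≤ wgt k K ε x (q x)
  eq : ∀ x, v x = -((ε * (kap k K x (q x) * (q x).im / wgt k K ε x (q x)) : ℝ) : ℂ) *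
    (Complex.I * x)

lemma exists_rectangle {A : Set ℂ} (hA : CompactlyInside A) : ∃ m R : ℝ, 0 < m ∧ 0 < R ∧
    ∀ z ∈ closure A, m < z.im ∧ ‖z‖ < R := by
  obtain ⟨-, hc, hsub⟩ := hA
  obtain ⟨C, hC⟩ := hc.exists_bound_of_continuousOn (f := fun z : ℂ => z.im⁻¹)
    (Complex.continuous_im.continuousOn.inv₀ fun z hz => (show 0 < z.im from hsub hz).ne')
  obtain ⟨R, hR⟩ := hc.exists_bound_of_continuousOn (f := fun z : ℂ => z) continuousOn_id
  refine ⟨(|C| + 1)⁻¹, |R| + 1, by positivity, by positivity, fun z hz => ⟨?_, ?_⟩⟩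
  · have hz0 : 0 < z.im := hsub hz
    have h1 := hC z hz
    rw [Real.norm_of_nonneg (inv_pos.2 hz0).le] at h1
    rw [inv_lt_comm₀ (by positivity) hz0]
    linarith [le_abs_self C]
  · linarith [hR z hz, le_abs_self R]

lemma HasStableCriticalPt.nonempty {X : ℂ → ℝ} {A : Set ℂ} (h : HasStableCriticalPt X A) :
    A.Nonempty := by
  by_contra hne
  rw [Set.not_nonempty_iff_eq_empty] at hne
  subst hne
  obtain ⟨r, hr, h⟩ := h
  -- Over the empty set both suprema are `sSup ∅ = 0`, so any function would qualify and would need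
  -- a critical point in `∅`.
  obtain ⟨z, hz, -⟩ := h (fun _ => 0) ⟨Set.univ, isOpen_univ, Set.subset_univ _, contDiffOn_const⟩
    (by simpa [c1Norm] using hr)
  exact hz

lemma c1Norm_le {A : Set ℂ} {f : ℂ → ℝ} {a b : ℝ} (ha : 0 ≤ a) (hb : 0 ≤ b)
    (h : ∀ z ∈ closure A, |f z| ≤ a) (hderiv : ∀ z ∈ closure A, ‖fderiv ℝ f z‖ ≤ b) :
    c1Norm A f ≤ a + b := by
  refine add_le_add (Real.sSup_le ?_ ha) (Real.sSup_le ?_ hb)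
  · rintro _ ⟨z, hz, rfl⟩; exact h z hz
  · rintro _ ⟨z, hz, rfl⟩; exact hderiv z hz

/-- Differentiability of the action along the family of solutions of the reduced equation. -/
lemma hasFDerivAt_reduced_action {k : ℝ} (hk : 1 < k) {K : ℂ → ℝ} (hK : IsTruncated K)
    {m R ε C : ℝ} (hm : 0 < m) (hR : 0 ≤ R) (hC : 0 ≤ C) (hε : |ε| ≤ 1) {U : Set ℂ}
    (hU : IsOpen U) {q v : ℂ → C(Circle, ℂ)} {c : ℂ → ℂ}
    (hd : ∀ z, HasVel (q z) (v z)) (hmean : ∀ z, cint (q z) = 2 * Real.pi * z)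
    (hql : ∀ z z' x, ‖q z x - q z' x‖ ≤ 2 * ‖z - z'‖)
    (hvl : ∀ z z' x, ‖v z x - v z' x‖ ≤ C * ‖z - z'‖)
    (him : ∀ z ∈ U, ∀ x, m ≤ (q z x).im) (hqR : ∀ z ∈ U, ∀ x, ‖q z x‖ ≤ R)
    (hvR : ∀ z ∈ U, ∀ x, ‖v z x‖ ≤ R)
    (hg : ∀ z ∈ U, ∀ x, gradDensity k K ε (q z) (v z) x = c z) {z : ℂ} (hz : z ∈ U) :
    HasFDerivAt (fun z => action k K ε (q z) (v z)) (detL (2 * Real.pi * c z)) z := by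
  obtain ⟨C', hC', hmain⟩ := exists_abs_action_sub_le hk hK hm hR
  refine hasFDerivAt_of_quadratic (C := C' * (2 + C) ^ 2) ?_
  have hev1 : ∀ᶠ z' in 𝓝 z, ‖z' - z‖ < (2 + C)⁻¹ := by
    have : Metric.ball z (2 + C)⁻¹ ∈ 𝓝 z := Metric.ball_mem_nhds z (by positivity)
    filter_upwards [this] with z' hz'
    rwa [Metric.mem_ball, dist_eq_norm] at hz'
  filter_upwards [hU.mem_nhds hz, hev1] with z' hz' hz1
  have hδ : (2 + C) * ‖z' - z‖ ≤ 1 := by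
    calc (2 + C) * ‖z' - z‖ ≤ (2 + C) * (2 + C)⁻¹ := by gcongr
      _ = 1 := mul_inv_cancel₀ (by positivity)
  have hn := norm_nonneg (z' - z)
  have := hmain ε hε _ _ _ _ (hd z) (hd z') (him z hz) (him z' hz') (hqR z hz) (hvR z hz)
    ((2 + C) * ‖z' - z‖) hδ (fun x => (hql z' z x).trans (by nlinarith))
    (fun x => (hvl z' z x).trans (by nlinarith))
  -- The density is the constant `c z`, so only the mean of `q z' - q z` enters, and this is exactly
  -- `z' - z`. Differentiability of `z ↦ q z` is never needed.
  simp only [hg z hz] at this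
  have hcs : Continuous fun x => q z' x - q z x := (q z').continuous.sub (q z).continuous
  rw [cint_det2 hcs, cint_sub (q z').continuous (q z).continuous, hmean, hmean] at this
  rw [detL_apply]
  have e : det2 (z' - z) (2 * Real.pi * c z) =
      det2 (2 * Real.pi * z' - 2 * Real.pi * z) (c z) := by
    simp [det2]; ring
  rw [e]
  refine this.trans (le_of_eq ?_)
  ring

/-- Existence of solutions close to circles centred at almost critical points of the Melnikov
function. -/
theorem exists_solution {k : ℝ} (hk : 1 < k) {K : ℂ → ℝ} (hK : IsTruncated K) {A : Set ℂ}
    (hA : CompactlyInside A) (hF : HasStableCriticalPt (melnikov k K) A) :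
    ∃ ε₀ : ℝ, 0 < ε₀ ∧ ∃ C : ℝ, 0 ≤ C ∧ ∀ ε : ℝ, |ε| < ε₀ → ∃ z ∈ A, ∃ q v : C(Circle, ℂ),
      IsSolution k K ε q v ∧ (∀ x, ‖q x - z‖ ≤ C * |ε|) ∧ ‖bdry k K z‖ ≤ C * |ε| := by
  have hs := sk_pos hk
  have hpi := Real.pi_pos
  obtain ⟨zs, hzs⟩ := hF.nonempty
  obtain ⟨r, hr, hstab⟩ := hF
  obtain ⟨m₀, R, hm₀, hR, hrect⟩ := exists_rectangle hA
  -- A convex neighbourhood of the closure of `A`, on which the mean value inequality turns the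
  -- gradient bound into a bound on values.
  set U : Set ℂ := {z | m₀ < z.im} ∩ Metric.ball 0 R with hUdef
  have hUo : IsOpen U := (isOpen_lt continuous_const Complex.continuous_im).inter Metric.isOpen_ball
  have hUc : Convex ℝ U := (convex_halfSpace_im_gt m₀).inter (convex_ball 0 R)
  have hAU : closure A ⊆ U := fun z hz => ⟨(hrect z hz).1, by simpa using (hrect z hz).2⟩
  have hUpos : ∀ z ∈ U, 0 < z.im := fun z hz => hm₀.trans hz.1
  have hUn : ∀ z ∈ U, ‖z‖ < R := fun z hz => by simpa using hz.2
  have hdF : ∀ z ∈ U, HasFDerivAt (melnikov k K) (detL (((sk k)⁻¹ : ℝ) * bdry k K z)) z :=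
    fun z hz => hasFDerivAt_melnikov hk hK (hUpos z hz)
  have hbc : ContinuousOn (bdry k K) U :=
    (continuousOn_bdry hk hK.contDiff.continuous).mono hUpos
  have hzsU : zs ∈ U := hAU (subset_closure hzs)
  set m := m₀ / 2 with hm
  set M := R + 1 with hM
  have hmpos : 0 < m := by positivity
  have hmM : m ≤ M := by
    have h1 := Complex.abs_im_le_norm zs
    have h2 := hUn zs hzsU
    have h3 : m₀ < zs.im := hzsU.1
    have h4 := le_abs_self zs.im
    rw [hm, hM]; linarith
  obtain ⟨ε₁, m₁, B, L, hε₁, hm₁, hB, hL, hall⟩ := exists_allBounds hk hK hmpos hmM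
  obtain ⟨ε₂, hε₂, C, hC, hred⟩ := exists_reduced_solution hm₁ hB hL
  set C' := ((L * C + B / m ^ 2) * C + L * C) * (2 * Real.pi) with hC'
  have hC'0 : 0 ≤ C' := by positivity
  set η := (sk k)⁻¹ * (2 * C') with hη
  have hη0 : 0 ≤ η := by positivity
  -- The bounds `m / (C + 1)` and `1 / (C + 1)` keep `q` where the clamp is inactive; the last one
  -- makes the `C¹` distance to the Melnikov function less than `r`.
  set ε₀ := min (min ε₁ ε₂) (min (min 1 (m / (C + 1))) (min (1 / (C + 1))
    (r / (η * (2 * R) + η + 1)))) with hε₀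
  have hε₀0 : 0 < ε₀ := by
    simp only [hε₀, lt_min_iff]
    refine ⟨⟨hε₁, hε₂⟩, ⟨one_pos, by positivity⟩, by positivity, by positivity⟩
  refine ⟨ε₀, hε₀0, C + C', by positivity, fun ε hε => ?_⟩
  simp only [hε₀, lt_min_iff] at hε
  obtain ⟨⟨b1, b2⟩, ⟨b3, b4⟩, b5, b6⟩ := hε
  have hb := hall ε b1
  have hwpos : ∀ x q, 0 < wgt k K ε x q := fun x q =>
    lt_of_lt_of_le (by positivity) (hb.wgt_lower x q)
  -- The rescaling by `1 / ε` is unavailable here. The Melnikov function itself then serves as `G`,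
  -- and a constant map is a solution.
  by_cases hε0 : ε = 0
  · obtain ⟨z, hz, hcrit⟩ := hstab (melnikov k K) ⟨U, hUo, hAU,
      contDiffOn_one_of_hasFDerivAt hUo hdF
      (continuous_detL.comp_continuousOn (continuousOn_const.mul hbc))⟩ (by
        have := c1Norm_le (A := A) (f := fun z => melnikov k K z - melnikov k K z) (a := 0) (b := 0)
          le_rfl le_rfl (fun z _ => by simp) (fun z _ => by simp)
        linarith)
    have hzU := hAU (subset_closure hz)
    have h0 := eq_zero_of_detL_eq_zero ((hdF z hzU).unique hcrit)
    have hb0 : bdry k K z = 0 := by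
      rcases mul_eq_zero.1 h0 with h | h
      · exact absurd h (by exact_mod_cast (inv_pos.2 hs).ne')
      · exact h
    refine ⟨z, hz, ContinuousMap.const _ z, 0, ⟨hasVel_const z, fun x => hUpos z hzU,
      fun x => hb.wgt_lower _ _, fun x => ?_⟩, fun x => ?_, ?_⟩
    · simp [hε0]
    · simp [hε0]
    · rw [hb0, norm_zero]; positivity
  · obtain ⟨q, v, c, hd, hveq, hmean, hv0, hqz, hvb, hql, hvl, hcl⟩ := hred ε b2 _ _ hb.coeff
    have hCε1 : C * |ε| ≤ m := by
      calc C * |ε| ≤ (C + 1) * (m / (C + 1)) := by gcongr; linarith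
        _ = m := by field_simp
    have hCε2 : C * |ε| ≤ 1 := by
      calc C * |ε| ≤ (C + 1) * (1 / (C + 1)) := by gcongr; linarith
        _ = 1 := by field_simp
    have him1 : ∀ z ∈ U, ∀ x, m ≤ (q z x).im := fun z hz x => by
      have h1 := (Complex.abs_im_le_norm (q z x - z)).trans ((hqz z x).trans hCε1)
      have h2 := (abs_le.1 h1).1
      have h3 : m₀ < z.im := hz.1
      rw [Complex.sub_im] at h2
      have h4 : m₀ = 2 * m := by rw [hm]; ring
      linarith
    have hqR : ∀ z ∈ U, ∀ x, ‖q z x‖ ≤ R + 1 := fun z hz x => by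
      have h1 := (hqz z x).trans hCε2
      have h2 := hUn z hz
      have h3 := norm_add_le (q z x - z) z
      rw [sub_add_cancel] at h3
      linarith
    have him2 : ∀ z ∈ U, ∀ x, (q z x).im ≤ M := fun z hz x =>
      (le_abs_self _).trans ((Complex.abs_im_le_norm _).trans (hqR z hz x))
    have hgrad : ∀ z ∈ U, ∀ x, gradDensity k K ε (q z) (v z) x = c z := fun z hz x =>
      gradDensity_eq_multiplier hmpos (hwpos _ _) (hveq z x) (him1 z hz x) (him2 z hz x)
    have hAct := fun z (hz : z ∈ U) => hasFDerivAt_reduced_action hk hK hmpos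
      (R := R + 1) (by positivity) hC b3.le hUo hd hmean hql hvl him1 hqR
      (fun z hz x => ((hvb z x).trans hCε2).trans (by linarith)) hgrad hz
    have hest : ∀ z ∈ U, ‖2 * Real.pi * c z - ε * bdry k K z‖ ≤ C' * |ε| ^ 2 := fun z hz =>
      norm_multiplier_sub_bdry_le hk hK hmpos hB hL hC hb (hgrad z hz) (him1 z hz) (him2 z hz)
        (by have h3 : m₀ < z.im := hz.1
            rw [hm]; linarith)
        ((le_abs_self _).trans ((Complex.abs_im_le_norm _).trans ((hUn z hz).le.trans (by
          rw [hM]; linarith)))) (hv0 z) (hqz z) (hvb z)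
    have habs : 0 < |ε| := abs_pos.2 hε0
    set a : ℝ := (ε * sk k)⁻¹ with ha
    -- The additive constant makes `G` agree with the Melnikov function at `zs`, the base point for
    -- the mean value inequality.
    set G : ℂ → ℝ := fun z => a * action k K ε (q z) (v z) +
      (melnikov k K zs - a * action k K ε (q zs) (v zs)) with hG
    have hdG : ∀ z ∈ U, HasFDerivAt G (detL (a * (2 * Real.pi * c z))) z := fun z hz => by
      rw [← smul_detL]
      exact ((hAct z hz).const_mul a).add_const _
    have hcc : Continuous c := by
      refine continuous_iff_continuousAt.2 fun z => ?_
      refine (LipschitzWith.of_dist_le_mul (K := ⟨C, hC⟩) fun z z' => ?_).continuous.continuousAt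
      rw [dist_eq_norm, dist_eq_norm]; exact hcl z z'
    have hdiff : ∀ z ∈ U, HasFDerivAt (fun z => G z - melnikov k K z)
        (detL (((sk k)⁻¹ : ℝ) * ((ε : ℂ)⁻¹ * (2 * Real.pi * c z - ε * bdry k K z)))) z := by
      intro z hz
      refine ((hdG z hz).sub (hdF z hz)).congr_fderiv ?_
      rw [detL_sub]
      congr 1
      have : (ε : ℂ) ≠ 0 := by exact_mod_cast hε0
      rw [ha]
      push_cast
      field_simp
    have hnorm : ∀ z ∈ U, ‖detL (((sk k)⁻¹ : ℝ) *
        ((ε : ℂ)⁻¹ * (2 * Real.pi * c z - ε * bdry k K z)))‖ ≤ η * |ε| := fun z hz => by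
      refine (norm_detL_le _).trans ?_
      rw [norm_mul, norm_mul, norm_inv, Complex.norm_real, Complex.norm_real, Real.norm_eq_abs,
        Real.norm_eq_abs, abs_of_pos (inv_pos.2 hs)]
      calc _ ≤ 2 * ((sk k)⁻¹ * (|ε|⁻¹ * (C' * |ε| ^ 2))) := by
            gcongr
            exact hest z hz
        _ = _ := by rw [hη]; field_simp
    have hzero : G zs - melnikov k K zs = 0 := by simp only [hG]; ring
    have hval : ∀ z ∈ U, |G z - melnikov k K z| ≤ η * |ε| * (2 * R) := fun z hz => by
      have := hUc.norm_image_sub_le_of_norm_hasFDerivWithin_le (𝕜 := ℝ)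
        (fun w hw => (hdiff w hw).hasFDerivWithinAt) hnorm hzsU hz
      simp only [hzero, sub_zero] at this
      refine this.trans ?_
      gcongr
      have h1 := hUn z hz
      have h2 := hUn zs hzsU
      linarith [norm_sub_le z zs]
    have hc1 : c1Norm A (fun z => G z - melnikov k K z) < r := by
      refine (c1Norm_le (a := η * |ε| * (2 * R)) (b := η * |ε|) (by positivity) (by positivity)
        (fun z hz => hval z (hAU hz))
        (fun z hz => by
          rw [(hdiff z (hAU hz)).fderiv]
          exact hnorm z (hAU hz))).trans_lt ?_
      have h6 : |ε| * (η * (2 * R) + η + 1) < r := by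
        rwa [lt_div_iff₀ (by positivity)] at b6
      nlinarith
    obtain ⟨z, hz, hcrit⟩ := hstab G ⟨U, hUo, hAU, contDiffOn_one_of_hasFDerivAt hUo hdG
      (continuous_detL.comp_continuousOn (by fun_prop))⟩ hc1
    have hzU := hAU (subset_closure hz)
    have h0 := eq_zero_of_detL_eq_zero ((hdG z hzU).unique hcrit)
    have hc0 : c z = 0 := by
      have h1 : (a : ℂ) ≠ 0 := by
        have : a ≠ 0 := inv_ne_zero (mul_ne_zero hε0 hs.ne')
        exact_mod_cast this
      have h2 : (2 * Real.pi : ℂ) ≠ 0 := by exact_mod_cast Real.two_pi_pos.ne'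
      exact (mul_eq_zero.1 ((mul_eq_zero.1 h0).resolve_left h1)).resolve_left h2
    refine ⟨z, hz, q z, v z, ⟨hd z, fun x => hmpos.trans_le (him1 z hzU x),
      fun x => hb.wgt_lower _ _, fun x => ?_⟩, fun x => (hqz z x).trans ?_, ?_⟩
    · rw [hveq z x, hc0, coef₂, clamp_of_mem (him1 z hzU x) (him2 z hzU x), div_eq_mul_inv]
      push_cast
      ring
    · gcongr; linarith
    · have h1 := hest z hzU
      rw [hc0, mul_zero, zero_sub, norm_neg, norm_mul, Complex.norm_real, Real.norm_eq_abs] at h1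
      have h2 : ‖bdry k K z‖ ≤ C' * |ε| := by
        have : |ε| * ‖bdry k K z‖ ≤ |ε| * (C' * |ε|) := h1.trans (le_of_eq (by ring))
        exact le_of_mul_le_mul_left this habs
      refine h2.trans ?_
      gcongr; linarith

/-! ### From solutions to loops -/

/-- The speed of the loop relative to the reference loop. -/
def relSpeed (k : ℝ) (K : ℂ → ℝ) (ε : ℝ) (q : Circle → ℂ) (t : ℝ) : ℝ :=
  (q (Circle.exp t)).im * sk k ^ 2 / wgt k K ε (Circle.exp t) (q (Circle.exp t))

/-- The derivative of the weight along the loop. -/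
def wgtVel (k : ℝ) (K : ℂ → ℝ) (ε : ℝ) (q v : Circle → ℂ) (t : ℝ) : ℝ :=
  ε * (fderiv ℝ K (loopCurve k q t) (loopVel k q v t) * (k - Real.sin t) +
    K (loopCurve k q t) * (-Real.cos t))

/-- The derivative of the relative speed. -/
def relAcc (k : ℝ) (K : ℂ → ℝ) (ε : ℝ) (q v : Circle → ℂ) (t : ℝ) : ℝ :=
  ((v (Circle.exp t)).im * sk k ^ 2 * wgt k K ε (Circle.exp t) (q (Circle.exp t)) -
    (q (Circle.exp t)).im * sk k ^ 2 * wgtVel k K ε q v t) /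
    wgt k K ε (Circle.exp t) (q (Circle.exp t)) ^ 2

lemma wgt_circleExp (k : ℝ) (K : ℂ → ℝ) (ε : ℝ) (q : Circle → ℂ) (t : ℝ) :
    wgt k K ε (Circle.exp t) (q (Circle.exp t)) =
      sk k ^ 2 + ε * (K (loopCurve k q t) * (k - Real.sin t)) := by
  rw [wgt, kap, ← loopCurve_eq_omegaAt, coe_circleExp]

namespace IsSolution

variable {k : ℝ} {K : ℂ → ℝ} {ε : ℝ} {q v : C(Circle, ℂ)}

lemma wgt_pos (hk : 1 < k) (h : IsSolution k K ε q v) (x : Circle) : 0 < wgt k K ε x (q x) :=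
  lt_of_lt_of_le (by have := sk_pos hk; positivity) (h.wgt_lower x)

/-- The equation for `q` makes the normal component of the velocity vanish, so the loop is tangent
to the circle centred at `q(x)` at the same parameter. -/
lemma loopVel_eq (hk : 1 < k) (h : IsSolution k K ε q v) (t : ℝ) :
    loopVel k q v t = (relSpeed k K ε q t : ℂ) * refVel k t := by
  have hD := (den_pos hk t).ne'
  have hsc := Real.sin_sq_add_cos_sq t
  have hc2 : Real.cos t ^ 2 = 1 - Real.sin t ^ 2 := by linarith
  have hw := (h.wgt_pos hk (Circle.exp t)).ne'
  have hwe : wgt k K ε (Circle.exp t) (q (Circle.exp t)) = sk k ^ 2 + ε *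
      (kap k K (Circle.exp t) (q (Circle.exp t)) * (k - Real.sin t)) := by
    rw [wgt, coe_circleExp]
  have hv := h.eq (Circle.exp t)
  rw [coe_circleExp] at hv
  have hre := congrArg Complex.re hv
  have him := congrArg Complex.im hv
  rw [← Complex.ofReal_neg, Complex.re_ofReal_mul, Complex.I_mul_re] at hre
  rw [← Complex.ofReal_neg, Complex.im_ofReal_mul, Complex.I_mul_im] at him
  simp only at hre him
  rw [loopVel, loopCurve, relSpeed]
  generalize wgt k K ε (Circle.exp t) (q (Circle.exp t)) = w at *
  generalize kap k K (Circle.exp t) (q (Circle.exp t)) = κ at *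
  generalize q (Circle.exp t) = a at *
  generalize v (Circle.exp t) = b at *
  have hs2 : sk k ^ 2 = w - ε * (κ * (k - Real.sin t)) := by linarith
  apply Complex.ext
  · simp only [Complex.add_re, Complex.re_ofReal_mul, Complex.ofReal_re, refCurve, refVel, hre, him,
      hs2]
    field_simp
    ring_nf
    simp only [hc2]
    ring
  · simp only [Complex.add_im, Complex.im_ofReal_mul, Complex.ofReal_im, refCurve, refVel, him, hs2]
    field_simp
    ring

lemma hasDerivAt_relSpeed (hk : 1 < k) (hK : ContDiff ℝ 1 K) (h : IsSolution k K ε q v) (t : ℝ) :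
    HasDerivAt (relSpeed k K ε q) (relAcc k K ε q v t) t := by
  have h1 := hasDerivAt_im (h.vel t)
  have h2 : HasDerivAt (fun t => K (loopCurve k q t))
      (fderiv ℝ K (loopCurve k q t) (loopVel k q v t)) t :=
    (hK.differentiable (by norm_num) _).hasFDerivAt.comp_hasDerivAt t
      (hasDerivAt_loopCurve hk h.vel t)
  have h3 : HasDerivAt (fun t => wgt k K ε (Circle.exp t) (q (Circle.exp t)))
      (wgtVel k K ε q v t) t := by
    simp only [wgt_circleExp]
    exact ((h2.mul ((Real.hasDerivAt_sin t).const_sub k)).const_mul ε).const_add _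
  exact (h1.mul_const _).div h3 (h.wgt_pos hk _).ne'

lemma continuous_wgt_comp (hk : 1 < k) (hK : ContDiff ℝ 1 K) (q : C(Circle, ℂ)) :
    Continuous fun t => wgt k K ε (Circle.exp t) (q (Circle.exp t)) :=
  (continuous_wgt hk hK.continuous ε).comp
    (Circle.exp.continuous.prodMk (q.continuous.comp Circle.exp.continuous))

lemma continuous_relAcc (hk : 1 < k) (hK : ContDiff ℝ 1 K) (h : IsSolution k K ε q v) :
    Continuous (relAcc k K ε q v) := by
  have h1 := continuous_wgt_comp (ε := ε) hk hK q
  have h2 := continuous_loopCurve hk q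
  have h3 := continuous_loopVel hk q v
  have h4 : Continuous fun t => fderiv ℝ K (loopCurve k q t) (loopVel k q v t) :=
    ((hK.continuous_fderiv (by norm_num)).comp h2).clm_apply h3
  have h5 : Continuous fun t => K (loopCurve k q t) := hK.continuous.comp h2
  have h6 : Continuous fun t => (q (Circle.exp t)).im :=
    Complex.continuous_im.comp (q.continuous.comp Circle.exp.continuous)
  have h7 : Continuous fun t => (v (Circle.exp t)).im :=
    Complex.continuous_im.comp (v.continuous.comp Circle.exp.continuous)
  have h8 : Continuous (wgtVel k K ε q v) :=
    continuous_const.mul ((h4.mul (continuous_const.sub Real.continuous_sin)).add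
      (h5.mul Real.continuous_cos.neg))
  exact (((h7.mul continuous_const).mul h1).sub ((h6.mul continuous_const).mul h8)).div (h1.pow 2)
    fun t => pow_ne_zero 2 (h.wgt_pos hk _).ne'

lemma deriv_lift (hk : 1 < k) (h : IsSolution k K ε q v) :
    deriv (lift fun x => omegaAt k (q x) x) =
      fun t => (relSpeed k K ε q t : ℂ) * refVel k t := by
  have e : (lift fun x => omegaAt k (q x) x) = loopCurve k q := funext fun t => lift_omegaAt k q t
  rw [e]
  funext t
  rw [(hasDerivAt_loopCurve hk h.vel t).deriv, h.loopVel_eq hk]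

lemma hasDerivAt_deriv_lift (hk : 1 < k) (hK : ContDiff ℝ 1 K) (h : IsSolution k K ε q v)
    (t : ℝ) : HasDerivAt (fun t => (relSpeed k K ε q t : ℂ) * refVel k t)
      ((relAcc k K ε q v t : ℂ) * refVel k t + (relSpeed k K ε q t : ℂ) * refAcc k t) t :=
  (h.hasDerivAt_relSpeed hk hK t).ofReal_comp.mul (hasDerivAt_refVel hk t)

lemma deriv_deriv_lift (hk : 1 < k) (hK : ContDiff ℝ 1 K) (h : IsSolution k K ε q v) :
    deriv (deriv (lift fun x => omegaAt k (q x) x)) = fun t =>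
      (relAcc k K ε q v t : ℂ) * refVel k t + (relSpeed k K ε q t : ℂ) * refAcc k t := by
  rw [h.deriv_lift hk]
  funext t
  exact (h.hasDerivAt_deriv_lift hk hK t).deriv

lemma relSpeed_pos (hk : 1 < k) (h : IsSolution k K ε q v) (t : ℝ) : 0 < relSpeed k K ε q t :=
  div_pos (mul_pos (h.im_pos _) (pow_pos (sk_pos hk) 2)) (h.wgt_pos hk _)

lemma refVel_normSq (hk : 1 < k) (t : ℝ) :
    (refVel k t).re * (refVel k t).re + (refVel k t).im * (refVel k t).im =
      1 / (k - Real.sin t) ^ 2 := by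
  have hD := (den_pos hk t).ne'
  have hs2 := sk_sq hk
  have hc2 : Real.cos t ^ 2 = 1 - Real.sin t ^ 2 := by linarith [Real.sin_sq_add_cos_sq t]
  simp only [refVel]
  field_simp
  rw [hs2, hc2]
  ring

lemma refVel_det_refAcc (hk : 1 < k) (t : ℝ) :
    (refVel k t).re * (refAcc k t).im - (refVel k t).im * (refAcc k t).re =
      sk k / (k - Real.sin t) ^ 3 := by
  have hD := (den_pos hk t).ne'
  have hc2 : Real.cos t ^ 2 = 1 - Real.sin t ^ 2 := by linarith [Real.sin_sq_add_cos_sq t]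
  simp only [refVel, refAcc]
  field_simp
  ring_nf
  simp only [hc2]
  ring

/-- The factor `l'` drops out because it multiplies a tangential vector; the curvature depends on
the speed factor alone. -/
lemma inner_curvature (l l' y : ℝ) (V W : ℂ) :
    ((l' : ℂ) * V + l * W - (y : ℂ)⁻¹ * (-(Complex.I * ((l : ℂ) * V) ^ 2))).re *
        (Complex.I * ((l : ℂ) * V)).re +
      ((l' : ℂ) * V + l * W - (y : ℂ)⁻¹ * (-(Complex.I * ((l : ℂ) * V) ^ 2))).im *
        (Complex.I * ((l : ℂ) * V)).im =
    l ^ 2 * (V.re * W.im - V.im * W.re) +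
      y⁻¹ * l ^ 3 * (V.re * V.re + V.im * V.im) * V.re := by
  rw [← Complex.ofReal_inv]
  simp only [pow_two, Complex.add_re, Complex.add_im, Complex.sub_re,
    Complex.sub_im, Complex.mul_re, Complex.mul_im, Complex.neg_re, Complex.neg_im,
    Complex.ofReal_re, Complex.ofReal_im, Complex.I_re, Complex.I_im]
  ring

/-- The loop is `C²` because its velocity is a smooth reference velocity times a speed factor that
is `C¹` along with `K`; positivity of this factor gives regularity. -/
lemma isLoop (hk : 1 < k) (hK : ContDiff ℝ 1 K) (h : IsSolution k K ε q v) :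
    IsLoop fun x => omegaAt k (q x) x := by
  refine ⟨fun x => ?_, ?_, fun t => ?_⟩
  · obtain ⟨t, -, rfl⟩ := exists_angle x
    rw [← loopCurve_eq_omegaAt]
    have : (loopCurve k q t).im = (q (Circle.exp t)).im * (sk k / (k - Real.sin t)) := by
      simp [loopCurve, refCurve]
    change 0 < (loopCurve k q t).im
    rw [this]
    exact mul_pos (h.im_pos _) (div_pos (sk_pos hk) (den_pos hk t))
  · have e : (lift fun x => omegaAt k (q x) x) = loopCurve k q := funext fun t => lift_omegaAt k q t
    rw [show (2 : WithTop ℕ∞) = 1 + 1 by norm_num, contDiff_succ_iff_deriv]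
    refine ⟨?_, by simp, ?_⟩
    · rw [e]
      exact fun t => (hasDerivAt_loopCurve hk h.vel t).differentiableAt
    · rw [contDiff_one_iff_deriv, h.deriv_deriv_lift hk hK, h.deriv_lift hk]
      refine ⟨fun t => (h.hasDerivAt_deriv_lift hk hK t).differentiableAt, ?_⟩
      have h1 := h.continuous_relAcc hk hK
      have h2 : Continuous (relSpeed k K ε q) :=
        continuous_iff_continuousAt.2 fun t => (h.hasDerivAt_relSpeed hk hK t).continuousAt
      have h3 := continuous_refVel hk
      have h4 := continuous_refAcc hk
      exact ((Complex.continuous_ofReal.comp h1).mul h3).add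
        ((Complex.continuous_ofReal.comp h2).mul h4)
  · rw [h.deriv_lift hk]
    refine mul_ne_zero ?_ fun h0 => ?_
    · exact_mod_cast (h.relSpeed_pos hk t).ne'
    · have := refVel_normSq hk t
      rw [h0] at this
      simp only [Complex.zero_re, Complex.zero_im, mul_zero, add_zero] at this
      have hpos : 0 < 1 / (k - Real.sin t) ^ 2 := by have := den_pos hk t; positivity
      linarith

lemma geodCurv_eq (hk : 1 < k) (hK : ContDiff ℝ 1 K) (h : IsSolution k K ε q v) (t : ℝ) :
    geodCurv (fun x => omegaAt k (q x) x) t =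
      k + ε * K (lift (fun x => omegaAt k (q x) x) t) := by
  have hD := den_pos hk t
  have hs := sk_pos hk
  have hs2 := sk_sq hk
  have hc2 : Real.cos t ^ 2 = 1 - Real.sin t ^ 2 := by linarith [Real.sin_sq_add_cos_sq t]
  have hw := h.wgt_pos hk (Circle.exp t)
  have hq := h.im_pos (Circle.exp t)
  have hl := h.relSpeed_pos hk t
  have hlift : lift (fun x => omegaAt k (q x) x) t = loopCurve k q t := lift_omegaAt k q t
  have him : (loopCurve k q t).im = (q (Circle.exp t)).im * (sk k / (k - Real.sin t)) := by
    simp [loopCurve, refCurve]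
  have hwe := wgt_circleExp k K ε q t
  have hld : relSpeed k K ε q t * wgt k K ε (Circle.exp t) (q (Circle.exp t)) =
      (q (Circle.exp t)).im * sk k ^ 2 := by
    rw [relSpeed]; field_simp
  have hnorm : hypNorm (loopCurve k q t) ((relSpeed k K ε q t : ℂ) * refVel k t) =
      relSpeed k K ε q t / ((q (Circle.exp t)).im * sk k) := by
    have e : hypInner (loopCurve k q t) ((relSpeed k K ε q t : ℂ) * refVel k t)
        ((relSpeed k K ε q t : ℂ) * refVel k t) =
        (relSpeed k K ε q t / ((q (Circle.exp t)).im * sk k)) ^ 2 := by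
      rw [hypInner, Complex.re_ofReal_mul, Complex.im_ofReal_mul, him]
      have := refVel_normSq hk t
      calc _ = relSpeed k K ε q t ^ 2 * ((refVel k t).re * (refVel k t).re +
            (refVel k t).im * (refVel k t).im) /
            ((q (Circle.exp t)).im * (sk k / (k - Real.sin t))) ^ 2 := by ring
        _ = _ := by rw [this]; field_simp
    rw [hypNorm, e, Real.sqrt_sq (by positivity)]
  rw [geodCurv, covDeriv, h.deriv_deriv_lift hk hK, h.deriv_lift hk, hlift, hnorm, hypInner, him]
  rw [hwe] at hld
  beta_reduce
  generalize relSpeed k K ε q t = l at *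
  generalize relAcc k K ε q v t = l'
  generalize K (loopCurve k q t) = κ at *
  generalize (q (Circle.exp t)).im = a at *
  -- The definition of the relative speed, solved for the curvature perturbation, reduces the claim
  -- to an algebraic identity for the reference circle.
  have hεκ : ε * κ = (a * sk k ^ 2 / l - sk k ^ 2) / (k - Real.sin t) := by
    field_simp
    linarith
  rw [hεκ]
  rw [inner_curvature, refVel_normSq hk, refVel_det_refAcc hk]
  simp only [refVel]
  field_simp
  linear_combination l * hs2

end IsSolution

/-! ### Quantitative bounds, embeddedness and convergence -/

/-- The deviations vanish at `ε = 0`: the velocity, the derivative of the weight and the gap between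
the weight and `sk k ^ 2` all carry a factor `ε`, with constants depending only on `R`, `k` and `K`.
-/
lemma exists_velocity_bounds {k : ℝ} (hk : 1 < k) {K : ℂ → ℝ} (hK : IsTruncated K) {R : ℝ}
    (hR : 0 ≤ R) : ∃ C : ℝ, 0 ≤ C ∧ ∀ ε : ℝ, |ε| ≤ 1 → ∀ q v : C(Circle, ℂ),
      IsSolution k K ε q v → (∀ x, ‖q x‖ ≤ R) →
      (∀ x, ‖v x‖ ≤ C * |ε|) ∧
      (∀ t, |relSpeed k K ε q t - (q (Circle.exp t)).im| ≤ C * |ε|) ∧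
      (∀ t, |relAcc k K ε q v t| ≤ C * |ε|) := by
  have hs := sk_pos hk
  obtain ⟨W, hW, w0, w1, -⟩ := exists_norm_ref_le hk
  obtain ⟨MK, LK, hMK, -, hKb, -⟩ := exists_bounds_of_hasCompactSupport hK.contDiff hK.compact
  obtain ⟨D, hD⟩ := (hK.compact.fderiv (𝕜 := ℝ)).exists_bound_of_continuous
    (hK.contDiff.continuous_fderiv (by norm_num))
  have hD0 : 0 ≤ D := (norm_nonneg _).trans (hD 0)
  have hk0 : 0 < k := by linarith
  set σ := sk k ^ 2 with hσ
  have hσ0 : 0 < σ := by positivity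
  set C₁ := MK * R * (σ / 2)⁻¹ with hC₁
  set C₂ := R * (MK * (k + 1)) * (σ / 2)⁻¹ with hC₂
  set C₃ := D * ((1 + 2 * W) * (R + C₁)) * (k + 1) + MK with hC₃
  set C₄ := C₁ * σ * (σ / 2)⁻¹ + R * σ * C₃ * ((σ / 2)⁻¹) ^ 2 with hC₄
  have p1 : 0 ≤ C₁ := by positivity
  have p2 : 0 ≤ C₂ := by positivity
  have p3 : 0 ≤ C₃ := by positivity
  have p4 : 0 ≤ C₄ := by positivity
  refine ⟨C₁ + C₂ + C₄, by positivity, fun ε hε q v h hq => ?_⟩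
  have hqi : ∀ x, |(q x).im| ≤ R := fun x => (Complex.abs_im_le_norm _).trans (hq x)
  have hw : ∀ x, (wgt k K ε x (q x))⁻¹ ≤ (σ / 2)⁻¹ := fun x =>
    inv_anti₀ (by positivity) (h.wgt_lower x)
  have hw0 : ∀ x, 0 < (wgt k K ε x (q x))⁻¹ := fun x => inv_pos.2 (h.wgt_pos hk x)
  have hv : ∀ x, ‖v x‖ ≤ C₁ * |ε| := fun x => by
    rw [h.eq x, norm_I_mul_circle, norm_neg, Complex.norm_real, Real.norm_eq_abs, abs_mul,
      div_eq_mul_inv, abs_mul, abs_mul, abs_of_pos (hw0 x)]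
    have := (hw0 x).le
    calc _ ≤ |ε| * (MK * R * (σ / 2)⁻¹) := by
          gcongr
          exacts [hKb _, hqi x, h.wgt_lower x]
      _ = _ := by rw [hC₁]; ring
  have hden : ∀ t, |k - Real.sin t| ≤ k + 1 := fun t => by
    rw [abs_of_pos (den_pos hk t)]; linarith [Real.neg_one_le_sin t]
  refine ⟨fun x => (hv x).trans ?_, fun t => ?_, fun t => ?_⟩
  · gcongr; linarith
  · have e : relSpeed k K ε q t - (q (Circle.exp t)).im = -(ε * ((q (Circle.exp t)).im *
        (K (loopCurve k q t) * (k - Real.sin t)) *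
        (wgt k K ε (Circle.exp t) (q (Circle.exp t)))⁻¹)) := by
      have h1 := (h.wgt_pos hk (Circle.exp t)).ne'
      have h2 := wgt_circleExp k K ε q t
      rw [relSpeed]
      field_simp
      rw [h2]; ring
    rw [e, abs_neg, abs_mul, abs_mul, abs_mul, abs_mul, abs_of_pos (hw0 _)]
    have := (hw0 (Circle.exp t)).le
    calc _ ≤ |ε| * (R * (MK * (k + 1)) * (σ / 2)⁻¹) := by
          gcongr
          exacts [hqi _, hKb _, hden t, h.wgt_lower _]
      _ = C₂ * |ε| := by rw [hC₂]; ring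
      _ ≤ _ := by gcongr; linarith
  · have e : relAcc k K ε q v t = (v (Circle.exp t)).im * σ *
        (wgt k K ε (Circle.exp t) (q (Circle.exp t)))⁻¹ - (q (Circle.exp t)).im * σ *
        wgtVel k K ε q v t * ((wgt k K ε (Circle.exp t) (q (Circle.exp t)))⁻¹) ^ 2 := by
      have h1 := (h.wgt_pos hk (Circle.exp t)).ne'
      rw [relAcc, hσ]
      field_simp
    have hvel : ‖loopVel k q v t‖ ≤ (1 + 2 * W) * (R + C₁) := by
      refine norm_loopVel_le (w0 t) (w1 t) ((hq _).trans (by linarith)) ((hv _).trans ?_)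
      calc C₁ * |ε| ≤ C₁ * 1 := by gcongr
        _ ≤ _ := by linarith
    have hwv : |wgtVel k K ε q v t| ≤ |ε| * C₃ := by
      rw [wgtVel, abs_mul]
      gcongr
      refine (abs_add_le _ _).trans ?_
      rw [abs_mul, abs_mul, abs_neg, hC₃]
      have f1 : |fderiv ℝ K (loopCurve k q t) (loopVel k q v t)| ≤ D * ((1 + 2 * W) * (R + C₁)) :=
        (ContinuousLinearMap.le_opNorm (fderiv ℝ K (loopCurve k q t)) _).trans
          (mul_le_mul (hD _) hvel (norm_nonneg _) hD0)
      have f2 := hKb (loopCurve k q t)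
      have f3 := Real.abs_cos_le_one t
      calc _ ≤ D * ((1 + 2 * W) * (R + C₁)) * (k + 1) + MK * 1 := by
            gcongr
            exact hden t
        _ = _ := by ring
    have hvi : |(v (Circle.exp t)).im| ≤ C₁ * |ε| := (Complex.abs_im_le_norm _).trans (hv _)
    rw [e]
    refine (abs_sub _ _).trans ?_
    rw [abs_mul, abs_mul, abs_mul _ ((wgt k K ε (Circle.exp t) (q (Circle.exp t)))⁻¹ ^ 2), abs_mul,
      abs_mul, abs_of_pos hσ0, abs_of_pos (hw0 _), abs_of_pos (pow_pos (hw0 _) 2)]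
    have g1 := hw (Circle.exp t)
    have g2 := (hw0 (Circle.exp t)).le
    calc _ ≤ C₁ * |ε| * σ * (σ / 2)⁻¹ + R * σ * (|ε| * C₃) * ((σ / 2)⁻¹) ^ 2 := by
          gcongr
          exact hqi _
      _ = C₄ * |ε| := by rw [hC₄]; ring
      _ ≤ _ := by gcongr; linarith

/-- Lipschitz bound in terms of the chord. -/
lemma HasVel.norm_sub_le {q v : C(Circle, ℂ)} (h : HasVel q v) {C : ℝ} (hC : 0 ≤ C)
    (hv : ∀ x, ‖v x‖ ≤ C) (x y : Circle) : ‖q x - q y‖ ≤ C * (Real.pi / 2 * ‖(x : ℂ) - y‖) := by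
  obtain ⟨s, -, rfl⟩ := exists_angle y
  -- The principal argument selects the shorter arc, whose length is at most `π/2` times the chord.
  set θ := ((x : ℂ) / Circle.exp s).arg with hθ
  have hx : x = Circle.exp (s + θ) := by
    have h1 : Circle.exp θ = x / Circle.exp s := by
      rw [hθ, ← Circle.coe_div, Circle.exp_arg]
    rw [Circle.exp_add, h1, mul_div_cancel]
  have hang := Complex.angle_le_mul_norm_sub (Circle.norm_coe x) (Circle.norm_coe (Circle.exp s))
  rw [Complex.angle_eq_abs_arg (Circle.coe_ne_zero _) (Circle.coe_ne_zero _), ← hθ] at hang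
  have hmv := (convex_univ (𝕜 := ℝ) (E := ℝ)).norm_image_sub_le_of_norm_hasDerivWithin_le
    (f := fun t => q (Circle.exp t)) (fun t _ => (h t).hasDerivWithinAt) (fun t _ => hv _)
    (Set.mem_univ s) (Set.mem_univ (s + θ))
  rw [add_sub_cancel_left, Real.norm_eq_abs, ← hx] at hmv
  refine hmv.trans ?_
  gcongr

lemma omegaAt_re (k : ℝ) (q : ℂ) (x : Circle) :
    (omegaAt k q x).re = q.re + q.im * ((x : ℂ).re / (k - (x : ℂ).im)) := by
  obtain ⟨t, -, rfl⟩ := exists_angle x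
  have := loopCurve_eq_omegaAt k (fun _ => q) t
  rw [← this, coe_circleExp]
  simp [loopCurve, refCurve]

lemma omegaAt_im (k : ℝ) (q : ℂ) (x : Circle) :
    (omegaAt k q x).im = q.im * (sk k / (k - (x : ℂ).im)) := by
  obtain ⟨t, -, rfl⟩ := exists_angle x
  have := loopCurve_eq_omegaAt k (fun _ => q) t
  rw [← this, coe_circleExp]
  simp [loopCurve, refCurve]

/-- Equality of heights gives `b₂ (y₂ - x₂) = (a₂ - b₂)(k - y₂)`. Inserted in the equality of
abscissas it gives `a₂ (x₁ - y₁) = (b₁ - a₁)(k - x₂)`. -/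
lemma norm_sub_le_of_omegaAt_eq {k : ℝ} (hk : 1 < k) {m : ℝ} (hm : 0 < m) {a b : ℂ}
    (ha : m ≤ a.im) (hb : m ≤ b.im) {x y : Circle} (h : omegaAt k a x = omegaAt k b y) :
    ‖(x : ℂ) - y‖ ≤ 2 * (k + 1) / m * ‖a - b‖ := by
  have hre := congrArg Complex.re h
  have him := congrArg Complex.im h
  rw [omegaAt_re, omegaAt_re] at hre
  rw [omegaAt_im, omegaAt_im] at him
  have hs := sk_pos hk
  have dx := circle_den_pos hk x
  have dy := circle_den_pos hk y
  have bx := abs_le.1 (abs_circle_im_le x)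
  have by' := abs_le.1 (abs_circle_im_le y)
  set dX := k - (x : ℂ).im with hdX
  set dY := k - (y : ℂ).im with hdY
  have hbpos := hm.trans_le hb
  have hapos := hm.trans_le ha
  have him' : a.im * dY = b.im * dX := by
    field_simp at him
    linarith
  have n1 := Complex.abs_im_le_norm (a - b)
  have n2 := Complex.abs_re_le_norm (a - b)
  rw [Complex.sub_im] at n1
  rw [Complex.sub_re] at n2
  have e1 : b.im * ((y : ℂ).im - (x : ℂ).im) = (a.im - b.im) * dY := by
    rw [hdX, hdY] at him'
    rw [hdY]
    linarith
  have i1 : |((x : ℂ) - y).im| ≤ (k + 1) / m * ‖a - b‖ := by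
    have : b.im * |((x : ℂ) - y).im| ≤ ‖a - b‖ * (k + 1) := by
      rw [Complex.sub_im, abs_sub_comm, ← abs_of_pos hbpos, ← abs_mul, e1,
        abs_mul, abs_of_pos dy]
      gcongr
      linarith
    rw [div_mul_eq_mul_div, le_div_iff₀ hm]
    calc _ ≤ |((x : ℂ) - y).im| * b.im := by gcongr
      _ ≤ _ := by linarith
  have e2 : a.im * ((x : ℂ).re - (y : ℂ).re) = (b.re - a.re) * dX := by
    have h1 : b.im * ((y : ℂ).re / dY) = a.im * ((y : ℂ).re / dX) := by
      field_simp
      linear_combination (-(y : ℂ).re) * him'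
    rw [h1] at hre
    field_simp at hre
    linarith
  have i2 : |((x : ℂ) - y).re| ≤ (k + 1) / m * ‖a - b‖ := by
    have : a.im * |((x : ℂ) - y).re| ≤ ‖a - b‖ * (k + 1) := by
      rw [Complex.sub_re, ← abs_of_pos hapos, ← abs_mul, e2,
        abs_mul, abs_of_pos dx, abs_sub_comm]
      gcongr
      linarith
    rw [div_mul_eq_mul_div, le_div_iff₀ hm]
    calc _ ≤ |((x : ℂ) - y).re| * a.im := by gcongr
      _ ≤ _ := by linarith
  calc ‖(x : ℂ) - y‖ ≤ |((x : ℂ) - y).re| + |((x : ℂ) - y).im| :=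
        Complex.norm_le_abs_re_add_abs_im _
    _ ≤ (k + 1) / m * ‖a - b‖ + (k + 1) / m * ‖a - b‖ := add_le_add i2 i1
    _ = _ := by ring

/-- At a double point the chord `|x - y|` is controlled by `|q(x) - q(y)|`, which the small velocity
bounds by a fraction of the same chord. -/
lemma injective_of_norm_vel_le {k : ℝ} (hk : 1 < k) {m η : ℝ} (hm : 0 < m) (hη : 0 ≤ η)
    (hsmall : 2 * (k + 1) / m * (η * (Real.pi / 2)) < 1) {q v : C(Circle, ℂ)} (h : HasVel q v)
    (hq : ∀ x, m ≤ (q x).im) (hv : ∀ x, ‖v x‖ ≤ η) :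
    Function.Injective fun x => omegaAt k (q x) x := by
  intro x y hxy
  have h1 := norm_sub_le_of_omegaAt_eq hk hm (hq x) (hq y) hxy
  have h2 := h.norm_sub_le hη hv x y
  have h3 : ‖(x : ℂ) - y‖ ≤ 2 * (k + 1) / m * (η * (Real.pi / 2)) * ‖(x : ℂ) - y‖ := by
    refine h1.trans ?_
    have h4 : 0 ≤ 2 * (k + 1) / m := by
      have : 0 < k := by linarith
      positivity
    calc _ ≤ 2 * (k + 1) / m * (η * (Real.pi / 2 * ‖(x : ℂ) - y‖)) := by gcongr
      _ = _ := by ring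
  have h5 : ‖(x : ℂ) - y‖ = 0 := by
    by_contra hne
    have hpos : 0 < ‖(x : ℂ) - y‖ := lt_of_le_of_ne (norm_nonneg _) (Ne.symm hne)
    nlinarith
  exact Circle.ext (sub_eq_zero.1 (norm_eq_zero.1 h5))

lemma iteratedDeriv_two (f : ℝ → ℂ) : iteratedDeriv 2 f = deriv (deriv f) := by
  rw [iteratedDeriv_succ, iteratedDeriv_one]

lemma isSolution_zero {k : ℝ} {K : ℂ → ℝ} {z : ℂ} (hz : 0 < z.im) :
    IsSolution k K 0 (ContinuousMap.const _ z) 0 :=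
  ⟨hasVel_const z, fun _ => hz,
    fun x => by simp only [wgt, zero_mul, add_zero]; nlinarith [sq_nonneg (sk k)],
    fun x => by simp⟩

/-- Quantitative `C²` estimate for the distance from a solution to a circle. -/
lemma exists_C2_bound {k : ℝ} (hk : 1 < k) {K : ℂ → ℝ} (hK : IsTruncated K) {R : ℝ}
    (hR : 0 ≤ R) : ∃ C : ℝ, 0 ≤ C ∧ ∀ ε : ℝ, |ε| ≤ 1 → ∀ q v : C(Circle, ℂ),
      IsSolution k K ε q v → (∀ x, ‖q x‖ ≤ R) → ∀ z : ℂ, 0 < z.im → ∀ δ : ℝ,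
      (∀ x, ‖q x - z‖ ≤ δ) → ∀ j ≤ 2, ∀ t,
      ‖iteratedDeriv j (lift fun x => omegaAt k (q x) x) t - iteratedDeriv j (lift (omegaAt k z)) t‖
        ≤ C * (|ε| + δ) := by
  obtain ⟨W, hW, w0, w1, w2⟩ := exists_norm_ref_le hk
  obtain ⟨C, hC, hmain⟩ := exists_velocity_bounds hk hK hR
  have hs := sk_pos hk
  refine ⟨(1 + W) + (C + 1) * W + C * W, by positivity, ?_⟩
  intro ε hε q v h hq z hz δ hδ j hj t
  have hδ0 : 0 ≤ δ := (norm_nonneg _).trans (hδ 1)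
  obtain ⟨-, hl, hl'⟩ := hmain ε hε q v h hq
  -- The circle is the solution with parameter `0`, so the same formulas for the first two
  -- derivatives apply to both loops.
  have h0 : IsSolution k K 0 (ContinuousMap.const _ z) 0 := isSolution_zero hz
  have e0 : omegaAt k z = fun x => omegaAt k ((ContinuousMap.const Circle z) x) x := rfl
  have hs0 : ∀ t, relSpeed k K 0 (ContinuousMap.const Circle z) t = z.im := fun t => by
    have := pow_pos hs 2
    simp [relSpeed, wgt]
    field_simp
  have ha0 : ∀ t, relAcc k K 0 (ContinuousMap.const Circle z) (0 : C(Circle, ℂ)) t = 0 :=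
      fun t => by
    simp [relAcc, wgtVel]
  have hld : |relSpeed k K ε q t - z.im| ≤ C * |ε| + δ := by
    have h1 := (Complex.abs_im_le_norm (q (Circle.exp t) - z)).trans (hδ _)
    rw [Complex.sub_im] at h1
    calc _ = |(relSpeed k K ε q t - (q (Circle.exp t)).im) + ((q (Circle.exp t)).im - z.im)| := by
          congr 1; ring
      _ ≤ _ := (abs_add_le _ _).trans (add_le_add (hl t) h1)
  have hε0 := abs_nonneg ε
  have hb : C * |ε| + δ ≤ (C + 1) * (|ε| + δ) := by nlinarith
  have hpos : 0 ≤ |ε| + δ := by positivity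
  have q1 : 0 ≤ (1 + W) * (|ε| + δ) := by positivity
  have q2 : 0 ≤ (C + 1) * W * (|ε| + δ) := by positivity
  have q3 : 0 ≤ C * W * (|ε| + δ) := by positivity
  have hn : ∀ w : ℂ, ‖w‖ ≤ W → ‖((relSpeed k K ε q t : ℂ) - z.im) * w‖ ≤
      (C + 1) * W * (|ε| + δ) := fun w hw => by
    rw [← Complex.ofReal_sub, norm_mul, Complex.norm_real, Real.norm_eq_abs]
    calc _ ≤ (C + 1) * (|ε| + δ) * W := by gcongr; exact hld.trans hb
      _ = _ := by ring
  interval_cases j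
  · simp only [iteratedDeriv_zero]
    rw [e0, lift_omegaAt, lift_omegaAt]
    have e : (((q (Circle.exp t)).re : ℂ) + ((q (Circle.exp t)).im : ℂ) * refCurve k t) -
        ((((ContinuousMap.const Circle z) (Circle.exp t)).re : ℂ) +
          (((ContinuousMap.const Circle z) (Circle.exp t)).im : ℂ) * refCurve k t) =
        loopCurve k (fun x => q x - z) t := by
      simp [loopCurve]; ring
    rw [e]
    refine (norm_loopCurve_le (w0 t) (hδ _)).trans ?_
    nlinarith
  · rw [iteratedDeriv_one, iteratedDeriv_one, e0, h.deriv_lift hk, h0.deriv_lift hk]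
    simp only [hs0]
    rw [← sub_mul]
    refine (hn _ (w1 t)).trans ?_
    nlinarith
  · rw [iteratedDeriv_two, iteratedDeriv_two, e0, h.deriv_deriv_lift hk hK.contDiff,
      h0.deriv_deriv_lift hk hK.contDiff]
    simp only [hs0, ha0]
    have e : (relAcc k K ε q v t : ℂ) * refVel k t + (relSpeed k K ε q t : ℂ) * refAcc k t -
        (((0 : ℝ) : ℂ) * refVel k t + (z.im : ℂ) * refAcc k t) =
        (relAcc k K ε q v t : ℂ) * refVel k t +
          ((relSpeed k K ε q t : ℂ) - z.im) * refAcc k t := by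
      push_cast; ring
    rw [e]
    refine (norm_add_le _ _).trans ?_
    have n1 : ‖(relAcc k K ε q v t : ℂ) * refVel k t‖ ≤ C * W * (|ε| + δ) := by
      rw [norm_mul, Complex.norm_real, Real.norm_eq_abs]
      calc _ ≤ C * |ε| * W := by gcongr; exacts [hl' t, w1 t]
        _ ≤ C * (|ε| + δ) * W := by gcongr; linarith
        _ = _ := by ring
    have n2 := hn _ (w2 t)
    nlinarith

/-! ### Truncation and the main theorem -/

/-- A cutoff equal to `1` near `N` and supported in a compact subset of the half-plane; the product
vanishes near every point outside, whatever values `K` takes there. -/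
lemma exists_truncation {K : ℂ → ℝ} (hK : ContDiffOn ℝ 1 K halfPlane) {N : Set ℂ}
    (hN : IsCompact N) (hsub : N ⊆ halfPlane) : ∃ L, IsTruncated L ∧ Set.EqOn L K N := by
  obtain ⟨N', hN', h1, h2⟩ := exists_compact_between hN isOpen_halfPlane hsub
  obtain ⟨χ, χ1, χ0, -⟩ := exists_contMDiffMap_one_nhds_of_subset_interior
    (modelWithCornersSelf ℝ ℂ) hN.isClosed h1 (n := 1)
  have hχ : ContDiff ℝ 1 χ := χ.contMDiff.contDiff
  have hts : tsupport χ ⊆ N' := closure_minimal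
    (fun z hz => by_contra fun h => hz (χ0 z h)) hN'.isClosed
  have htm : tsupport (fun z => χ z * K z) ⊆ N' := (tsupport_mul_subset_left).trans hts
  refine ⟨fun z => χ z * K z, ⟨contDiff_iff_contDiffAt.2 fun z => ?_,
    HasCompactSupport.of_support_subset_isCompact hN' (subset_closure.trans htm),
    htm.trans h2⟩, fun z hz => ?_⟩
  · by_cases hz : z ∈ halfPlane
    · exact hχ.contDiffAt.mul (hK.contDiffAt (isOpen_halfPlane.mem_nhds hz))
    · have : (fun z => χ z * K z) =ᶠ[𝓝 z] fun _ => 0 := by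
        rw [← Pi.zero_def]
        exact notMem_tsupport_iff_eventuallyEq.1 fun h => hz (h2 (htm h))
      exact contDiffAt_const.congr_of_eventuallyEq this
  · have := χ1.self_of_nhdsSet z hz
    simp [this]

lemma isCompact_slab (m R : ℝ) : IsCompact {z : ℂ | m ≤ z.im ∧ ‖z‖ ≤ R} := by
  refine (isCompact_closedBall (0 : ℂ) R).of_isClosed_subset ?_ fun z hz => by simpa using hz.2
  exact (isClosed_le continuous_const Complex.continuous_im).inter
    (isClosed_le continuous_norm continuous_const)

/-- A compact subset of the half-plane containing all the disks and all the circles with centre in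
a given rectangle. -/
lemma exists_compact_superset_disks {k : ℝ} (hk : 1 < k) {m : ℝ} (hm : 0 < m) (R : ℝ) :
    ∃ N : Set ℂ, IsCompact N ∧ N ⊆ halfPlane ∧ ∀ z : ℂ, m ≤ z.im → ‖z‖ ≤ R →
      hypDisk z (rho k) ⊆ N ∧ ∀ x, omegaAt k z x ∈ N := by
  have hs := sk_pos hk
  set P := {z : ℂ | m ≤ z.im ∧ ‖z‖ ≤ R}
  have hP : IsCompact P := isCompact_slab m R
  set f : ℂ × ℂ → ℂ := fun p => (p.1.re + (p.1.im * k / sk k : ℝ) * Complex.I) +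
    (p.1.im / sk k : ℝ) * p.2 with hf
  have hfc : Continuous f := by
    have h1 : Continuous fun p : ℂ × ℂ => p.1.re := Complex.continuous_re.comp continuous_fst
    have h2 : Continuous fun p : ℂ × ℂ => p.1.im := Complex.continuous_im.comp continuous_fst
    fun_prop
  refine ⟨f '' (P ×ˢ Metric.closedBall 0 1) ∪
    (fun p : Circle × ℂ => omegaAt k p.2 p.1) '' (Set.univ ×ˢ P),
    ((hP.prod (isCompact_closedBall _ _)).image hfc).union
      ((isCompact_univ.prod hP).image (continuous_omegaAt hk)), ?_, fun z hz hzR => ⟨?_, ?_⟩⟩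
  · rintro _ (⟨⟨z, w⟩, ⟨hz, hw⟩, rfl⟩ | ⟨⟨x, z⟩, ⟨-, hz⟩, rfl⟩)
    · have hz0 : 0 < z.im := hm.trans_le hz.1
      have hw1 : -1 ≤ w.im := by
        have := (abs_le.1 (Complex.abs_im_le_norm w)).1
        have h' : ‖w‖ ≤ 1 := by simpa using hw
        linarith
      change 0 < (f (z, w)).im
      have e : (f (z, w)).im = z.im / sk k * (k + w.im) := by
        simp [hf]; ring
      rw [e]
      exact mul_pos (div_pos hz0 hs) (by linarith)
    · change 0 < (omegaAt k z x).im
      rw [omegaAt_im]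
      exact mul_pos (hm.trans_le hz.1) (div_pos hs (circle_den_pos hk x))
  · intro w hw
    have hz0 : 0 < z.im := hm.trans_le hz
    have hr : 0 < z.im / sk k := div_pos hz0 hs
    rw [hypDisk_eq hk hz0, Metric.mem_ball, dist_eq_norm] at hw
    refine Or.inl ⟨(z, (w - (z.re + (z.im * k / sk k : ℝ) * Complex.I)) / (z.im / sk k : ℝ)),
      ⟨⟨hz, hzR⟩, ?_⟩, ?_⟩
    · rw [mem_closedBall_zero_iff, norm_div, Complex.norm_real, Real.norm_of_nonneg hr.le]
      exact (div_le_one hr).2 hw.le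
    · simp only [hf]
      rw [mul_div_cancel₀ _ (Complex.ofReal_ne_zero.2 hr.ne'), add_sub_cancel]
  · exact fun x => Or.inr ⟨(x, z), ⟨trivial, hz, hzR⟩, rfl⟩

lemma measurableSet_hypDisk {k : ℝ} (hk : 1 < k) {z : ℂ} (hz : 0 < z.im) :
    MeasurableSet (hypDisk z (rho k)) := by
  rw [hypDisk_eq hk hz]; exact measurableSet_ball

lemma melnikov_congr {k : ℝ} (hk : 1 < k) {K L : ℂ → ℝ} {z : ℂ} (hz : 0 < z.im)
    (h : Set.EqOn K L (hypDisk z (rho k))) : melnikov k K z = melnikov k L z :=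
  setIntegral_congr_fun (measurableSet_hypDisk hk hz) fun w hw => by
    simp only [h hw]

/-- Agreement on an open neighbourhood of the closure is used because the norm involves full
derivatives at boundary points. -/
lemma HasStableCriticalPt.congr {X Y : ℂ → ℝ} {A U : Set ℂ} (h : HasStableCriticalPt X A)
    (hU : IsOpen U) (hAU : closure A ⊆ U) (hXY : Set.EqOn X Y U) : HasStableCriticalPt Y A := by
  obtain ⟨r, hr, H⟩ := h
  refine ⟨r, hr, fun G hG hGr => H G hG ?_⟩
  convert hGr using 1
  unfold c1Norm
  congr 2
  · exact Set.image_congr fun z hz => by simp only [hXY (hAU hz)]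
  · refine Set.image_congr fun z hz => ?_
    rw [EventuallyEq.fderiv_eq]
    filter_upwards [hU.mem_nhds (hAU hz)] with w hw
    rw [hXY hw]

/-- The loops of the theorem, together with approximate centres. -/
lemma exists_family {k : ℝ} (hk : 1 < k) {K : ℂ → ℝ} (hK : ContDiffOn ℝ 1 K halfPlane)
    {A : Set ℂ} (hA : CompactlyInside A) (hF : HasStableCriticalPt (melnikov k K) A) :
    ∃ ε₀ : ℝ, 0 < ε₀ ∧ ∃ (u : ℝ → Circle → ℂ) (z : ℝ → ℂ),
      (∀ ε, |ε| < ε₀ → IsEmbeddedKLoop (fun w => k + ε * K w) (u ε) ∧ z ε ∈ A) ∧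
      ∀ {ι : Type} (l : Filter ι) [l.NeBot] (e : ι → ℝ) (z₀ : ℂ), z₀ ∈ closure A →
        Tendsto e l (𝓝 0) → Tendsto (fun i => z (e i)) l (𝓝 z₀) →
        IsCriticalPt (melnikov k K) z₀ ∧ C2Tendsto (fun i => u (e i)) l (omegaAt k z₀) := by
  obtain ⟨m, R, hm, hR, hbox⟩ := exists_rectangle hA
  -- The margins `m / 2` and `R + 1` leave room for `q` to oscillate around a centre in `A`, so the
  -- loops stay where `L = K`.
  obtain ⟨N, hNc, hNsub, hN⟩ := exists_compact_superset_disks hk (half_pos hm) (R + 1)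
  obtain ⟨L, hL, hLK⟩ := exists_truncation hK hNc hNsub
  set U := {z : ℂ | m / 2 < z.im ∧ ‖z‖ < R + 1} with hU
  have hUo : IsOpen U := (isOpen_lt continuous_const Complex.continuous_im).inter
    (isOpen_lt continuous_norm continuous_const)
  have hAU : closure A ⊆ U := fun z hz => ⟨by linarith [(hbox z hz).1], by linarith [(hbox z hz).2]⟩
  have hKL : Set.EqOn (melnikov k K) (melnikov k L) U := fun z hz =>
    melnikov_congr hk ((half_pos hm).trans hz.1) fun w hw =>
      (hLK ((hN z hz.1.le hz.2.le).1 hw)).symm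
  obtain ⟨ε₁, hε₁, C, hC, hsol⟩ := exists_solution hk hL hA (hF.congr hUo hAU hKL)
  have hR1 : 0 ≤ R + 1 := by linarith
  obtain ⟨Cv, hCv, hvel⟩ := exists_velocity_bounds hk hL hR1
  obtain ⟨C₂, hC₂, hbound⟩ := exists_C2_bound hk hL hR1
  have hlim : ∀ c : ℝ, Tendsto (fun ε : ℝ => c * |ε|) (𝓝 0) (𝓝 0) := fun c => by
    have : Continuous fun ε : ℝ => c * |ε| := by fun_prop
    simpa using this.tendsto 0
  have hsmall : ∀ᶠ ε : ℝ in 𝓝 0, 1 * |ε| < ε₁ ∧ 1 * |ε| < 1 ∧ C * |ε| < 1 ∧ C * |ε| < m / 2 ∧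
      (2 * (k + 1) / (m / 2) * (Cv * (Real.pi / 2))) * |ε| < 1 :=
    ((hlim _).eventually_lt_const hε₁).and <| ((hlim _).eventually_lt_const one_pos).and <|
      ((hlim _).eventually_lt_const one_pos).and <| ((hlim _).eventually_lt_const (half_pos hm)).and
      ((hlim _).eventually_lt_const one_pos)
  obtain ⟨ε₀, hε₀, hball⟩ := Metric.eventually_nhds_iff.1 hsmall
  simp only [Real.dist_eq, sub_zero, one_mul] at hball
  choose! z hzA q v hqv hqz hbd using hsol
  have hqm : ∀ ε, |ε| < ε₀ → ∀ x, m / 2 ≤ (q ε x).im ∧ ‖q ε x‖ ≤ R + 1 := fun ε hε x => by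
    obtain ⟨h1, -, h3, h4, -⟩ := hball hε
    have hz := hbox _ (subset_closure (hzA ε h1))
    have hd := hqz ε h1 x
    constructor
    · have := (abs_le.1 ((Complex.abs_im_le_norm _).trans hd)).1
      rw [Complex.sub_im] at this
      linarith [hz.1]
    · have := norm_sub_norm_le (q ε x) (z ε)
      linarith [hz.2]
  refine ⟨ε₀, hε₀, fun ε x => omegaAt k (q ε x) x, z, fun ε hε => ⟨?_, hzA ε (hball hε).1⟩, ?_⟩
  · obtain ⟨h1, h2, h3, h4, h5⟩ := hball hε
    have hs := hqv ε h1
    refine ⟨hs.isLoop hk hL.contDiff, ?_, fun t => ?_⟩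
    · refine injective_of_norm_vel_le hk (half_pos hm) (η := Cv * |ε|) (by positivity) ?_ hs.vel
        (fun x => (hqm ε hε x).1) (hvel ε h2.le _ _ hs fun x => (hqm ε hε x).2).1
      calc _ = (2 * (k + 1) / (m / 2) * (Cv * (Real.pi / 2))) * |ε| := by ring
        _ < 1 := h5
    · rw [hs.geodCurv_eq hk hL.contDiff]
      have := hqm ε hε (Circle.exp t)
      have := hLK ((hN _ this.1 this.2).2 (Circle.exp t))
      simp only [lift, this]
  · intro ι l _ e z₀ hz₀ he hz
    have hz₀U := hAU hz₀
    have hz₀0 : 0 < z₀.im := (half_pos hm).trans hz₀U.1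
    have habs : Tendsto (fun i => |e i|) l (𝓝 0) := by simpa using he.abs
    have hev : ∀ᶠ i in l, |e i| < ε₀ := habs.eventually_lt_const hε₀
    refine ⟨?_, fun j hj => ?_⟩
    -- The boundary integral at the approximate centres is `O(ε)`, so by continuity it vanishes at
    -- their limit.
    · have hb0 : bdry k L z₀ = 0 := by
        have t1 : Tendsto (fun i => bdry k L (z (e i))) l (𝓝 (bdry k L z₀)) :=
          ((continuousOn_bdry hk hL.contDiff.continuous).continuousAt
            (isOpen_halfPlane.mem_nhds hz₀0)).tendsto.comp hz
        have t2 : Tendsto (fun i => bdry k L (z (e i))) l (𝓝 0) := by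
          refine squeeze_zero_norm' ?_ ((hlim C).comp he)
          filter_upwards [hev] with i hi using hbd _ (hball hi).1
        exact tendsto_nhds_unique t1 t2
      have hd := hasFDerivAt_melnikov hk hL hz₀0
      have h0 : detL (((sk k)⁻¹ : ℝ) * bdry k L z₀) = 0 := by
        rw [hb0, mul_zero]; ext; simp [detL]
      rw [h0] at hd
      exact hd.congr_of_eventuallyEq (hKL.eventuallyEq_of_mem (hUo.mem_nhds hz₀U))
    · rw [Metric.tendstoUniformly_iff]
      intro η hη
      have t3 : Tendsto (fun i => C₂ * (|e i| + (C * |e i| + ‖z (e i) - z₀‖))) l (𝓝 0) := by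
        have h1 : Tendsto (fun i => ‖z (e i) - z₀‖) l (𝓝 0) :=
          tendsto_iff_norm_sub_tendsto_zero.1 hz
        simpa using (habs.add ((habs.const_mul C).add h1)).const_mul C₂
      filter_upwards [hev, t3.eventually_lt_const hη] with i hi hlt t
      obtain ⟨h1, h2, -⟩ := hball hi
      rw [dist_comm, dist_eq_norm]
      refine (hbound _ h2.le _ _ (hqv _ h1) (fun x => (hqm _ hi x).2) z₀ hz₀0 _ (fun x => ?_)
        j hj t).trans_lt hlt
      calc _ = ‖(q (e i) x - z (e i)) + (z (e i) - z₀)‖ := by rw [sub_add_sub_cancel]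
        _ ≤ _ := (norm_add_le _ _).trans (by gcongr; exact hqz _ h1 x)

end HypLoop

end

/-! ### Compactness and conclusion -/

open HypLoop in
theorem theoremT (k : ℝ) (hk : 1 < k) (K : ℂ → ℝ) (hK : ContDiffOn ℝ 1 K halfPlane)
    (A : Set ℂ) (hA : CompactlyInside A) (hF : HasStableCriticalPt (melnikov k K) A) :
    ∃ ε₀ : ℝ, 0 < ε₀ ∧ ∃ u : ℝ → Circle → ℂ,
      (∀ ε : ℝ, |ε| < ε₀ → IsEmbeddedKLoop (fun z => k + ε * K z) (u ε)) ∧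
      (∀ e : ℕ → ℝ, Tendsto e atTop (𝓝 0) →
        ∃ φ : ℕ → ℕ, StrictMono φ ∧ ∃ z₀ ∈ closure A, IsCriticalPt (melnikov k K) z₀ ∧
          C2Tendsto (fun j => u (e (φ j))) atTop (omegaAt k z₀)) ∧
      (∀ z₀ ∈ A, IsCriticalPt (melnikov k K) z₀ →
        (∀ z ∈ closure A, IsCriticalPt (melnikov k K) z → z = z₀) →
        C2Tendsto u (𝓝 0) (omegaAt k z₀)) := by
  obtain ⟨ε₀, hε₀, u, z, hu, hlim⟩ := exists_family hk hK hA hF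
  have hsub : ∀ e : ℕ → ℝ, Tendsto e atTop (𝓝 0) → ∃ φ : ℕ → ℕ, StrictMono φ ∧
      ∃ z₀ ∈ closure A, Tendsto (fun j => z (e (φ j))) atTop (𝓝 z₀) := fun e he => by
    have hev : ∀ᶠ n in atTop, z (e n) ∈ closure A := by
      have habs : Tendsto (fun i => |e i|) atTop (𝓝 0) := by simpa using he.abs
      filter_upwards [habs.eventually_lt_const hε₀] with n hn
      exact subset_closure (hu _ hn).2
    obtain ⟨z₀, hz₀, φ, hφ, h⟩ := hA.2.1.tendsto_subseq' hev.frequently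
    exact ⟨φ, hφ, z₀, hz₀, h⟩
  refine ⟨ε₀, hε₀, u, fun ε hε => (hu ε hε).1, fun e he => ?_, fun z₀ hz₀ _ huniq => ?_⟩
  · obtain ⟨φ, hφ, z₀, hz₀, h⟩ := hsub e he
    obtain ⟨hcrit, hconv⟩ := hlim atTop (fun j => e (φ j)) z₀ hz₀ (he.comp hφ.tendsto_atTop) h
    exact ⟨φ, hφ, z₀, hz₀, hcrit, hconv⟩
  · refine (hlim (𝓝 0) id z₀ (subset_closure hz₀) tendsto_id ?_).2
    -- Every sequence has a subsequence along which the centres converge to a critical point, which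
    -- uniqueness forces to be `z₀`; hence the centres converge along the full filter.
    refine tendsto_of_subseq_tendsto fun e he => ?_
    obtain ⟨φ, hφ, z₁, hz₁, h⟩ := hsub e he
    have := (hlim atTop (fun j => e (φ j)) z₁ hz₁ (he.comp hφ.tendsto_atTop) h).1
    rw [huniq z₁ hz₁ this] at h
    exact ⟨φ, h⟩
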